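/- Conventions. $T^k=(S^1)^k$. A face of a polytope is a nonempty face (the polytope is a face of itself), $\mathring Q$ is the relative interior of a convex set $Q$, and $\partial V=\overline V\setminus V$ for a subset $V$ of a space. **Quasitoric manifolds.** Let $n\ge 1$ and let $P\subset\mathbb R^n$ be an $n$-dimensional simple convex polytope. A quasitoric manifold over $P$ is a smooth closed manifold $M^{2n}$ with a smooth action of $T^n$ such that (i) the action is locally standard: every point has an invariant open neighbourhood diffeomorphic to an open subset of $\mathbb C^n$ by a map that is equivariant, up to an automorphism of $T^n$, for the coordinatewise action on $\mathbb C^n$; (ii) $M/T^n$ is diffeomorphic to $P$ as a manifold with corners (corner charts of $M/T^n$ are $(|z_1|^2,\dots,|z_n|^2)$, $z$ being the coordinates of (i)). Fix a diffeomorphism $\Phi:M/T^n\to P$. **$(2n,k)$-manifolds.** Let $1\le k\le n$. Let $M^{2n}$ be a smooth, closed, orientable, simply connected manifold, with a smooth effective $T^k$-action $\theta$ with connected stabilizers, and let $\mu:M\to\mathbb R^k$ be a continuous $T^k$-invariant map that is open onto its image and whose image $P^k$ is a $k$-dimensional convex polytope. The triple $(M,\theta,\mu)$ has the structure of a $(2n,k)$-manifold,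 with almost moment map $\mu$, if the following data exist and satisfy the following axioms. 1. A smooth atlas of $M$ with one chart $\varphi_i:M_i\to\mathbb R^{2n}$, onto $\mathbb R^{2n}$, for each fixed point $x_i$, such that $M_i$ is invariant and dense, $x_i$ is the only fixed point in $M_i$, and $\varphi_i(x_i)=0$. For a set $\sigma$ of indices put $W_\sigma=\bigcap_{i\in\sigma}M_i\cap\bigcap_{i\notin\sigma}(M\setminus M_i)$ and $P_\sigma=\operatorname{conv}\{\mu(x_i):i\in\sigma\}$. If $W_\sigma\ne\emptyset$, then $\sigma$ and $P_\sigma$ are called admissible; below, $\sigma$ and $\tau$ are admissible. 2. $\mu$ is a bijection from the fixed points to the vertices of $P^k$. 3. The stabilizer is constant on each $W_\sigma$. Let $T^\sigma$ be the quotient of $T^k$ by it. 4. $\mu(W_\sigma)\subseteq\mathring P_\sigma$, $\dim P_\sigma=\dim T^\sigma$, and $\mu$ induces a locally trivial fibre bundle $W_\sigma/T^\sigma\to\mathring P_\sigma$; a trivialization $h_\sigma:W_\sigma/T^\sigma\cong\mathring P_\sigma\times F_\sigma$ over $\mathring P_\sigma$ is fixed. For $c\in F_\sigma$, the leaf $W_\sigma[c]\subseteq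 W_\sigma$ is the preimage of $\mathring P_\sigma\times\{c\}$. 5. For every leaf $W_\sigma[c]$ there is a family $B$ of admissible sets $\tau$ with $P_\tau$ a proper face of $P_\sigma$, and for each $\tau\in B$ exactly one $c_\tau\in F_\tau$, such that $\partial W_\sigma[c]=\bigcup_{\tau\in B}W_\tau[c_\tau]$. 6. Let $CQ$ be the disjoint union of the sets $\mathring P'_\sigma$, where $\mathring P'_\sigma$ is a copy of $\mathring P_\sigma$ and there is one for each admissible polytope, with the quotient topology of the map $M\to CQ$ that sends $y\in W_\sigma$ to the copy of $\mu(y)$ in $\mathring P'_\sigma$. Let $\mathfrak E/T^k\subseteq CQ\times M/T^k$ be the subspace of pairs $(x,[y])$ for which there is a $\sigma$ with $x\in\mathring P'_\sigma$, $y\in W_\sigma$ and $x$ the copy of $\mu(y)$. There are a compact Hausdorff space $\mathcal F$ containing, as a dense subspace, the space $F_\sigma$ of the main stratum ($\sigma$ consisting of all indices), subspaces $\tilde F_\sigma\subseteq\mathcal F$ with $\bigcup_\sigma\tilde F_\sigma=\mathcal F$, and continuous surjections $p_\sigma:\tilde F_\sigma\to F_\sigma$, such that the map $$H:\ \bigcup_\sigma\mathring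 P'_\sigma\times\tilde F_\sigma\ \longrightarrow\ \mathfrak E/T^k,\qquad H(x,c)=\bigl(x,\ h_\sigma^{-1}(x,p_\sigma(c))\bigr)\quad\text{for } x\in\mathring P'_\sigma,\ c\in\tilde F_\sigma,$$ is continuous, where its domain is a subspace of $CQ\times\mathcal F$. **Theorem.** Let $n\ge1$, let $M^{2n}$ be a quasitoric manifold over the simple polytope $P$, and let $\mu:M\to M/T^n\xrightarrow{\ \Phi\ }P\subset\mathbb R^n$ be the orbit projection. Then $M$, with its $T^n$-action and with $\mu$ as almost moment map, has the structure of a $(2n,n)$-manifold whose admissible polytopes are exactly the faces of $P$. -/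

import Mathlib

open Set Topology
open scoped Manifold ContDiff

universe u

noncomputable section

/-! ### Convex polytopes -/

/-- A convex polytope of full dimension `k` in `ℝ^k`. -/
def IsFullPolytope {k : ℕ} (P : Set (EuclideanSpace ℝ (Fin k))) : Prop :=
  (∃ V : Finset (EuclideanSpace ℝ (Fin k)), P = convexHull ℝ (V : Set (EuclideanSpace ℝ (Fin k)))) ∧
    affineSpan ℝ P = ⊤

/-- `F` is a (nonempty) face of `P`: the set of points of `P` at which some linear functional
attains its maximum over `P`. The zero functional shows that `P` is a face of itself. -/
def IsFace {k : ℕ} (P F : Set (EuclideanSpace ℝ (Fin k))) : Prop :=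
  F.Nonempty ∧ IsExposed ℝ P F

/-- The dimension of a convex set, that is, of its affine hull. -/
def polytopeDim {k : ℕ} (Q : Set (EuclideanSpace ℝ (Fin k))) : ℕ :=
  Module.finrank ℝ (vectorSpan ℝ Q)

/-- An `n`-dimensional polytope in `ℝ^n` is simple if each of its vertices lies in exactly `n`
facets (faces of dimension `n - 1`). -/
def IsSimplePolytope {n : ℕ} (P : Set (EuclideanSpace ℝ (Fin n))) : Prop :=
  IsFullPolytope P ∧
    ∀ v ∈ P.extremePoints ℝ, {F | IsFace P F ∧ polytopeDim F + 1 = n ∧ v ∈ F}.encard = n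

/-! ### Torus actions on manifolds -/

/-- The compact torus `T^k`, with its product group structure, topology and smooth structure. -/
abbrev Torus (k : ℕ) : Type := Fin k → Circle

/-- The action `T^k × M → M` is smooth. -/
abbrev IsSmoothTorusAction (n k : ℕ) (M : Type u) [TopologicalSpace M]
    [ChartedSpace (EuclideanSpace ℝ (Fin (2 * n))) M] [MulAction (Torus k) M] : Prop :=
  ContMDiffSMul (ModelWithCorners.pi fun _ : Fin k => 𝓡 1) (𝓡 (2 * n)) ∞ (Torus k) M

/-- The smooth manifold `M` can be oriented: it has a covering family of smooth charts all of whose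
coordinate changes have positive Jacobian determinant. -/
def IsOrientable (m : ℕ) (M : Type u) [TopologicalSpace M]
    [ChartedSpace (EuclideanSpace ℝ (Fin m)) M] : Prop :=
  ∃ A : Set (OpenPartialHomeomorph M (EuclideanSpace ℝ (Fin m))),
    A ⊆ IsManifold.maximalAtlas (𝓡 m) ∞ M ∧ (∀ x : M, ∃ e ∈ A, x ∈ e.source) ∧
    ∀ e ∈ A, ∀ e' ∈ A, ∀ x ∈ e.source ∩ e'.source,
      0 < (fderiv ℝ (fun z => e' (e.symm z)) (e x)).det

/-- The orbit space `M / T^k`, with the quotient topology. -/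
abbrev OrbitSpace (k : ℕ) (M : Type u) [MulAction (Torus k) M] : Type u :=
  MulAction.orbitRel.Quotient (Torus k) M

/-- The projection `M → M / T^k`. -/
def orbitMk (k : ℕ) {M : Type u} [MulAction (Torus k) M] (y : M) : OrbitSpace k M :=
  Quotient.mk (MulAction.orbitRel (Torus k) M) y

/-- The fixed points of the action. -/
abbrev FixedPt (k : ℕ) (M : Type u) [MulAction (Torus k) M] : Type u :=
  MulAction.fixedPoints (Torus k) M

/-! ### Quasitoric manifolds -/

/-- A standard chart of a `T^n`-action on `M^{2n}`: a diffeomorphism from an invariant open set of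
`M` onto an open set of `ℂ^n` that carries the action, up to an automorphism `α` of `T^n`, to the
coordinatewise action of `T^n` on `ℂ^n`. -/
structure IsStandardChart {n : ℕ} {M : Type u} [TopologicalSpace M]
    [ChartedSpace (EuclideanSpace ℝ (Fin (2 * n))) M] [MulAction (Torus n) M]
    (ψ : OpenPartialHomeomorph M (Fin n → ℂ)) : Prop where
  smooth : ContMDiffOn (𝓡 (2 * n)) 𝓘(ℝ, Fin n → ℂ) ∞ ψ ψ.source
  smooth_symm : ContMDiffOn 𝓘(ℝ, Fin n → ℂ) (𝓡 (2 * n)) ∞ ψ.symm ψ.target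
  invariant : ∀ (t : Torus n), ∀ y ∈ ψ.source, t • y ∈ ψ.source
  equivariant : ∃ α : Torus n ≃ₜ* Torus n, ∀ (t : Torus n), ∀ y ∈ ψ.source, ∀ j : Fin n,
    ψ (t • y) j = (α t j : ℂ) * ψ y j

/-- The action is locally standard. -/
def IsLocallyStandard (n : ℕ) (M : Type u) [TopologicalSpace M]
    [ChartedSpace (EuclideanSpace ℝ (Fin (2 * n))) M] [MulAction (Torus n) M] : Prop :=
  ∀ x : M, ∃ ψ : OpenPartialHomeomorph M (Fin n → ℂ), IsStandardChart ψ ∧ x ∈ ψ.source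

/-- The orbit map `ℂ^n → ℝ^n_{≥0}`, `z ↦ (|z_1|^2, …, |z_n|^2)`, of the standard action of `T^n`. -/
def cornerCoord {n : ℕ} (z : Fin n → ℂ) : Fin n → ℝ := fun j => Complex.normSq (z j)

/-- A homeomorphism `Φ` from the orbit space of a locally standard action onto a simple polytope
`P ⊂ ℝ^n` is a diffeomorphism of manifolds with corners. The corner charts of the orbit space are
`[y] ↦ (|ψ_1 y|^2, …, |ψ_n y|^2) ∈ ℝ^n_{≥0}`, for the standard charts `ψ`; in such charts
around any point, `Φ` and its inverse are smooth (here `f` and `g` are `Φ` and `Φ⁻¹` written in the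
chart). -/
def IsCornerDiffeo {n : ℕ} {M : Type u} [TopologicalSpace M]
    [ChartedSpace (EuclideanSpace ℝ (Fin (2 * n))) M] [MulAction (Torus n) M]
    {P : Set (EuclideanSpace ℝ (Fin n))} (Φ : OrbitSpace n M ≃ₜ P) : Prop :=
  ∀ x : M, ∃ ψ : OpenPartialHomeomorph M (Fin n → ℂ), IsStandardChart ψ ∧ x ∈ ψ.source ∧
    ∃ (f : (Fin n → ℝ) → EuclideanSpace ℝ (Fin n)) (g : EuclideanSpace ℝ (Fin n) → (Fin n → ℝ)),
      ContDiffOn ℝ ∞ f (cornerCoord '' ψ.target) ∧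
      ContDiffOn ℝ ∞ g ((fun y : M => (Φ (orbitMk n y) : EuclideanSpace ℝ (Fin n))) '' ψ.source) ∧
      ∀ y ∈ ψ.source, f (cornerCoord (ψ y)) = Φ (orbitMk n y) ∧
        g (Φ (orbitMk n y)) = cornerCoord (ψ y)

/-- `M^{2n}` is a quasitoric manifold over the simple polytope `P`, its orbit space being identified
with `P` by the diffeomorphism `Φ`. -/
structure IsQuasitoric (n : ℕ) (M : Type u) [TopologicalSpace M]
    [ChartedSpace (EuclideanSpace ℝ (Fin (2 * n))) M] [MulAction (Torus n) M]
    (P : Set (EuclideanSpace ℝ (Fin n))) (Φ : OrbitSpace n M ≃ₜ P) : Prop where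
  hausdorff : T2Space M
  compact : CompactSpace M
  smooth : IsManifold (𝓡 (2 * n)) ∞ M
  smooth_action : IsSmoothTorusAction n n M
  locallyStandard : IsLocallyStandard n M
  simple : IsSimplePolytope P
  diffeo : IsCornerDiffeo Φ

/-! ### `(2n,k)`-manifolds -/

/-- The standing assumptions on the triple `(M^{2n}, θ, μ)`: `M` is a smooth closed orientable simply
connected manifold, `θ` is a smooth effective action of `T^k` with connected stabilizers,
`1 ≤ k ≤ n`, and `μ` is a continuous invariant map, open onto its image, whose image is a
`k`-dimensional polytope in `ℝ^k`. -/
structure IsTorusSetting (n k : ℕ) (M : Type u) [TopologicalSpace M]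
    [ChartedSpace (EuclideanSpace ℝ (Fin (2 * n))) M] [MulAction (Torus k) M]
    (μ : M → EuclideanSpace ℝ (Fin k)) : Prop where
  one_le : 1 ≤ k
  le : k ≤ n
  hausdorff : T2Space M
  compact : CompactSpace M
  smooth : IsManifold (𝓡 (2 * n)) ∞ M
  orientable : IsOrientable (2 * n) M
  simplyConnected : SimplyConnectedSpace M
  smooth_action : IsSmoothTorusAction n k M
  effective : FaithfulSMul (Torus k) M
  connected_stabilizer : ∀ y : M, IsConnected (MulAction.stabilizer (Torus k) y : Set (Torus k))
  continuous_map : Continuous μ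
  invariant_map : ∀ (t : Torus k) (y : M), μ (t • y) = μ y
  open_map : IsOpenMap (Set.rangeFactorization μ)
  polytope : IsFullPolytope (Set.range μ)

/-- The first axiom: a smooth atlas with one chart `φ_x : M_x → ℝ^{2n}` for every fixed point `x`;
`φ_x` is onto `ℝ^{2n}`, its domain `M_x` is invariant and dense and contains no fixed point other
than `x`, and `φ_x x = 0`. -/
structure InvariantAtlas (n k : ℕ) (M : Type u) [TopologicalSpace M]
    [ChartedSpace (EuclideanSpace ℝ (Fin (2 * n))) M] [MulAction (Torus k) M] where
  chart : FixedPt k M → OpenPartialHomeomorph M (EuclideanSpace ℝ (Fin (2 * n)))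
  smooth : ∀ x, chart x ∈ IsManifold.maximalAtlas (𝓡 (2 * n)) ∞ M
  cover : ⋃ x, (chart x).source = univ
  target : ∀ x, (chart x).target = univ
  invariant : ∀ x, ∀ (t : Torus k), ∀ y ∈ (chart x).source, t • y ∈ (chart x).source
  fixed : ∀ x, (chart x).source ∩ MulAction.fixedPoints (Torus k) M = {(x : M)}
  zero : ∀ x, chart x (x : M) = 0
  dense : ∀ x, Dense (chart x).source

namespace InvariantAtlas

/-- The set of those `x` for which `y ∈ M_x`. -/
def typeOf {n k : ℕ} {M : Type u} [TopologicalSpace M]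
    [ChartedSpace (EuclideanSpace ℝ (Fin (2 * n))) M] [MulAction (Torus k) M]
    (A : InvariantAtlas n k M) (y : M) : Set (FixedPt k M) :=
  {x | y ∈ (A.chart x).source}

/-- The space `W_σ`: the intersection of the `M_x`, `x ∈ σ`, and of the complements of the `M_x`,
`x ∉ σ`. The index set `σ` is admissible if `W_σ` is nonempty. -/
def stratum {n k : ℕ} {M : Type u} [TopologicalSpace M]
    [ChartedSpace (EuclideanSpace ℝ (Fin (2 * n))) M] [MulAction (Torus k) M]
    (A : InvariantAtlas n k M) (σ : Set (FixedPt k M)) : Set M :=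
  {y | A.typeOf y = σ}

/-- The orbit space `W_σ / T^k = W_σ / T^σ`, as a subspace of `M / T^k`. -/
def orbitStratum {n k : ℕ} {M : Type u} [TopologicalSpace M]
    [ChartedSpace (EuclideanSpace ℝ (Fin (2 * n))) M] [MulAction (Torus k) M]
    (A : InvariantAtlas n k M) (σ : Set (FixedPt k M)) : Set (OrbitSpace k M) :=
  orbitMk k '' A.stratum σ

end InvariantAtlas

/-- The polytope `P_σ`: the convex hull of the points `μ x`, `x ∈ σ`. -/
def spanPolytope {k : ℕ} {M : Type u} [MulAction (Torus k) M]
    (μ : M → EuclideanSpace ℝ (Fin k)) (σ : Set (FixedPt k M)) :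
    Set (EuclideanSpace ℝ (Fin k)) :=
  convexHull ℝ ((fun x : FixedPt k M => μ x) '' σ)

/-- The standing assumptions, the first four axioms, and the structural data that come with them:
the spaces of parameters `F_σ` and the trivializations
`h_σ : W_σ / T^σ ≃ int P_σ × F_σ` over `int P_σ`. (A locally trivial bundle over the contractible
base `int P_σ` is trivial, so the bundle axiom amounts to the existence of such an `h_σ`. The values
of `F` at sets `σ` that are not admissible play no role.) -/
structure TorusStrata (n k : ℕ) (M : Type u) [TopologicalSpace M]
    [ChartedSpace (EuclideanSpace ℝ (Fin (2 * n))) M] [MulAction (Torus k) M]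
    (μ : M → EuclideanSpace ℝ (Fin k)) where
  setting : IsTorusSetting n k M μ
  /-- First axiom. -/
  atlas : InvariantAtlas n k M
  /-- Second axiom: `μ` is a bijection from the fixed points to the vertices of the polytope. -/
  bijOn_vertices : Set.BijOn μ (MulAction.fixedPoints (Torus k) M)
    ((Set.range μ).extremePoints ℝ)
  /-- Third axiom: the stabilizer is constant on every `W_σ`. -/
  stabilizer_eq : ∀ σ, ∀ y ∈ atlas.stratum σ, ∀ z ∈ atlas.stratum σ,
    MulAction.stabilizer (Torus k) y = MulAction.stabilizer (Torus k) z
  /-- Fourth axiom: `μ` maps `W_σ` to the relative interior of `P_σ`, -/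
  mapsTo : ∀ σ, Set.MapsTo μ (atlas.stratum σ) (intrinsicInterior ℝ (spanPolytope μ σ))
  /-- the torus `T^σ = T^k / χ(W_σ)` has dimension `dim P_σ`, -/
  torus_dim : ∀ σ, ∀ y ∈ atlas.stratum σ,
    Nonempty ((Torus k ⧸ MulAction.stabilizer (Torus k) y) ≃ₜ*
      Torus (polytopeDim (spanPolytope μ σ)))
  /-- and the map `W_σ / T^σ → int P_σ` induced by `μ` is a fibre bundle, -/
  F : Set (FixedPt k M) → Type u
  topF : ∀ σ, TopologicalSpace (F σ)
  /-- with a fixed trivialization. -/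
  h : ∀ σ, (atlas.stratum σ).Nonempty →
    (atlas.orbitStratum σ ≃ₜ intrinsicInterior ℝ (spanPolytope μ σ) × F σ)
  h_fst : ∀ (σ) (hσ : (atlas.stratum σ).Nonempty) (y : M) (hy : y ∈ atlas.stratum σ),
    ((h σ hσ ⟨orbitMk k y, mem_image_of_mem _ hy⟩).1 : EuclideanSpace ℝ (Fin k)) = μ y

attribute [instance] TorusStrata.topF

namespace TorusStrata

/-- The family of admissible polytopes. -/
def admissiblePolytopes {n k : ℕ} {M : Type u} [TopologicalSpace M]
    [ChartedSpace (EuclideanSpace ℝ (Fin (2 * n))) M] [MulAction (Torus k) M]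
    {μ : M → EuclideanSpace ℝ (Fin k)} (S : TorusStrata n k M μ) :
    Set (Set (EuclideanSpace ℝ (Fin k))) :=
  {Q | ∃ σ, (S.atlas.stratum σ).Nonempty ∧ spanPolytope μ σ = Q}

/-- The leaf `W_σ[ξ_σ, c]`, where `ξ_σ : W_σ / T^σ → F_σ` is the second component of `h_σ`. -/
def leaf {n k : ℕ} {M : Type u} [TopologicalSpace M]
    [ChartedSpace (EuclideanSpace ℝ (Fin (2 * n))) M] [MulAction (Torus k) M]
    {μ : M → EuclideanSpace ℝ (Fin k)} (S : TorusStrata n k M μ) (σ : Set (FixedPt k M))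
    (hσ : (S.atlas.stratum σ).Nonempty) (c : S.F σ) : Set M :=
  {y | ∃ hy : y ∈ S.atlas.stratum σ, (S.h σ hσ ⟨orbitMk k y, mem_image_of_mem _ hy⟩).2 = c}

/-- The complex `C(M, P)`: the disjoint union of the relative interiors of the admissible polytopes.
A point is a pair of an admissible polytope and a point of its relative interior. -/
def Complex {n k : ℕ} {M : Type u} [TopologicalSpace M]
    [ChartedSpace (EuclideanSpace ℝ (Fin (2 * n))) M] [MulAction (Torus k) M]
    {μ : M → EuclideanSpace ℝ (Fin k)} (S : TorusStrata n k M μ) : Type :=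
  {q : Set (EuclideanSpace ℝ (Fin k)) × EuclideanSpace ℝ (Fin k) //
    q.1 ∈ S.admissiblePolytopes ∧ q.2 ∈ intrinsicInterior ℝ q.1}

/-- The open cell of the complex that belongs to `σ`. -/
def cell {n k : ℕ} {M : Type u} [TopologicalSpace M]
    [ChartedSpace (EuclideanSpace ℝ (Fin (2 * n))) M] [MulAction (Torus k) M]
    {μ : M → EuclideanSpace ℝ (Fin k)} (S : TorusStrata n k M μ) (σ : Set (FixedPt k M)) :
    Set S.Complex :=
  {q | q.1.1 = spanPolytope μ σ}

/-- The canonical map `M → C(M, P)`: it sends `y ∈ W_σ` to the point `μ y` of the cell of `σ`. -/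
def canonicalMap {n k : ℕ} {M : Type u} [TopologicalSpace M]
    [ChartedSpace (EuclideanSpace ℝ (Fin (2 * n))) M] [MulAction (Torus k) M]
    {μ : M → EuclideanSpace ℝ (Fin k)} (S : TorusStrata n k M μ) (y : M) : S.Complex :=
  ⟨(spanPolytope μ (S.atlas.typeOf y), μ y),
    ⟨S.atlas.typeOf y, ⟨y, rfl⟩, rfl⟩, S.mapsTo (S.atlas.typeOf y) rfl⟩

/-- The space `CQ(M, P)`: the complex with the quotient topology of the canonical map. -/
instance instTopologicalSpaceComplex {n k : ℕ} {M : Type u} [TopologicalSpace M]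
    [ChartedSpace (EuclideanSpace ℝ (Fin (2 * n))) M] [MulAction (Torus k) M]
    {μ : M → EuclideanSpace ℝ (Fin k)} (S : TorusStrata n k M μ) : TopologicalSpace S.Complex :=
  TopologicalSpace.coinduced S.canonicalMap inferInstance

/-- The orbit space `𝔈(M, P) / T^k`, as a subspace of `CQ(M, P) × M / T^k`: the pairs `(q, w)` such
that, for some admissible `σ`, the point `q` lies in the cell of `σ`, `w` is the orbit of a point
`y ∈ W_σ`, and `q` lies over `μ y`. -/
def OrbitTotal {n k : ℕ} {M : Type u} [TopologicalSpace M]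
    [ChartedSpace (EuclideanSpace ℝ (Fin (2 * n))) M] [MulAction (Torus k) M]
    {μ : M → EuclideanSpace ℝ (Fin k)} (S : TorusStrata n k M μ) : Set (S.Complex × OrbitSpace k M) :=
  {p | ∃ σ, p.1 ∈ S.cell σ ∧ ∃ y ∈ S.atlas.stratum σ, orbitMk k y = p.2 ∧ p.1.1.2 = μ y}

/-- The sixth axiom: a universal space of parameters `U` and virtual spaces of parameters
`V σ ⊆ U`. -/
structure UniversalParameters {n k : ℕ} {M : Type u} [TopologicalSpace M]
    [ChartedSpace (EuclideanSpace ℝ (Fin (2 * n))) M] [MulAction (Torus k) M]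
    {μ : M → EuclideanSpace ℝ (Fin k)} (S : TorusStrata n k M μ) where
  U : Type u
  topU : TopologicalSpace U
  compact : CompactSpace U
  hausdorff : T2Space U
  /-- `U` is a compactification of the space of parameters of the main stratum, whose index set
  consists of all fixed points. -/
  incl : S.F univ → U
  incl_dense : IsDenseEmbedding incl
  V : Set (FixedPt k M) → Set U
  cover : ∀ c : U, ∃ σ, (S.atlas.stratum σ).Nonempty ∧ c ∈ V σ
  /-- The projections of the virtual spaces of parameters onto the spaces of parameters. -/
  p : ∀ σ, V σ → S.F σ
  p_continuous : ∀ σ, (S.atlas.stratum σ).Nonempty → Continuous (p σ)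
  p_surjective : ∀ σ, (S.atlas.stratum σ).Nonempty → Function.Surjective (p σ)
  /-- The map `H` on the union of the products `int P_σ × V σ`, a subspace of `CQ(M, P) × U`. It is
  determined by the next field. -/
  H : {e : S.Complex × U | ∃ σ, (S.atlas.stratum σ).Nonempty ∧ e.1 ∈ S.cell σ ∧ e.2 ∈ V σ} →
    S.OrbitTotal
  /-- `H (q, c) = (q, p_σ c)`, where the right hand side denotes the pair of `q` and of the orbit in
  `W_σ / T^σ` that corresponds to `(q, p_σ c)` under the trivialization `h_σ`. -/
  H_apply : ∀ (σ) (hσ : (S.atlas.stratum σ).Nonempty) (q : S.Complex) (hq : q ∈ S.cell σ)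
    (c : U) (hc : c ∈ V σ),
    (H ⟨(q, c), ⟨σ, hσ, hq, hc⟩⟩ : S.Complex × OrbitSpace k M) =
      (q, ((S.h σ hσ).symm (⟨q.1.2, by
        have h1 : q.1.1 = spanPolytope μ σ := hq
        exact h1 ▸ q.2.2⟩, p σ ⟨c, hc⟩) : OrbitSpace k M))
  H_continuous : Continuous H

end TorusStrata

/-- The structure of a `(2n,k)`-manifold on `(M, θ, μ)`: all six axioms, with the structural data. -/
structure TwoNKManifold (n k : ℕ) (M : Type u) [TopologicalSpace M]
    [ChartedSpace (EuclideanSpace ℝ (Fin (2 * n))) M] [MulAction (Torus k) M]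
    (μ : M → EuclideanSpace ℝ (Fin k)) extends TorusStrata n k M μ where
  /-- Fifth axiom: the boundary `closure L \ L` of a leaf `L` of `W_σ` is a union of leaves, one leaf
  of `W_τ` for each `τ` in a family `B` of admissible sets for which `P_τ` is a proper face
  of `P_σ`. -/
  leaf_boundary : ∀ (σ) (hσ : (atlas.stratum σ).Nonempty) (c : F σ),
    ∃ (B : Set (Set (FixedPt k M))) (hB : ∀ τ ∈ B, (atlas.stratum τ).Nonempty)
      (d : ∀ τ ∈ B, F τ),
      (∀ τ ∈ B, IsFace (spanPolytope μ σ) (spanPolytope μ τ) ∧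
        spanPolytope μ τ ≠ spanPolytope μ σ) ∧
      closure (toTorusStrata.leaf σ hσ c) \ toTorusStrata.leaf σ hσ c =
        ⋃ (τ) (hτ : τ ∈ B), toTorusStrata.leaf τ (hB τ hτ) (d τ hτ)
  /-- Sixth axiom. -/
  universal : toTorusStrata.UniversalParameters

end

/-! Every face of `P` should carry one stratum, namely its relative interior pulled back by the
orbit projection. Every space of parameters is then a point. For a point `p` of `P` let `carrierFace
P p` be the smallest face containing it. The chart domain of a fixed point over the vertex `v` is
the set of `y` with `v ∈ carrierFace P (orbitProj Φ y)`, the preimage of the open star of `v`. Since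
a face is the hull of its vertices, the index set of `y` records exactly the carrier of `orbitProj Φ
y`.

The main difficulty is that this preimage is diffeomorphic to `ℝ^{2n}`; local standardness only
controls a small neighbourhood of the fixed point. On the open star there is a smooth proper
function that increases along rays from `v` (`exists_radial_exhaustion`). At a point `p` of the
star, `p - v` is tangent to the carrier of `p`, and corner charts lift such vectors to `M`
(`IsCornerChart.exists_tangent_maps`). Hence the pulled back function has nonzero derivative away
from the fixed point (`IsCornerChart.isPushable`).

In place of a gradient flow, finitely many diffeomorphisms of small support are composed and
iterated to push sublevel sets down (`exists_diffeomorph_lt`). A small chart at the fixed point can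
thus engulf every compact subset of the star, and a stabilizing sequence of diffeomorphisms
identifies it with the whole star (`exists_openPartialHomeomorph_of_engulfing`,
`exists_chart_of_exhaustion`).

All these cells contain the preimage of the interior of `P`, which is connected and dense, so any
two of them meet in a connected set. This gives orientability and simple connectedness. Stabilizers
are read off from the nonzero coordinates in a corner chart, whose number is the dimension of the
carrier. The remaining axioms express facts about the face lattice, and the map of the sixth axiom
is `q ↦ (q, Φ⁻¹ q)`, continuous because `CQ → P` is. -/

noncomputable section

/-! ### Minimal faces of convex sets and polytopes -/

section CarrierFace

variable {E : Type*} [NormedAddCommGroup E] [NormedSpace ℝ E]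

/-- The minimal face of a convex set `P` that contains `p`: the points of `P` that lie on a segment
in `P` which extends beyond `p`. -/
def carrierFace (P : Set E) (p : E) : Set E :=
  {q | q ∈ P ∧ ∃ ε : ℝ, 0 < ε ∧ p + ε • (p - q) ∈ P}

variable {P Q : Set E} {p q : E}

theorem carrierFace_subset : carrierFace P p ⊆ P := fun _ h => h.1

theorem self_mem_carrierFace (hp : p ∈ P) : p ∈ carrierFace P p :=
  ⟨hp, 1, one_pos, by simpa using hp⟩

/-- The ray from `q` through `p` stays in `P` for all small positive times past `p`. -/
theorem Convex.add_smul_mem_of_le (hP : Convex ℝ P) (hp : p ∈ P) {u : E} {ε δ : ℝ} (hδ : 0 ≤ δ)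
    (hδε : δ ≤ ε) (hε : 0 < ε) (h : p + ε • u ∈ P) : p + δ • u ∈ P := by
  have := hP.add_smul_sub_mem hp h (t := δ / ε) ⟨by positivity, (div_le_one hε).2 hδε⟩
  rwa [add_sub_cancel_left, smul_smul, div_mul_cancel₀ _ hε.ne'] at this

theorem convex_carrierFace (hP : Convex ℝ P) (hp : p ∈ P) : Convex ℝ (carrierFace P p) := by
  rintro a ⟨ha, ε, hε, ha'⟩ b ⟨hb, δ, hδ, hb'⟩ s t hs ht hst
  refine ⟨hP ha hb hs ht hst, min ε δ, lt_min hε hδ, ?_⟩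
  have h1 := hP.add_smul_mem_of_le hp (lt_min hε hδ).le (min_le_left ε δ) hε ha'
  have h2 := hP.add_smul_mem_of_le hp (lt_min hε hδ).le (min_le_right ε δ) hδ hb'
  convert hP h1 h2 hs ht hst using 1
  obtain rfl : t = 1 - s := by linarith
  module

/-- If `x = s a + t b` and `p + ε (p - x)` lies in `P`, averaging that point with `b` in the ratio
`1 : ε t` cancels the `b` term. What remains is a point on the ray from `a` through `p`, strictly
beyond `p`. -/
theorem isExtreme_carrierFace (hP : Convex ℝ P) : IsExtreme ℝ P (carrierFace P p) := by
  refine ⟨carrierFace_subset, ?_⟩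
  rintro a ha b hb x ⟨-, ε, hε, hx'⟩ ⟨s, t, hs, ht, hst, rfl⟩
  have hd : 0 < 1 + ε * t := by positivity
  refine ⟨ha, ε * s / (1 + ε * t), by positivity, ?_⟩
  convert hP hx' hb (a := 1 / (1 + ε * t)) (b := ε * t / (1 + ε * t)) (by positivity)
    (by positivity) (by field_simp) using 1
  obtain rfl : s = 1 - t := by linarith
  have h1 : ε * (1 - t) / (1 + ε * t) = 1 / (1 + ε * t) * (1 + ε) - 1 := by field_simp; ring
  have h2 : ε * t / (1 + ε * t) = 1 / (1 + ε * t) * (ε * t) := by ring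
  have h3 : 1 / (1 + ε * t) * (1 + ε * t) = 1 := by field_simp
  have h4 : ε * (1 - t) / (1 + ε * t) = 1 / (1 + ε * t) * (ε * (1 - t)) := by ring
  have : p + (ε * (1 - t) / (1 + ε * t)) • (p - a)
      = (1 / (1 + ε * t) * (1 + ε)) • p - (1 / (1 + ε * t) * (ε * (1 - t))) • a := by
    rw [smul_sub, ← h4, h1]; module
  rw [this, h2]
  module

/-- The carrier of `p` lies in every extreme subset that contains `p`. -/
theorem carrierFace_subset_of_isExtreme (hF : IsExtreme ℝ P Q) (hp : p ∈ Q) :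
    carrierFace P p ⊆ Q := by
  rintro q ⟨hq, ε, hε, h⟩
  refine hF.2 hq h hp ⟨ε / (1 + ε), 1 / (1 + ε), by positivity, by positivity, by field_simp; ring,
    ?_⟩
  have h3 : ε / (1 + ε) = 1 / (1 + ε) * ε := by ring
  have h4 : 1 / (1 + ε) * (1 + ε) = 1 := by field_simp
  have : (1 / (1 + ε) * (1 + ε)) • p = p := by rw [h4, one_smul]
  rw [h3]
  conv_rhs => rw [← this]
  module

theorem carrierFace_subset_of_mem (hP : Convex ℝ P) (hq : q ∈ carrierFace P p) :
    carrierFace P q ⊆ carrierFace P p :=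
  carrierFace_subset_of_isExtreme (isExtreme_carrierFace hP) hq

theorem carrierFace_of_mem_extremePoints (hp : p ∈ P.extremePoints ℝ) : carrierFace P p = {p} :=
  (carrierFace_subset_of_isExtreme (isExtreme_singleton.2 hp) rfl).antisymm
    (singleton_subset_iff.2 (self_mem_carrierFace hp.1))

/-- Directions in the span of the carrier of `p` are directions in which `p` can be moved. -/
theorem eventually_add_smul_mem (hP : Convex ℝ P) (hp : p ∈ P) {w : E}
    (hw : w ∈ vectorSpan ℝ (carrierFace P p)) : ∀ᶠ s : ℝ in 𝓝 0, p + s • w ∈ P := by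
  rw [vectorSpan_eq_span_vsub_set_right ℝ (self_mem_carrierFace hp)] at hw
  have key : ∀ {ε : ℝ} {w : E}, 0 < ε → p + ε • w ∈ P → p + ε • (-w) ∈ P →
      ∀ᶠ s : ℝ in 𝓝 0, p + s • w ∈ P := by
    intro ε w hε h1 h2
    filter_upwards [Metric.closedBall_mem_nhds (0 : ℝ) hε] with s hs
    rw [mem_closedBall_zero_iff, Real.norm_eq_abs] at hs
    rcases le_total 0 s with h | h
    · exact hP.add_smul_mem_of_le hp h (by rwa [abs_of_nonneg h] at hs) hε h1
    · have := hP.add_smul_mem_of_le hp (neg_nonneg.2 h) (by rwa [abs_of_nonpos h] at hs) hε h2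
      simpa using this
  induction hw using Submodule.span_induction with
  | mem x hx =>
    obtain ⟨q, ⟨hq, ε, hε, h⟩, rfl⟩ := hx
    have hm : 0 < min ε 1 := lt_min hε one_pos
    refine key hm ?_ ?_
    · exact hP.add_smul_mem_of_le hp hm.le (min_le_right _ _) one_pos (by simpa using hq)
    · exact hP.add_smul_mem_of_le hp hm.le (min_le_left _ _) hε (by simpa using h)
  | zero => simpa using hp
  -- A step along `x + y` is the midpoint of steps of double length along `x` and along `y`.
  | add x y _ _ hx hy =>
    have h2 : Filter.Tendsto (fun s : ℝ => 2 * s) (𝓝 0) (𝓝 0) := by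
      have : Continuous fun s : ℝ => 2 * s := by fun_prop
      simpa using this.tendsto 0
    filter_upwards [h2.eventually hx, h2.eventually hy] with s h1 h3
    convert hP h1 h3 (a := 1 / 2) (b := 1 / 2) (by norm_num) (by norm_num) (by norm_num) using 1
    module
  | smul a x _ hx =>
    have h2 : Filter.Tendsto (fun s : ℝ => s * a) (𝓝 0) (𝓝 0) := by
      have : Continuous fun s : ℝ => s * a := by fun_prop
      simpa using this.tendsto 0
    filter_upwards [h2.eventually hx] with s h1
    rwa [smul_smul]

theorem sub_mem_vectorSpan_carrierFace (hp : p ∈ P) (hq : q ∈ carrierFace P p) :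
    q - p ∈ vectorSpan ℝ (carrierFace P p) :=
  vsub_mem_vectorSpan ℝ hq (self_mem_carrierFace hp)

/-- Moving from a point of the carrier of `p` a bit towards `p` does not change the carrier. -/
theorem carrierFace_lineMap (hP : Convex ℝ P) (hp : p ∈ P) (hq : q ∈ carrierFace P p) {s : ℝ}
    (hs : 0 < s) (hs1 : s ≤ 1) : carrierFace P (AffineMap.lineMap q p s) = carrierFace P p := by
  set x := AffineMap.lineMap q p s with hx
  have hxP : x ∈ carrierFace P p :=
    (convex_carrierFace hP hp).lineMap_mem hq (self_mem_carrierFace hp) ⟨hs.le, hs1⟩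
  refine (carrierFace_subset_of_mem hP hxP).antisymm (carrierFace_subset_of_mem hP ?_)
  -- For `s < 1` the point `x` is inside the open segment between `p` and `q`; its carrier is
  -- extreme, so it contains the endpoint `p`.
  rcases hs1.lt_or_eq with h1 | rfl
  · refine (isExtreme_carrierFace hP).2 (x := p) (y := q) hp hq.1
      (self_mem_carrierFace hxP.1) ?_
    rw [openSegment_symm, openSegment_eq_image_lineMap]
    exact ⟨s, ⟨hs, h1⟩, rfl⟩
  · simpa [hx] using self_mem_carrierFace hp

/-! #### Relative interiors -/

/-- The line from `q` through `p` stays in the affine hull of `Q`, where `p` is an interior point,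
so it continues a little beyond `p` within `Q`. -/
theorem subset_carrierFace_of_mem_intrinsicInterior (hQP : Q ⊆ P)
    (hp : p ∈ intrinsicInterior ℝ Q) : Q ⊆ carrierFace P p := by
  intro q hq
  obtain ⟨y, hy, rfl⟩ := hp
  refine ⟨hQP hq, ?_⟩
  let q' : affineSpan ℝ Q := ⟨q, subset_affineSpan ℝ Q hq⟩
  have hc : Continuous fun s : ℝ => (AffineMap.lineMap (y : E) q (-s) : E) := by
    simp only [AffineMap.lineMap_apply]; fun_prop
  have hm : ∀ s : ℝ, AffineMap.lineMap (y : E) q (-s) ∈ affineSpan ℝ Q := fun s =>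
    AffineMap.lineMap_mem _ y.2 q'.2
  have hc' : Continuous fun s : ℝ => (⟨_, hm s⟩ : affineSpan ℝ Q) := hc.subtype_mk _
  have h0 : (⟨_, hm 0⟩ : affineSpan ℝ Q) = y := by ext; simp
  have := hc'.continuousAt (x := 0) (isOpen_interior.mem_nhds (h0 ▸ hy))
  obtain ⟨ε, hε, h⟩ := Metric.mem_nhds_iff.1 this
  have h2 := interior_subset (h (show ε / 2 ∈ Metric.ball 0 ε by
    rw [mem_ball_zero_iff, Real.norm_eq_abs, abs_of_pos (by positivity)]; linarith))
  refine ⟨ε / 2, by positivity, hQP ?_⟩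
  rw [mem_preimage] at h2
  convert h2 using 1
  simp only [AffineMap.lineMap_apply, vsub_eq_sub, vadd_eq_add]
  module

/-- Take a relative interior point `y` and a point `q'` of `Q` beyond `p` on the ray from `y`. The
homothety with centre `q'` taking `p` to `y` takes a neighbourhood of `p` into `Q`; contracting back
towards `q'` keeps that neighbourhood in `Q`. -/
theorem mem_intrinsicInterior_of_forall [FiniteDimensional ℝ E] (hQ : Convex ℝ Q) (hp : p ∈ Q)
    (h : ∀ q ∈ Q, ∃ ε : ℝ, 0 < ε ∧ p + ε • (p - q) ∈ Q) : p ∈ intrinsicInterior ℝ Q := by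
  obtain ⟨q, y, hy, rfl⟩ := Set.Nonempty.intrinsicInterior hQ ⟨p, hp⟩
  have hyQ : (y : E) ∈ Q := intrinsicInterior_subset ⟨y, hy, rfl⟩
  obtain ⟨ε, hε, hq'⟩ := h y hyQ
  set q' := p + ε • (p - (y : E)) with hq'_def
  have hq'A := subset_affineSpan ℝ Q hq'
  refine ⟨⟨p, subset_affineSpan ℝ Q hp⟩, ?_, rfl⟩
  rw [mem_interior_iff_mem_nhds]
  have hc : Continuous fun x : affineSpan ℝ Q => AffineMap.lineMap q' (x : E) ((1 + ε) / ε) := by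
    simp only [AffineMap.lineMap_apply, vsub_eq_sub, vadd_eq_add]; fun_prop
  have hm : ∀ x : affineSpan ℝ Q, AffineMap.lineMap q' (x : E) ((1 + ε) / ε) ∈ affineSpan ℝ Q :=
    fun x => AffineMap.lineMap_mem _ hq'A x.2
  have hc' : Continuous fun x : affineSpan ℝ Q => (⟨_, hm x⟩ : affineSpan ℝ Q) := hc.subtype_mk _
  have h0 : (⟨_, hm ⟨p, subset_affineSpan ℝ Q hp⟩⟩ : affineSpan ℝ Q) = y := by
    ext
    simp only [AffineMap.lineMap_apply, vsub_eq_sub, vadd_eq_add, hq'_def]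
    have : ((1 + ε) / ε) * ε = 1 + ε := by field_simp
    have h2 : p - (p + ε • (p - (y : E))) = (-ε) • (p - y) := by module
    rw [h2, smul_smul, mul_neg, this]
    module
  filter_upwards [hc'.continuousAt (isOpen_interior.mem_nhds (h0 ▸ hy))] with x hx
  have hx' := interior_subset hx
  have := hQ.lineMap_mem hq' hx' (t := ε / (1 + ε)) ⟨by positivity, by
    rw [div_le_one (by positivity)]; linarith⟩
  rw [mem_preimage]
  convert this using 1
  simp only [AffineMap.lineMap_apply, vsub_eq_sub, vadd_eq_add, add_sub_cancel_right, smul_smul]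
  rw [show ε / (1 + ε) * ((1 + ε) / ε) = 1 by field_simp]
  module

/-- This turns the relative interiors in the axioms into level sets of the carrier. The carrier of
`q` meets the criterion for relative interior points because the opposite of an opposite point is a
multiple of the original direction. -/
theorem intrinsicInterior_carrierFace [FiniteDimensional ℝ E] (hP : Convex ℝ P) :
    intrinsicInterior ℝ (carrierFace P p) = {q | q ∈ P ∧ carrierFace P q = carrierFace P p} := by
  ext q
  constructor
  · intro hq
    have hqF := intrinsicInterior_subset hq
    exact ⟨hqF.1, (carrierFace_subset_of_mem hP hqF).antisymm
      (subset_carrierFace_of_mem_intrinsicInterior carrierFace_subset hq)⟩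
  · rintro ⟨hq, h⟩
    rw [← h]
    refine mem_intrinsicInterior_of_forall (convex_carrierFace hP hq) (self_mem_carrierFace hq) ?_
    rintro x ⟨hx, ε, hε, h'⟩
    refine ⟨ε, hε, h', 1 / ε, by positivity, ?_⟩
    convert hx using 1
    rw [show q - (q + ε • (q - x)) = ε • (x - q) by module, smul_smul, one_div_mul_cancel hε.ne']
    module

/-- A nonempty extreme convex subset is the carrier of each point of its relative interior. -/
theorem carrierFace_eq_of_mem_intrinsicInterior (hF : IsExtreme ℝ P Q)
    (hp : p ∈ intrinsicInterior ℝ Q) : carrierFace P p = Q :=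
  (carrierFace_subset_of_isExtreme hF (intrinsicInterior_subset hp)).antisymm
    (subset_carrierFace_of_mem_intrinsicInterior hF.1 hp)

theorem carrierFace_eq_of_mem_interior (hp : p ∈ interior P) : carrierFace P p = P :=
  carrierFace_eq_of_mem_intrinsicInterior IsExtreme.rfl (interior_subset_intrinsicInterior hp)

theorem convex_setOf_carrierFace_eq (hP : Convex ℝ P) (F : Set E) :
    Convex ℝ {q | q ∈ P ∧ carrierFace P q = F} := by
  rw [convex_iff_forall_pos]
  rintro a ⟨ha, rfl⟩ b ⟨hb, hab⟩ s t hs ht hst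
  have h := carrierFace_lineMap hP hb (q := a) (hab ▸ self_mem_carrierFace ha) ht (by linarith)
  rw [AffineMap.lineMap_apply_module, show 1 - t = s by linarith] at h
  exact ⟨hP ha hb hs.le ht.le hst, h.trans hab⟩

theorem carrierFace_subset_closure (hP : Convex ℝ P) (hp : p ∈ P) :
    carrierFace P p ⊆ closure {q | q ∈ P ∧ carrierFace P q = carrierFace P p} := by
  intro q hq
  have hc : Continuous fun s : ℝ => (AffineMap.lineMap q p s : E) := by
    simp only [AffineMap.lineMap_apply]; fun_prop
  have h := hc.continuousWithinAt (s := Ioc 0 1) (x := 0)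
  have h0 : (0 : ℝ) ∈ closure (Ioc (0 : ℝ) 1) := by
    rw [closure_Ioc (by norm_num)]; simp
  have := h.mem_closure h0 (t := {q | q ∈ P ∧ carrierFace P q = carrierFace P p})
    fun s hs => ⟨hP.lineMap_mem hq.1 hp ⟨hs.1.le, hs.2⟩, carrierFace_lineMap hP hp hq hs.1 hs.2⟩
  simpa using this

end CarrierFace

/-! ### Faces of polytopes -/

section Polytope

variable {E : Type*} [NormedAddCommGroup E] [NormedSpace ℝ E] [FiniteDimensional ℝ E]
  {V P Q : Set E} {p q v : E}

/-- The minimal face of a polytope that contains a given point is exposed. -/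
theorem exists_exposing_carrierFace (hV : V.Finite) (hP : P = convexHull ℝ V) (hp : p ∈ P) :
    ∃ l : E →L[ℝ] ℝ, (∀ q ∈ P, l p ≤ l q) ∧ ∀ q ∈ P, l q = l p ↔ q ∈ carrierFace P p := by
  have hconv : Convex ℝ P := hP ▸ convex_convexHull ℝ V
  have hVP : V ⊆ P := hP ▸ subset_convexHull ℝ V
  set S := carrierFace P p with hS
  set D := vectorSpan ℝ S with hD
  have hSconv : Convex ℝ S := convex_carrierFace hconv hp
  -- The exposing functional separates the direction space `D` of the face from the hull of the
  -- generators outside the face. These are disjoint because `P \ S` is convex and a point of `P`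
  -- reached from `p` along `D` belongs to `S`.
  set K := convexHull ℝ ((fun w => w - p) '' (V \ S)) with hK
  have hKeq : K = (fun w => w - p) '' convexHull ℝ (V \ S) := by
    exact (AffineMap.image_convexHull (AffineEquiv.vaddConst ℝ p).symm.toAffineMap (V \ S)).symm
  have hsub : convexHull ℝ (V \ S) ⊆ P \ S :=
    convexHull_min (sdiff_subset_sdiff_left hVP) ((isExtreme_carrierFace hconv).convex_sdiff hconv)
  have hdisj : Disjoint K (D : Set E) := by
    rw [Set.disjoint_left]
    intro k hk hkD
    rw [hKeq] at hk
    obtain ⟨q, hq, rfl⟩ := hk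
    have hq' := hsub hq
    have := eventually_add_smul_mem hconv hp (D.neg_mem hkD)
    obtain ⟨ε, hε, h⟩ := Metric.eventually_nhds_iff.1 this
    refine hq'.2 ⟨hq'.1, ε / 2, by positivity, ?_⟩
    have := @h (ε / 2) (by rw [Real.dist_eq, sub_zero, abs_of_pos (by positivity)]; linarith)
    simpa using this
  obtain ⟨f, a, b, hfK, hab, hfD⟩ := geometric_hahn_banach_compact_closed
    (convex_convexHull ℝ _) ((hV.sdiff.image _).isCompact_convexHull ℝ) D.convex
    D.closed_of_finiteDimensional hdisj
  -- A functional bounded below on a subspace vanishes there: the chosen multiple of `d` would have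
  -- value `b - 1`.
  have hf0 : ∀ d ∈ D, f d = 0 := by
    intro d hd
    by_contra hne
    have h1 := hfD (((b - 1) / f d) • d) (D.smul_mem _ hd)
    rw [map_smul, smul_eq_mul, div_mul_cancel₀ _ hne] at h1
    linarith
  have hb : b < 0 := by simpa using hfD 0 D.zero_mem
  have hSeq : ∀ q ∈ S, f q = f p := fun q hq => by
    have := hf0 _ (sub_mem_vectorSpan_carrierFace hp hq)
    rw [map_sub] at this; linarith
  have hlt : ∀ w ∈ V \ S, f w < f p := by
    intro w hw
    have := hfK (w - p) (subset_convexHull ℝ _ ⟨w, hw, rfl⟩)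
    rw [map_sub] at this; linarith
  have key : P ⊆ {q | q ∈ P ∧ (q ∈ S ∨ f q < f p)} := by
    have hc : Convex ℝ {q | q ∈ P ∧ (q ∈ S ∨ f q < f p)} := by
      rw [convex_iff_forall_pos]
      rintro x ⟨hx, hx'⟩ y ⟨hy, hy'⟩ s t hs ht hst
      refine ⟨hconv hx hy hs.le ht.le hst, ?_⟩
      by_cases hxS : x ∈ S ∧ y ∈ S
      · exact Or.inl (hSconv hxS.1 hxS.2 hs.le ht.le hst)
      · right
        have h1 : f x ≤ f p := hx'.elim (fun h => (hSeq x h).le) le_of_lt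
        have h2 : f y ≤ f p := hy'.elim (fun h => (hSeq y h).le) le_of_lt
        have h3 : f x < f p ∨ f y < f p := by tauto
        simp only [map_add, map_smul, smul_eq_mul]
        obtain rfl : s = 1 - t := by linarith
        rcases h3 with h3 | h3 <;> nlinarith
    conv_lhs => rw [hP]
    refine convexHull_min (fun w hw => ⟨hVP hw, ?_⟩) hc
    by_cases h : w ∈ S
    · exact Or.inl h
    · exact Or.inr (hlt w ⟨hw, h⟩)
  refine ⟨-f, fun q hq => ?_, fun q hq => ⟨fun h => ?_, fun h => ?_⟩⟩
  · rcases (key hq).2 with h | h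
    · simp [hSeq q h]
    · simpa using h.le
  · rcases (key hq).2 with h' | h'
    · exact h'
    · simp at h; linarith
  · simp [hSeq q h]

theorem isExposed_carrierFace (hV : V.Finite) (hP : P = convexHull ℝ V) (hp : p ∈ P) :
    IsExposed ℝ P (carrierFace P p) := by
  intro _
  obtain ⟨l, h1, h2⟩ := exists_exposing_carrierFace hV hP hp
  refine ⟨-l, Set.ext fun x => ⟨fun hx => ⟨hx.1, fun y hy => ?_⟩, fun ⟨hx, h⟩ => ?_⟩⟩
  · rw [neg_apply, neg_apply, (h2 x hx.1).2 hx]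
    exact neg_le_neg (h1 y hy)
  · refine (h2 x hx).1 (le_antisymm ?_ (h1 x hx))
    simpa using h p hp

theorem exists_carrierFace_eq_of_isExposed (hP : Convex ℝ P) (hF : IsExposed ℝ P Q)
    (hne : Q.Nonempty) : ∃ p ∈ P, carrierFace P p = Q := by
  obtain ⟨p, hp⟩ := hne.intrinsicInterior (hF.convex hP)
  exact ⟨p, hF.subset (intrinsicInterior_subset hp),
    carrierFace_eq_of_mem_intrinsicInterior hF.isExtreme hp⟩

theorem isCompact_carrierFace (hV : V.Finite) (hP : P = convexHull ℝ V) (hp : p ∈ P) :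
    IsCompact (carrierFace P p) :=
  (isExposed_carrierFace hV hP hp).isCompact (hP ▸ hV.isCompact_convexHull ℝ)

omit [FiniteDimensional ℝ E] in
theorem finite_extremePoints (hV : V.Finite) (hP : P = convexHull ℝ V) :
    (P.extremePoints ℝ).Finite :=
  hV.subset (hP ▸ extremePoints_convexHull_subset)

/-- Krein–Milman for the compact face, whose extreme points are the vertices of `P` in it; the hull
of finitely many points is already closed. This identifies `P_σ` with a face. -/
theorem convexHull_extremePoints_inter_carrierFace (hV : V.Finite) (hP : P = convexHull ℝ V)
    (hp : p ∈ P) : convexHull ℝ (P.extremePoints ℝ ∩ carrierFace P p) = carrierFace P p := by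
  have hconv : Convex ℝ P := hP ▸ convex_convexHull ℝ V
  have h1 := closure_convexHull_extremePoints (isCompact_carrierFace hV hP hp)
    (convex_carrierFace hconv hp)
  rw [(isExtreme_carrierFace hconv).extremePoints_eq, inter_comm] at h1
  rwa [((((finite_extremePoints hV hP).inter_of_left _).isCompact_convexHull ℝ).isClosed).closure_eq]
    at h1

theorem finite_carrierFaces (hV : V.Finite) (hP : P = convexHull ℝ V) :
    {F | ∃ p ∈ P, carrierFace P p = F}.Finite := by
  refine (((finite_extremePoints hV hP).finite_subsets).image (convexHull ℝ)).subset ?_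
  rintro F ⟨p, hp, rfl⟩
  exact ⟨_, inter_subset_left, convexHull_extremePoints_inter_carrierFace hV hP hp⟩

theorem exists_extremePoint_mem_carrierFace (hV : V.Finite) (hP : P = convexHull ℝ V)
    (hp : p ∈ P) : ∃ v ∈ P.extremePoints ℝ, v ∈ carrierFace P p := by
  have : (convexHull ℝ (P.extremePoints ℝ ∩ carrierFace P p)).Nonempty := by
    rw [convexHull_extremePoints_inter_carrierFace hV hP hp]
    exact ⟨p, self_mem_carrierFace hp⟩
  obtain ⟨v, h1, h2⟩ := convexHull_nonempty_iff.1 this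
  exact ⟨v, h1, h2⟩

/-- The velocity at `p` of a curve in a polytope is tangent to the minimal face of `p`. -/
theorem hasDerivAt_mem_vectorSpan_carrierFace (hV : V.Finite) (hP : P = convexHull ℝ V)
    {c : ℝ → E} {b : E} (hc : ∀ᶠ s in 𝓝 0, c s ∈ P) (hb : HasDerivAt c b 0) :
    b ∈ vectorSpan ℝ (carrierFace P (c 0)) := by
  have hp : c 0 ∈ P := hc.self_of_nhds
  set p := c 0 with hp_def
  obtain ⟨l, h1, h2⟩ := exists_exposing_carrierFace hV hP hp
  have hVP : V ⊆ P := hP ▸ subset_convexHull ℝ V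
  by_contra hnot
  obtain ⟨m, hm0, hm⟩ := Submodule.exists_le_ker_of_notMem hnot
  have hmc : Continuous m := m.continuous_of_finiteDimensional
  -- A large multiple of `l` dominates `m`: generators in the face have `m (w - p) = 0`, the
  -- finitely many others have `l (w - p) > 0`.
  have hbound : ∀ {m : E →ₗ[ℝ] ℝ}, (vectorSpan ℝ (carrierFace P p) ≤ LinearMap.ker m) →
      ∃ C : ℝ, ∀ q ∈ P, 0 ≤ C * l (q - p) + m (q - p) := by
    intro m hm
    have hfin : ∃ C : ℝ, ∀ w ∈ V, 0 ≤ C * l (w - p) + m (w - p) := by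
      have : ∀ w ∈ V, ∃ C : ℝ, ∀ C' ≥ C, 0 ≤ C' * l (w - p) + m (w - p) := by
        intro w hw
        rcases (h1 w (hVP hw)).eq_or_lt with h | h
        · refine ⟨0, fun C' _ => ?_⟩
          have hwS := (h2 w (hVP hw)).1 h.symm
          have : m (w - p) = 0 := hm (sub_mem_vectorSpan_carrierFace hp hwS)
          rw [this, map_sub, h]; simp
        · have h' : 0 < l (w - p) := by rw [map_sub]; linarith
          refine ⟨-m (w - p) / l (w - p), fun C' hC' => ?_⟩
          have := (div_le_iff₀ h').1 hC'
          linarith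
      choose! C hC using this
      obtain ⟨C0, hC0⟩ := (hV.image C).bddAbove
      exact ⟨C0, fun w hw => hC w hw C0 (hC0 ⟨w, hw, rfl⟩)⟩
    obtain ⟨C, hC⟩ := hfin
    refine ⟨C, fun q hq => ?_⟩
    have hcv : Convex ℝ {q : E | 0 ≤ C * l (q - p) + m (q - p)} := by
      intro x hx y hy s t hs ht hst
      simp only [mem_ofPred_eq, map_sub, map_add, map_smul, smul_eq_mul] at hx hy ⊢
      obtain rfl : s = 1 - t := by linarith
      nlinarith
    rw [hP] at hq
    exact convexHull_min hC hcv hq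
  -- A functional nonnegative on `P - p` has a minimum at time `0` along the curve. Applied to `l`
  -- and to `C l + m`, this forces `m b = 0`.
  have hzero : ∀ {m : E →ₗ[ℝ] ℝ}, (∀ q ∈ P, 0 ≤ m (q - p)) → m b = 0 := by
    intro m hm
    set m' : E →L[ℝ] ℝ := LinearMap.toContinuousLinearMap m with hm'
    have hmb : ∀ x, m' x = m x := fun x => rfl
    have hd : HasDerivAt (fun s => m' (c s - p)) (m' b) 0 :=
      m'.hasFDerivAt.comp_hasDerivAt 0 (hb.sub_const p)
    have hmin : IsLocalMin (fun s => m' (c s - p)) 0 := by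
      filter_upwards [hc] with s hs
      have h0 : m' (c 0 - p) = 0 := by rw [← hp_def, sub_self, map_zero]
      rw [h0]
      exact hm _ hs
    exact hmin.hasDerivAt_eq_zero hd
  have hl : l b = 0 := hzero (m := (l : E →ₗ[ℝ] ℝ)) fun q hq => by
    simpa using h1 q hq
  obtain ⟨C, hC⟩ := hbound hm
  have h3 : C * l b + m b = 0 := hzero (m := C • (l : E →ₗ[ℝ] ℝ) + m) fun q hq => by
    simpa using hC q hq
  rw [hl, mul_zero, zero_add] at h3
  exact hm0 h3

/-- The open star of a vertex `v` of a polytope is cut out by an open set on which there is a smooth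
function that increases away from `v` and is proper on the star. -/
theorem exists_radial_exhaustion (hV : V.Finite) (hP : P = convexHull ℝ V)
    (hv : v ∈ P.extremePoints ℝ) :
    ∃ (W : Set E) (f : E → ℝ), IsOpen W ∧ (∀ p ∈ P, v ∈ carrierFace P p ↔ p ∈ W) ∧
      ContDiffOn ℝ ∞ f W ∧ (∀ R, IsCompact {p | p ∈ P ∧ p ∈ W ∧ f p ≤ R}) ∧
      f v = 0 ∧ ∀ p ∈ P, p ∈ W → p ≠ v → 0 < f p ∧ 0 < fderiv ℝ f p (p - v) := by
  have hconv : Convex ℝ P := hP ▸ convex_convexHull ℝ V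
  have hPc : IsCompact P := hP ▸ hV.isCompact_convexHull ℝ
  obtain ⟨lv, hlv1, hlv2⟩ := exists_exposing_carrierFace hV hP hv.1
  rw [carrierFace_of_mem_extremePoints hv] at hlv2
  have hfin : {F | (∃ p ∈ P, carrierFace P p = F) ∧ v ∉ F}.Finite :=
    (finite_carrierFaces hV hP).subset fun F hF => hF.1
  have : ∀ F ∈ {F | (∃ p ∈ P, carrierFace P p = F) ∧ v ∉ F}, ∃ (l : E →L[ℝ] ℝ) (c : ℝ),
      (∀ q ∈ P, c ≤ l q) ∧ ∀ q ∈ P, l q = c ↔ q ∈ F := by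
    rintro F ⟨⟨p, hp, rfl⟩, -⟩
    obtain ⟨l, h1, h2⟩ := exists_exposing_carrierFace hV hP hp
    exact ⟨l, l p, h1, h2⟩
  choose! l c hl1 hl2 using this
  set I := hfin.toFinset with hI
  have hmem : ∀ F, F ∈ I ↔ (∃ p ∈ P, carrierFace P p = F) ∧ v ∉ F := fun F => by simp [I]
  set a : Set E → E → ℝ := fun F q => l F q - c F with ha
  set L : E → ℝ := fun q => lv q - lv v with hL
  have ha0 : ∀ F ∈ I, ∀ q ∈ P, 0 ≤ a F q := fun F hF q hq =>
    sub_nonneg.2 (hl1 F ((hmem F).1 hF) q hq)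
  have ha1 : ∀ F ∈ I, ∀ q ∈ P, a F q = 0 ↔ q ∈ F := fun F hF q hq =>
    sub_eq_zero.trans (hl2 F ((hmem F).1 hF) q hq)
  have hav : ∀ F ∈ I, 0 < a F v := fun F hF =>
    (ha0 F hF v hv.1).lt_of_ne fun h => ((hmem F).1 hF).2 ((ha1 F hF v hv.1).1 h.symm)
  have hL0 : ∀ q ∈ P, 0 ≤ L q := fun q hq => sub_nonneg.2 (hlv1 q hq)
  have hL1 : ∀ q ∈ P, q ≠ v → 0 < L q := fun q hq hne => (hL0 q hq).lt_of_ne fun h =>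
    hne ((hlv2 q hq).1 (sub_eq_zero.1 h.symm))
  have hacd : ∀ F, ContDiff ℝ ∞ (a F) := fun F => (l F).contDiff.sub contDiff_const
  have hLcd : ContDiff ℝ ∞ L := lv.contDiff.sub contDiff_const
  set W : Set E := {q | ∀ F ∈ I, 0 < a F q} with hW
  -- `L` vanishes only at `v`, and `a F` vanishes exactly on the face `F`. The poles run along the
  -- faces that miss `v`, which form the complement of the open star.
  set f : E → ℝ := fun q => L q * (1 + ∑ F ∈ I, (a F q)⁻¹) with hf
  have hWo : IsOpen W := by
    have : W = ⋂ F ∈ I, {q | 0 < a F q} := by ext; simp [W]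
    rw [this]
    exact isOpen_biInter_finset fun F _ => isOpen_lt continuous_const (hacd F).continuous
  have hfcd : ContDiffOn ℝ ∞ f W :=
    hLcd.contDiffOn.mul (contDiffOn_const.add (ContDiffOn.sum fun F hF =>
      (hacd F).contDiffOn.inv fun q hq => (hq F hF).ne'))
  refine ⟨W, f, hWo, fun p hp => ⟨fun h F hF => ?_, fun h => ?_⟩, hfcd, fun R => ?_, ?_,
    fun p hp hpW hne => ⟨?_, ?_⟩⟩
  · refine (ha0 F hF p hp).lt_of_ne fun h0 => ((hmem F).1 hF).2 ?_
    have hpF := (ha1 F hF p hp).1 h0.symm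
    obtain ⟨⟨q, hq, rfl⟩, -⟩ := (hmem F).1 hF
    exact carrierFace_subset_of_mem hconv hpF h
  · by_contra hnot
    have hF : carrierFace P p ∈ I := (hmem _).2 ⟨⟨p, hp, rfl⟩, hnot⟩
    exact (h _ hF).ne' ((ha1 _ hF p hp).2 (self_mem_carrierFace hp))
  -- On the star `f p ≤ R` implies the closed condition `L p ≤ R * a F p`. If `a F p = 0`, this
  -- forces `L p = 0`, so `p = v`, where `a F` is positive; hence `K` stays inside `W`.
  · set K : Set E := P ∩ ⋂ F ∈ I, {p | L p ≤ R * a F p} with hK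
    have hKc : IsCompact K := hPc.inter_right (isClosed_biInter fun F _ =>
      isClosed_le hLcd.continuous (continuous_const.mul (hacd F).continuous))
    have hKW : K ⊆ W := by
      rintro p ⟨hp, h⟩ F hF
      refine (ha0 F hF p hp).lt_of_ne fun h0 => ?_
      have h1 : L p ≤ R * a F p := by simpa using mem_iInter₂.1 h F hF
      rw [← h0, mul_zero] at h1
      by_cases hpv : p = v
      · exact (hav F hF).ne (hpv ▸ h0)
      · exact (hL1 p hp hpv).not_ge h1
    have heq : {p | p ∈ P ∧ p ∈ W ∧ f p ≤ R} = K ∩ f ⁻¹' Iic R := by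
      ext p
      refine ⟨fun ⟨hp, hpW, h⟩ => ⟨⟨hp, mem_iInter₂.2 fun F hF => ?_⟩, h⟩,
        fun ⟨hpK, h⟩ => ⟨hpK.1, hKW hpK, h⟩⟩
      have h1 : (a F p)⁻¹ ≤ 1 + ∑ F ∈ I, (a F p)⁻¹ := by
        have := Finset.single_le_sum (f := fun F => (a F p)⁻¹)
          (fun G hG => (inv_pos.2 (hpW G hG)).le) hF
        linarith
      have h2 : L p * (a F p)⁻¹ ≤ R := (mul_le_mul_of_nonneg_left h1 (hL0 p hp)).trans h
      have h3 := hpW F hF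
      rwa [← div_eq_mul_inv, div_le_iff₀ h3] at h2
    rw [heq]
    exact hKc.of_isClosed_subset ((hfcd.continuousOn.mono hKW).preimage_isClosed_of_isClosed
      hKc.isClosed isClosed_Iic) inter_subset_left
  · simp [hf, hL]
  · exact mul_pos (hL1 p hp hne) (by
      have : 0 ≤ ∑ F ∈ I, (a F p)⁻¹ := Finset.sum_nonneg fun F hF => (inv_pos.2 (hpW F hF)).le
      linarith)
  · have hda : ∀ F, HasFDerivAt (a F) (l F) p := fun F => (l F).hasFDerivAt.sub_const _
    have hdL : HasFDerivAt L lv p := lv.hasFDerivAt.sub_const _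
    have hdf := hdL.mul ((hasFDerivAt_const (1 : ℝ) p).add (HasFDerivAt.fun_sum (u := I)
      fun F hF => (hasDerivAt_inv (hpW F hF).ne').comp_hasFDerivAt p (hda F)))
    -- In the direction `p - v` the derivative of the affine function `a F` is `a F p - a F v`, and
    -- the negative part cancels against the term that comes from differentiating `L`.
    have e1 : fderiv ℝ f p (p - v) = L p * (1 + ∑ F ∈ I, a F v * ((a F p) ^ 2)⁻¹) := by
      rw [HasFDerivAt.fderiv (f := f) hdf]
      have e2 : ∀ F, l F p - l F v = a F p - a F v := fun F => by simp [ha]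
      have e3 : lv p - lv v = L p := rfl
      simp only [add_apply, smul_apply, smul_eq_mul, sum_apply, zero_add,
        Pi.add_apply, Function.comp_apply, map_sub lv, map_sub (l _), e2, e3]
      rw [mul_comm _ (L p), ← mul_add, add_left_comm, ← Finset.sum_add_distrib]
      congr 2
      refine Finset.sum_congr rfl fun F hF => ?_
      have := (hpW F hF).ne'
      field_simp
      ring
    rw [e1]
    refine mul_pos (hL1 p hp hne) ?_
    have : 0 ≤ ∑ F ∈ I, a F v * ((a F p) ^ 2)⁻¹ := Finset.sum_nonneg fun F hF =>
      mul_nonneg (hav F hF).le (by positivity)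
    linarith

end Polytope

/-! ### Diffeomorphisms with small support -/

section Push

variable {E : Type*} [NormedAddCommGroup E] [NormedSpace ℝ E] [FiniteDimensional ℝ E]

/-- Moving points by a small multiple of a compactly supported field of constant direction is a
diffeomorphism. -/
theorem exists_diffeomorph_add_smul {η : E → ℝ} (hη : ContDiff ℝ ∞ η) (hc : HasCompactSupport η)
    (w : E) : ∃ δ > 0, ∀ ε : ℝ, 0 < ε → ε < δ →
      ∃ h : E ≃ₘ⟮𝓘(ℝ, E), 𝓘(ℝ, E)⟯ E, ∀ z, h z = z + (ε * η z) • w := by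
  obtain ⟨K, hK⟩ := hη.lipschitzWith_of_hasCompactSupport hc (by simp)
  refine ⟨1 / ((K : ℝ) * ‖w‖ + 1), by positivity, fun ε hε hεδ => ?_⟩
  have hsmall : ε * (K * ‖w‖) < 1 := by
    rw [lt_div_iff₀ (by positivity)] at hεδ
    nlinarith
  set f : E → E := fun z => z + (ε * η z) • w with hf
  have hfcd : ContDiff ℝ ∞ f := contDiff_id.add ((contDiff_const.mul hη).smul contDiff_const)
  set c : NNReal := ⟨ε * (K * ‖w‖), by positivity⟩ with hcdef
  -- The map is the identity plus a perturbation with Lipschitz constant `ε * (K * ‖w‖) < 1`, hence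
  -- a homeomorphism.
  have happ : ApproximatesLinearOn f ((ContinuousLinearEquiv.refl ℝ E : E ≃L[ℝ] E) : E →L[ℝ] E)
      univ c := by
    intro x _ y _
    have e1 : f x - f y - ((ContinuousLinearEquiv.refl ℝ E : E ≃L[ℝ] E) : E →L[ℝ] E) (x - y)
        = (ε * (η x - η y)) • w := by
      simp only [hf, ContinuousLinearEquiv.coe_refl, ContinuousLinearMap.id_apply]
      module
    rw [e1, norm_smul, norm_mul, Real.norm_of_nonneg hε.le]
    have := hK.dist_le_mul x y
    rw [dist_eq_norm, dist_eq_norm] at this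
    calc ε * ‖η x - η y‖ * ‖w‖ ≤ ε * (K * ‖x - y‖) * ‖w‖ := by gcongr
      _ = ε * (K * ‖w‖) * ‖x - y‖ := by ring
  have hcN : Subsingleton E ∨
      c < ‖((ContinuousLinearEquiv.refl ℝ E).symm : E →L[ℝ] E)‖₊⁻¹ := by
    rcases subsingleton_or_nontrivial E with h | h
    · exact Or.inl h
    · right
      have : ‖((ContinuousLinearEquiv.refl ℝ E).symm : E →L[ℝ] E)‖₊ = 1 := by
        rw [ContinuousLinearEquiv.refl_symm, ContinuousLinearEquiv.coe_refl]
        ext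
        exact ContinuousLinearMap.norm_id
      rw [this, inv_one]
      exact hsmall
  set F : E ≃ₜ E := happ.toHomeomorph f hcN with hF
  have hFf : (F : E → E) = f := rfl
  have hderiv : ∀ z, ∃ L : E ≃L[ℝ] E, HasFDerivAt F (L : E →L[ℝ] E) z := by
    intro z
    -- The derivative is `1 - T` with `‖T‖ < 1`, invertible by the Neumann series.
    set T : E →L[ℝ] E := -((ε • fderiv ℝ η z).smulRight w) with hT
    have hTn : ‖T‖ < 1 := by
      rw [hT, norm_neg]
      refine lt_of_le_of_lt ?_ hsmall
      rw [ContinuousLinearMap.norm_smulRight_apply, norm_smul, Real.norm_of_nonneg hε.le, mul_assoc]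
      gcongr
      exact norm_fderiv_le_of_lipschitz ℝ hK
    refine ⟨ContinuousLinearEquiv.unitsEquiv ℝ E (Units.oneSub T hTn), ?_⟩
    have h1 : HasFDerivAt f (ContinuousLinearMap.id ℝ E + (ε • fderiv ℝ η z).smulRight w) z :=
      (hasFDerivAt_id z).add
        (((hη.differentiable (by simp) z).hasFDerivAt.const_smul ε).smul_const w)
    convert h1 using 1
    ext x
    simp [hT]
  choose L hL using hderiv
  exact ⟨{ toEquiv := F.toEquiv
           contMDiff_toFun := hfcd.contMDiff
           contMDiff_invFun := (F.contDiff_symm hL hfcd).contMDiff }, fun z => rfl⟩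

end Push

/-! ### Extending diffeomorphisms from a chart, and pushing points down a function. -/

section Extend

/-- Transport of a self-map of the model space to the manifold by means of a chart. -/
def extendById {E M : Type*} [TopologicalSpace E] [TopologicalSpace M] (e : OpenPartialHomeomorph M E) (h : E → E) : M → M := by
  classical exact e.source.piecewise (fun x => e.symm (h (e x))) id

theorem extendById_of_mem {E M : Type*} [TopologicalSpace E] [TopologicalSpace M] {e : OpenPartialHomeomorph M E} {h : E → E} {x : M}
    (hx : x ∈ e.source) : extendById e h x = e.symm (h (e x)) :=
  by classical exact piecewise_eq_of_mem _ _ _ hx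

theorem extendById_of_notMem {E M : Type*} [TopologicalSpace E] [TopologicalSpace M] {e : OpenPartialHomeomorph M E} {h : E → E} {x : M}
    (hx : x ∉ e.source) : extendById e h x = x :=
  by classical exact piecewise_eq_of_notMem _ _ _ hx

variable {E : Type*} [NormedAddCommGroup E] [NormedSpace ℝ E] {M : Type*} [TopologicalSpace M]
  [ChartedSpace E M]

theorem contMDiff_extendById [T2Space M] {e : OpenPartialHomeomorph M E}
    (he : e ∈ IsManifold.maximalAtlas 𝓘(ℝ, E) ∞ M) {h : E → E} (hh : ContDiff ℝ ∞ h) {K : Set E}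
    (hK : IsCompact K) (hKe : K ⊆ e.target) (hid : ∀ z ∉ K, h z = z)
    (hmaps : MapsTo h e.target e.target) :
    ContMDiff 𝓘(ℝ, E) 𝓘(ℝ, E) ∞ (extendById e h) := by
  intro x
  by_cases hx : x ∈ e.source
  · have h1 : ContMDiffAt 𝓘(ℝ, E) 𝓘(ℝ, E) ∞ (fun x => e.symm (h (e x))) x := by
      have h2 : ContMDiffAt 𝓘(ℝ, E) 𝓘(ℝ, E) ∞ (h ∘ e) x :=
        hh.contMDiff.contMDiffAt.comp x (contMDiffAt_of_mem_maximalAtlas he hx)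
      exact (contMDiffAt_symm_of_mem_maximalAtlas he (hmaps (e.map_source hx))).comp x h2
    refine h1.congr_of_eventuallyEq ?_
    filter_upwards [e.open_source.mem_nhds hx] with y hy
    exact extendById_of_mem hy
  · have hcl : IsClosed (e.symm '' K) := (hK.image_of_continuousOn
      (e.continuousOn_symm.mono hKe)).isClosed
    have hxK : x ∈ (e.symm '' K)ᶜ := by
      rintro ⟨z, hz, rfl⟩
      exact hx (e.map_target (hKe hz))
    refine (contMDiffAt_id (I := 𝓘(ℝ, E)) (n := ∞) (x := x)).congr_of_eventuallyEq ?_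
    filter_upwards [hcl.isOpen_compl.mem_nhds hxK] with y hy
    by_cases hys : y ∈ e.source
    · rw [extendById_of_mem hys, hid, e.left_inv hys, id]
      exact fun hz => hy ⟨e y, hz, e.left_inv hys⟩
    · rw [extendById_of_notMem hys, id]

/-- A diffeomorphism of the model space with compact support in the target of a chart extends by
the identity to the manifold. -/
theorem exists_diffeomorph_extend [T2Space M] {e : OpenPartialHomeomorph M E}
    (he : e ∈ IsManifold.maximalAtlas 𝓘(ℝ, E) ∞ M) (h : E ≃ₘ⟮𝓘(ℝ, E), 𝓘(ℝ, E)⟯ E) {K : Set E}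
    (hK : IsCompact K) (hKe : K ⊆ e.target) (hid : ∀ z ∉ K, h z = z) :
    ∃ H : M ≃ₘ⟮𝓘(ℝ, E), 𝓘(ℝ, E)⟯ M, (∀ x ∈ e.source, H x = e.symm (h (e x))) ∧
      (∀ x ∈ e.source, h (e x) ∈ e.target) ∧ ∀ x ∉ e.source, H x = x := by
  have hid' : ∀ z ∉ K, h.symm z = z := fun z hz => by
    conv_lhs => rw [← hid z hz]
    exact h.symm_apply_apply z
  have hmaps : MapsTo h e.target e.target := by
    intro z hz
    by_cases hzK : h z ∈ K
    · exact hKe hzK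
    · have := hid _ hzK
      rwa [h.injective this]
  have hmaps' : MapsTo h.symm e.target e.target := by
    intro z hz
    by_cases hzK : h.symm z ∈ K
    · exact hKe hzK
    · have := hid' _ hzK
      rwa [h.symm.injective this]
  refine ⟨{ toFun := extendById e h
            invFun := extendById e h.symm
            left_inv := ?_
            right_inv := ?_
            contMDiff_toFun := contMDiff_extendById he h.contMDiff.contDiff hK hKe hid hmaps
            contMDiff_invFun :=
              contMDiff_extendById he h.symm.contMDiff.contDiff hK hKe hid' hmaps' },
    fun x hx => extendById_of_mem hx, fun x hx => hmaps (e.map_source hx),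
    fun x hx => extendById_of_notMem hx⟩
  · intro x
    by_cases hx : x ∈ e.source
    · have h1 := hmaps (e.map_source hx)
      rw [extendById_of_mem hx, extendById_of_mem (e.map_target h1), e.right_inv h1,
        h.symm_apply_apply, e.left_inv hx]
    · rw [extendById_of_notMem hx, extendById_of_notMem hx]
  · intro x
    by_cases hx : x ∈ e.source
    · have h1 := hmaps' (e.map_source hx)
      rw [extendById_of_mem hx, extendById_of_mem (e.map_target h1), e.right_inv h1,
        h.apply_symm_apply, e.left_inv hx]
    · rw [extendById_of_notMem hx, extendById_of_notMem hx]

/-- The function `f` can be decreased at `y` by diffeomorphisms with arbitrarily small support that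
decrease `f` wherever they are not the identity. -/
def IsPushable (E : Type*) [NormedAddCommGroup E] [NormedSpace ℝ E] {M : Type*}
    [TopologicalSpace M] [ChartedSpace E M] (f : M → ℝ) (y : M) : Prop :=
  ∀ N ∈ 𝓝 y, ∃ H : M ≃ₘ⟮𝓘(ℝ, E), 𝓘(ℝ, E)⟯ M,
    (∀ x ∉ N, H x = x) ∧ (∀ x, H x = x ∨ f (H x) < f x) ∧ H y ≠ y

theorem isPushable_of_fderiv_ne_zero [FiniteDimensional ℝ E] [T2Space M] {e : OpenPartialHomeomorph M E}
    (he : e ∈ IsManifold.maximalAtlas 𝓘(ℝ, E) ∞ M) {f : M → ℝ} {y : M} (hy : y ∈ e.source)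
    (hf : ContDiffAt ℝ 1 (fun z => f (e.symm z)) (e y)) {w : E}
    (hw : fderiv ℝ (fun z => f (e.symm z)) (e y) w ≠ 0) : IsPushable E f y := by
  intro N hN
  set G : E → ℝ := fun z => f (e.symm z) with hG
  wlog hneg : fderiv ℝ G (e y) w < 0 generalizing w
  · refine this (w := -w) (by simpa using hw) ?_
    rw [map_neg, neg_lt_zero]
    exact lt_of_le_of_ne (not_lt.1 hneg) hw.symm
  have hev : ∀ᶠ z in 𝓝 (e y), z ∈ e.target ∧ e.symm z ∈ N ∧ DifferentiableAt ℝ G z ∧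
      fderiv ℝ G z w < 0 := by
    have h1 : ∀ᶠ z in 𝓝 (e y), ContDiffAt ℝ 1 G z := hf.eventually (by simp)
    have h2 : ContinuousAt (fun z => fderiv ℝ G z w) (e y) :=
      ((hf.fderiv_right (m := 0) (by simp)).continuousAt).clm_apply continuousAt_const
    have h3 : e.symm ⁻¹' N ∈ 𝓝 (e y) :=
      (e.continuousAt_symm (e.map_source hy)) (by rwa [e.left_inv hy])
    filter_upwards [e.open_target.mem_nhds (e.map_source hy), h3, h1,
      h2.eventually_lt continuousAt_const hneg] with z a b c d
    exact ⟨a, b, c.differentiableAt (by simp), d⟩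
  obtain ⟨ρ, hρ, hball⟩ := Metric.eventually_nhds_iff_ball.1 hev
  let η : ContDiffBump (e y) := ⟨ρ / 4, ρ / 2, by positivity, by linarith⟩
  have hηout : ∀ z ∉ Metric.closedBall (e y) (ρ / 2), η z = 0 := fun z hz =>
    η.zero_of_le_dist (le_of_lt (not_le.1 hz))
  obtain ⟨δ, hδ, hdiff⟩ := exists_diffeomorph_add_smul (η.contDiff (n := ⊤)) η.hasCompactSupport w
  -- The first bound makes the push a diffeomorphism; the second keeps points of the half-size ball
  -- inside the ball of radius `ρ` while they move.
  set ε := min (δ / 2) (ρ / 4 / (‖w‖ + 1)) with hε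
  have hεpos : 0 < ε := by positivity
  obtain ⟨h, hh⟩ := hdiff ε hεpos (lt_of_le_of_lt (min_le_left _ _) (by linarith))
  have hεw : ε * ‖w‖ < ρ / 2 := by
    have h1 : ε * (‖w‖ + 1) ≤ ρ / 4 := (le_div_iff₀ (by positivity)).1 (min_le_right _ _)
    nlinarith
  have hsub : Metric.closedBall (e y) (ρ / 2) ⊆ Metric.ball (e y) ρ :=
    Metric.closedBall_subset_ball (by linarith)
  obtain ⟨H, H1, H2, H3⟩ := exists_diffeomorph_extend he h
    (isCompact_closedBall (e y) (ρ / 2)) (fun z hz => (hball z (hsub hz)).1)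
    (fun z hz => by rw [hh, hηout z hz, mul_zero, zero_smul, add_zero])
  have hHid : ∀ x ∈ e.source, η (e x) = 0 → H x = x := fun x hx h0 => by
    rw [H1 x hx, hh, h0, mul_zero, zero_smul, add_zero, e.left_inv hx]
  have hHlt : ∀ x ∈ e.source, η (e x) ≠ 0 → f (H x) < f x := by
    intro x hx hne
    have hηpos : 0 < η (e x) := lt_of_le_of_ne η.nonneg hne.symm
    have hxb : e x ∈ Metric.closedBall (e y) (ρ / 2) := by
      by_contra hcon
      exact hne (hηout _ hcon)
    have hline : ∀ s ∈ Icc 0 (ε * η (e x)), e x + s • w ∈ Metric.ball (e y) ρ := by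
      intro s hs
      rw [mem_ball_iff_norm, add_sub_right_comm]
      refine (norm_add_le _ _).trans_lt ?_
      rw [mem_closedBall_iff_norm] at hxb
      rw [norm_smul, Real.norm_of_nonneg hs.1]
      have h1 : s ≤ ε := hs.2.trans (mul_le_of_le_one_right hεpos.le η.le_one)
      nlinarith [norm_nonneg w]
    -- The whole segment from `e x` to its image lies where the derivative along `w` is negative.
    have hanti : StrictAntiOn (fun s : ℝ => G (e x + s • w)) (Icc 0 (ε * η (e x))) := by
      have hd : ∀ s ∈ Icc 0 (ε * η (e x)), HasDerivAt (fun s : ℝ => G (e x + s • w))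
          (fderiv ℝ G (e x + s • w) w) s := by
        intro s hs
        have h1 : HasDerivAt (fun s : ℝ => e x + s • w) w s := by
          simpa using ((hasDerivAt_id s).smul_const w).const_add (e x)
        exact (hball _ (hline s hs)).2.2.1.hasFDerivAt.comp_hasDerivAt s h1
      refine strictAntiOn_of_deriv_neg (convex_Icc _ _)
        (fun s hs => (hd s hs).continuousAt.continuousWithinAt) fun s hs => ?_
      rw [interior_Icc] at hs
      rw [(hd s (Ioo_subset_Icc_self hs)).deriv]
      exact (hball _ (hline s (Ioo_subset_Icc_self hs))).2.2.2
    have hpos : 0 < ε * η (e x) := by positivity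
    have := hanti (left_mem_Icc.2 hpos.le) (right_mem_Icc.2 hpos.le) hpos
    simp only [zero_smul, add_zero, hG] at this
    rw [H1 x hx, hh]
    rwa [e.left_inv hx] at this
  refine ⟨H, fun x hxN => ?_, fun x => ?_, fun hcon => ?_⟩
  · by_cases hx : x ∈ e.source
    · refine hHid x hx (hηout _ fun hxb => hxN ?_)
      have := (hball _ (hsub hxb)).2.1
      rwa [e.left_inv hx] at this
    · exact H3 x hx
  · by_cases hx : x ∈ e.source
    · by_cases h0 : η (e x) = 0
      · exact Or.inl (hHid x hx h0)
      · exact Or.inr (hHlt x hx h0)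
    · exact Or.inl (H3 x hx)
  · have := hHlt y hy (by
      rw [η.one_of_mem_closedBall (Metric.mem_closedBall_self η.rIn_pos.le)]; exact one_ne_zero)
    rw [hcon] at this
    exact lt_irrefl _ this

end Extend

/-! ### Engulfing and recognition of the model space -/

section Engulf

variable {E : Type*} [NormedAddCommGroup E] [NormedSpace ℝ E] {M : Type*} [TopologicalSpace M]
  [ChartedSpace E M]

theorem Diffeomorph.mapsTo_of_forall_notMem (H : M ≃ₘ⟮𝓘(ℝ, E), 𝓘(ℝ, E)⟯ M) {O : Set M}
    (h : ∀ x ∉ O, H x = x) : MapsTo H O O := by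
  intro x hx
  by_contra hcon
  have := h _ hcon
  exact hcon (by rwa [H.injective this])

theorem Diffeomorph.symm_apply_of_eq (H : M ≃ₘ⟮𝓘(ℝ, E), 𝓘(ℝ, E)⟯ M) {x : M} (h : H x = x) :
    H.symm x = x := by
  conv_lhs => rw [← h]
  exact H.symm_apply_apply x

/-- If `f` is pushable on the part `{c ≤ f}` of an open set `O` on which `f` is proper, then the
sublevel set `{f ≤ R}` can be moved into `{f < c}` by a diffeomorphism. -/
theorem exists_diffeomorph_lt [T2Space M] {f : M → ℝ} {O Z : Set M} (hO : IsOpen O)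
    (hf : ContinuousOn f O) (hZ : IsClosed Z) {c R : ℝ} (hcpt : IsCompact {x | x ∈ O ∧ f x ≤ R})
    (hpush : ∀ x ∈ O, c ≤ f x → x ∉ Z ∧ IsPushable E f x) :
    ∃ H : M ≃ₘ⟮𝓘(ℝ, E), 𝓘(ℝ, E)⟯ M, (∀ x ∈ Z, H x = x) ∧ (∀ x ∉ O, H x = x) ∧
      ∀ x ∈ O, f x ≤ R → f (H x) < c := by
  set A : Set M := {x | x ∈ O ∧ f x ≤ R} ∩ f ⁻¹' Ici c with hA
  have hAc : IsCompact A := hcpt.of_isClosed_subset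
    ((hf.mono fun x hx => hx.1).preimage_isClosed_of_isClosed hcpt.isClosed isClosed_Ici)
    inter_subset_left
  -- This class is closed under composition, and a composite moves every point that one of its
  -- factors moves, since a strict decrease of `f` cannot be undone.
  let good : (M ≃ₘ⟮𝓘(ℝ, E), 𝓘(ℝ, E)⟯ M) → Prop := fun H =>
    (∀ x ∈ Z, H x = x) ∧ (∀ x ∉ O, H x = x) ∧ ∀ x, H x = x ∨ f (H x) < f x
  have good_refl : good (Diffeomorph.refl 𝓘(ℝ, E) M ∞) :=
    ⟨fun _ _ => rfl, fun _ _ => rfl, fun _ => Or.inl rfl⟩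
  have good_trans : ∀ {H K}, good H → good K → good (H.trans K) := by
    rintro H K ⟨h1, h2, h3⟩ ⟨k1, k2, k3⟩
    refine ⟨fun x hx => ?_, fun x hx => ?_, fun x => ?_⟩
    · rw [Diffeomorph.coe_trans, Function.comp_apply, h1 x hx, k1 x hx]
    · rw [Diffeomorph.coe_trans, Function.comp_apply, h2 x hx, k2 x hx]
    · rw [Diffeomorph.coe_trans, Function.comp_apply]
      rcases h3 x with h | h
      · rw [h]; exact k3 x
      · rcases k3 (H x) with k | k
        · rw [k]; exact Or.inr h
        · exact Or.inr (k.trans h)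
  have moved : ∃ k, good k ∧ ∀ x ∈ A, k x ≠ x := by
    refine hAc.induction_on (p := fun s => ∃ k, good k ∧ ∀ x ∈ s, k x ≠ x)
      ⟨_, good_refl, by simp⟩ (fun s t hst ⟨k, hk, h⟩ => ⟨k, hk, fun x hx => h x (hst hx)⟩) ?_ ?_
    · rintro s t ⟨H, hH, hs⟩ ⟨K, hK, ht⟩
      refine ⟨H.trans K, good_trans hH hK, fun x hx hcon => ?_⟩
      rw [Diffeomorph.coe_trans, Function.comp_apply] at hcon
      rcases hH.2.2 x with h | h
      · rw [h] at hcon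
        exact hx.elim (fun hx => hs x hx h) (fun hx => ht x hx hcon)
      · rcases hK.2.2 (H x) with k | k
        · rw [k] at hcon; rw [hcon] at h; exact lt_irrefl _ h
        · rw [hcon] at k; exact lt_asymm h k
    · rintro x ⟨⟨hxO, -⟩, hxc⟩
      obtain ⟨hxZ, hp⟩ := hpush x hxO hxc
      obtain ⟨H, h1, h2, h3⟩ := hp (O ∩ Zᶜ) ((hO.inter hZ.isOpen_compl).mem_nhds ⟨hxO, hxZ⟩)
      refine ⟨{y | H y ≠ y}, mem_nhdsWithin_of_mem_nhds
        ((isOpen_ne_fun H.continuous continuous_id).mem_nhds h3), H,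
        ⟨fun y hy => h1 y fun h => h.2 hy, fun y hy => h1 y fun h => hy h.1, h2⟩, fun y hy => hy⟩
  obtain ⟨k, hk, hkA⟩ := moved
  have hkO := k.mapsTo_of_forall_notMem hk.2.1
  -- By compactness one diffeomorphism `k` moves all of the slab `A = {c ≤ f ≤ R}`; the decrease is
  -- continuous and positive on `A`, so it is bounded below.
  have hdec : ∃ ε > 0, ∀ x ∈ A, f (k x) ≤ f x - ε := by
    rcases A.eq_empty_or_nonempty with h | hne
    · exact ⟨1, one_pos, by simp [h]⟩
    · have hcont : ContinuousOn (fun x => f x - f (k x)) A := by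
        have hAO : A ⊆ O := fun x hx => hx.1.1
        exact (hf.mono hAO).sub (hf.comp k.continuous.continuousOn fun x hx => hkO (hAO hx))
      obtain ⟨x, hx, hmin⟩ := hAc.exists_isMinOn hne hcont
      refine ⟨f x - f (k x), ?_, fun y hy => ?_⟩
      · have := (hk.2.2 x).resolve_left (hkA x hx)
        linarith
      · have : f x - f (k x) ≤ f y - f (k y) := hmin hy
        linarith
  obtain ⟨ε, hε, hdec⟩ := hdec
  have hle : ∀ x, f (k x) ≤ f x := fun x => (hk.2.2 x).elim (fun h => by rw [h]) le_of_lt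
  -- Each application of `k` lowers `f` by at least `ε` while the point is in the slab, and a point
  -- below `c` stays below.
  have iter : ∀ j : ℕ, ∃ H, good H ∧ ∀ x ∈ O, f x ≤ R → f (H x) < c ∨ f (H x) ≤ R - j * ε := by
    intro j
    induction j with
    | zero => exact ⟨_, good_refl, fun x _ hx => Or.inr (by simpa using hx)⟩
    | succ j ih =>
      obtain ⟨H, hH, h⟩ := ih
      refine ⟨H.trans k, good_trans hH hk, fun x hx hxR => ?_⟩
      rw [Diffeomorph.coe_trans, Function.comp_apply]
      rcases lt_or_ge (f (H x)) c with h' | h'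
      · exact Or.inl ((hle _).trans_lt h')
      · have h1 := (h x hx hxR).resolve_left h'.not_gt
        have h2 : f (H x) ≤ R := by
          have : 0 ≤ j * ε := by positivity
          linarith
        have h3 := hdec (H x) ⟨⟨H.mapsTo_of_forall_notMem hH.2.1 hx, h2⟩, h'⟩
        right
        push_cast
        linarith
  obtain ⟨j, hj⟩ := exists_nat_gt ((R - c) / ε)
  obtain ⟨H, hH, h⟩ := iter j
  refine ⟨H, hH.1, hH.2.1, fun x hx hxR => (h x hx hxR).elim id fun h' => h'.trans_lt ?_⟩
  rw [div_lt_iff₀ hε] at hj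
  linarith

/-- An open set `O` is diffeomorphic to an open subset `U` if every compact subset of `O` can be
engulfed by `U` by means of diffeomorphisms that fix any given compact subset of `U`. -/
theorem exists_openPartialHomeomorph_of_engulfing {U O : Set M} (hO : IsOpen O)
    (hUO : U ⊆ O) {C K : ℕ → Set M} (hC : ∀ j, IsCompact (C j)) (hCU : ∀ j, C j ⊆ U)
    (hCi : ∀ x ∈ U, ∃ j, x ∈ interior (C j))
    (hK : ∀ j, IsCompact (K j)) (hKO : ∀ j, K j ⊆ O) (hKu : ∀ x ∈ O, ∃ j, x ∈ K j)
    (heng : ∀ C K : Set M, IsCompact C → C ⊆ U → IsCompact K → K ⊆ O →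
      ∃ H : M ≃ₘ⟮𝓘(ℝ, E), 𝓘(ℝ, E)⟯ M, (∀ x ∈ C, H x = x) ∧ (∀ x ∉ O, H x = x) ∧ K ⊆ H '' U) :
    ∃ F : OpenPartialHomeomorph M M, F.source = U ∧ F.target = O ∧
      ContMDiffOn 𝓘(ℝ, E) 𝓘(ℝ, E) ∞ F U ∧ ContMDiffOn 𝓘(ℝ, E) 𝓘(ℝ, E) ∞ F.symm O := by
  -- A state is a diffeomorphism together with a compact part of `U` on which it will never be
  -- changed again.
  let St := {s : (M ≃ₘ⟮𝓘(ℝ, E), 𝓘(ℝ, E)⟯ M) × Set M //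
    IsCompact s.2 ∧ s.2 ⊆ U ∧ ∀ x ∉ O, s.1 x = x}
  have step : ∀ (j : ℕ) (s : St), ∃ t : St, (∀ x ∈ s.1.2 ∪ C j, t.1.1 x = s.1.1 x) ∧
      s.1.2 ∪ C j ⊆ t.1.2 ∧ K j ⊆ t.1.1 '' t.1.2 := by
    rintro j ⟨⟨Φ, D⟩, hD, hDU, hΦ⟩
    have hΦ' : ∀ x ∉ O, Φ.symm x = x := fun x hx => Φ.symm_apply_of_eq (hΦ x hx)
    -- To cover `K j`, the set is first pulled back by `Φ`; the new map is `Φ ∘ χ`, equal to `Φ`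
    -- where `χ` is the identity.
    obtain ⟨χ, h1, h2, h3⟩ := heng (D ∪ C j) (Φ.symm '' K j) (hD.union (hC j))
      (union_subset hDU (hCU j)) ((hK j).image Φ.symm.continuous) (by
        rintro _ ⟨x, hx, rfl⟩
        exact Φ.symm.mapsTo_of_forall_notMem hΦ' (hKO j hx))
    have h4 : χ.symm '' (Φ.symm '' K j) ⊆ U := by
      rintro _ ⟨x, hx, rfl⟩
      obtain ⟨u, hu, rfl⟩ := h3 hx
      rwa [χ.symm_apply_apply]
    refine ⟨⟨(χ.trans Φ, (D ∪ C j) ∪ χ.symm '' (Φ.symm '' K j)), ?_, ?_, ?_⟩, ?_, ?_, ?_⟩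
    · exact (hD.union (hC j)).union (((hK j).image Φ.symm.continuous).image χ.symm.continuous)
    · exact union_subset (union_subset hDU (hCU j)) h4
    · intro x hx
      simp only [Diffeomorph.coe_trans, Function.comp_apply]
      rw [h2 x hx, hΦ x hx]
    · intro x hx
      simp only [Diffeomorph.coe_trans, Function.comp_apply]
      rw [h1 x hx]
    · exact subset_union_left
    · intro x hx
      refine ⟨χ.symm (Φ.symm x), Or.inr ⟨_, ⟨x, hx, rfl⟩, rfl⟩, ?_⟩
      simp only [Diffeomorph.coe_trans, Function.comp_apply]
      rw [χ.apply_symm_apply, Φ.apply_symm_apply]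
  choose next hn1 hn2 hn3 using step
  let s : ℕ → St := fun j => Nat.rec
    ⟨(Diffeomorph.refl 𝓘(ℝ, E) M ∞, ∅), isCompact_empty, empty_subset _, fun _ _ => rfl⟩ next j
  have hs : ∀ j, s (j + 1) = next j (s j) := fun j => rfl
  -- The shift by one drops the initial state `(id, ∅)`, so that `D j` already contains `C j` and `Φ
  -- j '' D j` contains `K j`.
  let Φ : ℕ → M ≃ₘ⟮𝓘(ℝ, E), 𝓘(ℝ, E)⟯ M := fun j => (s (j + 1)).1.1
  let D : ℕ → Set M := fun j => (s (j + 1)).1.2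
  have hDm : Monotone D := monotone_nat_of_le_succ fun j =>
    subset_union_left.trans (hn2 (j + 1) (s (j + 1)))
  have hCD : ∀ j, C j ⊆ D j := fun j => subset_union_right.trans (hn2 j (s j))
  have hKD : ∀ j, K j ⊆ Φ j '' D j := fun j => hn3 j (s j)
  have hDU : ∀ j, D j ⊆ U := fun j => (s (j + 1)).2.2.1
  have hΦO : ∀ j, MapsTo (Φ j) O O := fun j =>
    (Φ j).mapsTo_of_forall_notMem (s (j + 1)).2.2.2
  have hagree : ∀ {i j}, i ≤ j → ∀ x ∈ D i, Φ j x = Φ i x := by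
    intro i j hij
    induction j, hij using Nat.le_induction with
    | base => exact fun _ _ => rfl
    | succ j hij ih =>
      intro x hx
      exact (hn1 (j + 1) (s (j + 1)) x (Or.inl (hDm hij hx))).trans (ih x hx)
  have hUD : ∀ x ∈ U, ∃ j, x ∈ interior (D j) := fun x hx => by
    obtain ⟨j, hj⟩ := hCi x hx
    exact ⟨j, interior_mono (hCD j) hj⟩
  choose! N hN using hUD
  have hND : ∀ x ∈ U, x ∈ D (N x) := fun x hx => interior_subset (hN x hx)
  -- Near every point of `U` the sequence is eventually constant, so its limit is locally one of the
  -- diffeomorphisms `Φ j`.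
  let F : M → M := fun x => Φ (N x) x
  have hF : ∀ {j x}, x ∈ D j → F x = Φ j x := by
    intro j x hx
    have hxU := hDU j hx
    rcases le_total (N x) j with h | h
    · exact (hagree h x (hND x hxU)).symm
    · exact hagree h x hx
  have hinj : InjOn F U := by
    intro x hx y hy hxy
    have h1 := hDm (le_max_left (N x) (N y)) (hND x hx)
    have h2 := hDm (le_max_right (N x) (N y)) (hND y hy)
    rw [hF h1, hF h2] at hxy
    exact (Φ _).injective hxy
  have hmaps : MapsTo F U O := fun x hx => hΦO _ (hUO hx)
  have hsurj : SurjOn F U O := by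
    intro y hy
    obtain ⟨j, hj⟩ := hKu y hy
    obtain ⟨x, hx, rfl⟩ := hKD j hj
    exact ⟨x, hDU j hx, hF hx⟩
  have hbij : BijOn F U O := ⟨hmaps, hinj, hsurj⟩
  have hUo : IsOpen U := isOpen_iff_mem_nhds.2 fun x hx =>
    Filter.mem_of_superset (mem_interior_iff_mem_nhds.1 (hN x hx)) (hDU _)
  have hsmooth : ∀ x ∈ U, ContMDiffAt 𝓘(ℝ, E) 𝓘(ℝ, E) ∞ F x := by
    intro x hx
    refine ((Φ (N x)).contMDiff x).congr_of_eventuallyEq ?_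
    filter_upwards [mem_interior_iff_mem_nhds.1 (hN x hx)] with y hy
    exact hF hy
  -- The inverse is defined by choice and needs a point of `M`, so the empty case is separate.
  rcases U.eq_empty_or_nonempty with hUe | ⟨x0, hx0⟩
  · have hOe : O = ∅ := by
      rw [eq_empty_iff_forall_notMem]
      intro y hy
      obtain ⟨x, hx, -⟩ := hsurj hy
      simp [hUe] at hx
    refine ⟨(OpenPartialHomeomorph.refl M).restrOpen ∅ isOpen_empty, by simp [hUe], ?_, ?_, ?_⟩
    · rw [hOe, eq_empty_iff_forall_notMem]
      intro y hy
      simpa using ((OpenPartialHomeomorph.refl M).restrOpen ∅ isOpen_empty).map_target hy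
    · rw [hUe]; exact fun x hx => hx.elim
    · rw [hOe]; exact fun x hx => hx.elim
  have : Nonempty M := ⟨x0⟩
  let G := Function.invFunOn F U
  have hG : ∀ x ∈ U, G (F x) = x := fun x hx => hinj.leftInvOn_invFunOn hx
  have hGO : ∀ y ∈ O, G y ∈ U ∧ F (G y) = y := fun y hy =>
    ⟨Function.invFunOn_mem (hsurj hy), Function.invFunOn_eq (hsurj hy)⟩
  have hGsmooth : ∀ y ∈ O, ContMDiffAt 𝓘(ℝ, E) 𝓘(ℝ, E) ∞ G y := by
    intro y hy
    obtain ⟨hx, hxy⟩ := hGO y hy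
    set x := G y with hxdef
    refine ((Φ (N x)).symm.contMDiff y).congr_of_eventuallyEq ?_
    have hop : IsOpen (Φ (N x) '' interior (D (N x))) :=
      (Φ (N x)).toHomeomorph.isOpenMap _ isOpen_interior
    have hy' : y ∈ Φ (N x) '' interior (D (N x)) := ⟨x, hN x hx, by
      rw [← hF (hND x hx)]; exact hxy⟩
    filter_upwards [hop.mem_nhds hy'] with z hz
    obtain ⟨u, hu, rfl⟩ := hz
    have hu' := interior_subset hu
    rw [(Φ (N x)).symm_apply_apply, ← hF hu', hG u (hDU _ hu')]
  exact ⟨{ toFun := F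
           invFun := G
           source := U
           target := O
           map_source' := hmaps
           map_target' := fun y hy => (hGO y hy).1
           left_inv' := hG
           right_inv' := fun y hy => (hGO y hy).2
           open_source := hUo
           open_target := hO
           continuousOn_toFun := fun x hx => (hsmooth x hx).continuousAt.continuousWithinAt
           continuousOn_invFun := fun y hy => (hGsmooth y hy).continuousAt.continuousWithinAt },
    rfl, rfl, fun x hx => (hsmooth x hx).contMDiffWithinAt,
    fun y hy => (hGsmooth y hy).contMDiffWithinAt⟩

end Engulf

/-! ### Charts onto the whole model space. -/

section Recognition

variable {E : Type*} [NormedAddCommGroup E] [InnerProductSpace ℝ E] {M : Type*}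
  [TopologicalSpace M] [ChartedSpace E M]

theorem mem_maximalAtlas_trans [IsManifold 𝓘(ℝ, E) ∞ M] {e : OpenPartialHomeomorph M E}
    (he : e ∈ IsManifold.maximalAtlas 𝓘(ℝ, E) ∞ M) {φ : OpenPartialHomeomorph E E}
    (hφ : ContDiffOn ℝ ∞ φ φ.source) (hφ' : ContDiffOn ℝ ∞ φ.symm φ.target) :
    e.trans φ ∈ IsManifold.maximalAtlas 𝓘(ℝ, E) ∞ M := by
  refine OpenPartialHomeomorph.mem_maximalAtlas_of_contMDiffOn _ ?_ ?_
  · rw [OpenPartialHomeomorph.trans_source]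
    exact hφ.contMDiffOn.comp ((contMDiffOn_of_mem_maximalAtlas he).mono inter_subset_left)
      fun x hx => hx.2
  · rw [OpenPartialHomeomorph.trans_target]
    exact (contMDiffOn_symm_of_mem_maximalAtlas he).comp (hφ'.contMDiffOn.mono inter_subset_left)
      fun x hx => hx.2

/-- Every neighbourhood of a point contains the domain of a chart onto the model space. -/
theorem exists_chart_target_univ [IsManifold 𝓘(ℝ, E) ∞ M] {O : Set M} (hO : IsOpen O) {x : M}
    (hx : x ∈ O) : ∃ e ∈ IsManifold.maximalAtlas 𝓘(ℝ, E) ∞ M, x ∈ e.source ∧ e.source ⊆ O ∧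
      e.target = univ ∧ e x = 0 := by
  set e₀ := chartAt E x with he₀
  have hx₀ : x ∈ e₀.source := mem_chart_source E x
  have h1 : e₀.target ∩ e₀.symm ⁻¹' O ∈ 𝓝 (e₀ x) :=
    (e₀.isOpen_inter_preimage_symm hO).mem_nhds ⟨e₀.map_source hx₀, by
      rwa [mem_preimage, e₀.left_inv hx₀]⟩
  obtain ⟨r, hr, hball⟩ := Metric.mem_nhds_iff.1 h1
  set φ := (OpenPartialHomeomorph.univBall (e₀ x) r).symm with hφ
  have hs : φ.source = Metric.ball (e₀ x) r := OpenPartialHomeomorph.univBall_target _ hr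
  have ht : φ.target = univ := OpenPartialHomeomorph.univBall_source _ _
  refine ⟨e₀.trans φ, mem_maximalAtlas_trans (IsManifold.chart_mem_maximalAtlas x) ?_ ?_,
    ?_, ?_, ?_, ?_⟩
  · rw [hs]
    exact OpenPartialHomeomorph.contDiffOn_univBall_symm (n := ⊤)
  · exact (OpenPartialHomeomorph.contDiff_univBall (n := ⊤)).contDiffOn
  · rw [OpenPartialHomeomorph.trans_source, hs]
    exact ⟨hx₀, Metric.mem_ball_self hr⟩
  · rw [OpenPartialHomeomorph.trans_source, hs]
    rintro y ⟨hy, hy'⟩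
    have := (hball hy').2
    rwa [mem_preimage, e₀.left_inv hy] at this
  · rw [OpenPartialHomeomorph.trans_target, ht, univ_inter, eq_univ_iff_forall]
    intro z
    have : φ.symm z ∈ φ.source := φ.map_target (by rw [ht]; trivial)
    rw [hs] at this
    exact (hball this).1
  · rw [OpenPartialHomeomorph.coe_trans, Function.comp_apply, hφ]
    exact OpenPartialHomeomorph.univBall_symm_apply_center _ _

/-- An open set on which there is a proper function without critical points other than a unique
minimum is diffeomorphic to the model space. -/
theorem exists_chart_of_exhaustion [FiniteDimensional ℝ E] [T2Space M]
    [IsManifold 𝓘(ℝ, E) ∞ M] {O : Set M} (hO : IsOpen O) {f : M → ℝ} (hf : ContinuousOn f O)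
    (hcpt : ∀ R, IsCompact {x | x ∈ O ∧ f x ≤ R}) {x₀ : M} (hx₀ : x₀ ∈ O)
    (hmin : ∀ x ∈ O, x ≠ x₀ → f x₀ < f x) (hpush : ∀ x ∈ O, x ≠ x₀ → IsPushable E f x) :
    ∃ e ∈ IsManifold.maximalAtlas 𝓘(ℝ, E) ∞ M, e.source = O ∧ e.target = univ ∧ e x₀ = 0 := by
  obtain ⟨e, he, hxe, heO, het, hex⟩ := exists_chart_target_univ (E := E) hO hx₀
  set U := e.source with hU
  have hUo : IsOpen U := e.open_source
  have hsymm : Continuous e.symm := by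
    have := e.continuousOn_symm
    rwa [het, continuousOn_univ] at this
  have hright : ∀ z, e (e.symm z) = z := fun z => e.right_inv (by rw [het]; trivial)
  have hsU : ∀ z, e.symm z ∈ U := fun z => e.map_target (by rw [het]; trivial)
  -- the squared norm in the chart
  set N : M → ℝ := fun x => ‖e x‖ ^ 2 with hN
  have hNcont : ContinuousOn N U := (e.continuousOn.norm).pow 2
  have hNcpt : ∀ R, IsCompact {x | x ∈ U ∧ N x ≤ R} := by
    intro R
    have h1 : IsCompact {z : E | ‖z‖ ^ 2 ≤ R} := by
      refine (isCompact_closedBall (0 : E) √R).of_isClosed_subset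
        (isClosed_le (by fun_prop) continuous_const) fun z hz => ?_
      rw [mem_closedBall_zero_iff]
      exact Real.le_sqrt_of_sq_le hz
    convert h1.image hsymm using 1
    ext x
    refine ⟨fun ⟨hx, h⟩ => ⟨e x, h, e.left_inv hx⟩, ?_⟩
    rintro ⟨z, hz, rfl⟩
    exact ⟨hsU z, by simpa [N, hright] using hz⟩
  have hNpush : ∀ x ∈ U, 0 < N x → IsPushable E N x := by
    intro x hx hpos
    have hG : (fun z => N (e.symm z)) = fun z => ‖z‖ ^ 2 := by
      ext z; simp [N, hright]
    refine isPushable_of_fderiv_ne_zero he hx (w := e x) ?_ ?_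
    · rw [hG]; exact (contDiff_norm_sq ℝ).contDiffAt
    · rw [hG]
      have := (hasStrictFDerivAt_norm_sq (F := E) (e x)).hasFDerivAt.fderiv
      rw [this]
      simp only [smul_apply, innerSL_apply_apply, real_inner_self_eq_norm_sq]
      simpa [N] using hpos.ne'
  have shrink : ∀ {δ : ℝ} (R : ℝ), 0 < δ → ∃ g : M ≃ₘ⟮𝓘(ℝ, E), 𝓘(ℝ, E)⟯ M, (∀ x ∉ U, g x = x) ∧
      ∀ x ∈ U, N x ≤ R → N (g x) < δ := by
    intro δ R hδ
    obtain ⟨g, -, h2, h3⟩ := exists_diffeomorph_lt (E := E) hUo hNcont isClosed_empty (hNcpt R)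
      (c := δ) fun x hx hc => ⟨notMem_empty x, hNpush x hx (hδ.trans_le hc)⟩
    exact ⟨g, h2, h3⟩
  -- a sublevel set inside the chart
  obtain ⟨c, hc0, hcU⟩ : ∃ c, f x₀ < c ∧ ∀ x ∈ O, f x < c → x ∈ U := by
    set A := {x | x ∈ O ∧ f x ≤ f x₀ + 1} \ U with hA
    have hAc : IsCompact A := (hcpt _).diff hUo
    rcases A.eq_empty_or_nonempty with h | hne
    · refine ⟨f x₀ + 1, by linarith, fun x hx hxc => ?_⟩
      by_contra hcon
      exact (h ▸ (⟨⟨hx, hxc.le⟩, hcon⟩ : x ∈ A) : x ∈ (∅ : Set M))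
    · obtain ⟨y, hy, hymin⟩ := hAc.exists_isMinOn hne (hf.mono fun x hx => hx.1.1)
      have hylt : f x₀ < f y := hmin y hy.1.1 fun h => hy.2 (h ▸ hxe)
      refine ⟨f y, hylt, fun x hx hxc => ?_⟩
      by_contra hcon
      have : f y ≤ f x := hymin (⟨⟨hx, hxc.le.trans hy.1.2⟩, hcon⟩ : x ∈ A)
      linarith
  -- The ball `{N ≤ δ}` lies in `{f < c}`, so pushes of `f` above level `c` can be chosen to fix it.
  obtain ⟨δ, hδ, hδc⟩ : ∃ δ > 0, ∀ x ∈ U, N x ≤ δ → f x < c := by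
    have hc1 : ContinuousAt (fun z => f (e.symm z)) 0 := by
      have h1 : e.symm 0 = x₀ := by rw [← hex, e.left_inv hxe]
      refine ContinuousAt.comp (g := f) ?_ hsymm.continuousAt
      rw [h1]
      exact hf.continuousAt (hO.mem_nhds hx₀)
    have hc2 : ∀ᶠ z in 𝓝 (0 : E), f (e.symm z) < c := by
      refine hc1.eventually_lt continuousAt_const ?_
      rwa [← hex, e.left_inv hxe]
    obtain ⟨r, hr, hball⟩ := Metric.eventually_nhds_iff_ball.1 hc2
    refine ⟨(r / 2) ^ 2, by positivity, fun x hx hxN => ?_⟩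
    have := hball (e x) (by
      rw [mem_ball_zero_iff]
      have := abs_le_of_sq_le_sq hxN (by positivity)
      rw [abs_of_nonneg (norm_nonneg _)] at this
      linarith)
    rwa [e.left_inv hx] at this
  set Z := {x | x ∈ U ∧ N x ≤ δ} with hZ
  obtain ⟨F, hFs, hFt, hF1, hF2⟩ := exists_openPartialHomeomorph_of_engulfing (E := E) hO heO
    (C := fun j : ℕ => {x | x ∈ U ∧ N x ≤ j}) (K := fun j : ℕ => {x | x ∈ O ∧ f x ≤ j})
    (fun j => hNcpt j) (fun j x hx => hx.1) (fun x hx => by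
      obtain ⟨j, hj⟩ := exists_nat_gt (N x)
      refine ⟨j, mem_interior.2 ⟨U ∩ N ⁻¹' Iio (j : ℝ), fun y hy => ⟨hy.1, le_of_lt hy.2⟩,
        hNcont.isOpen_inter_preimage hUo isOpen_Iio, hx, hj⟩⟩)
    (fun j => hcpt j) (fun j x hx => hx.1) (fun x hx => by
      obtain ⟨j, hj⟩ := exists_nat_gt (f x)
      exact ⟨j, hx, hj.le⟩) (by
    intro C K hC hCU hK hKO
    obtain ⟨R, hR⟩ := (hC.image_of_continuousOn (hNcont.mono hCU)).bddAbove
    obtain ⟨g, hg1, hg2⟩ := shrink R hδ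
    have hgU : MapsTo g U U := g.mapsTo_of_forall_notMem hg1
    have hgU' : MapsTo g.symm U U :=
      g.symm.mapsTo_of_forall_notMem fun x hx => g.symm_apply_of_eq (hg1 x hx)
    have hgO : MapsTo g O O := g.mapsTo_of_forall_notMem fun x hx => hg1 x fun h => hx (heO h)
    have hgK : g '' K ⊆ O := by
      rintro _ ⟨x, hx, rfl⟩
      exact hgO (hKO hx)
    obtain ⟨R', hR'⟩ := ((hK.image g.continuous).image_of_continuousOn (hf.mono hgK)).bddAbove
    obtain ⟨h, hh1, hh2, hh3⟩ := exists_diffeomorph_lt (E := E) hO hf (hNcpt δ).isClosed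
      (hcpt R') (c := c) fun x hx hxc => ⟨fun hxZ => (hδc x hxZ.1 hxZ.2).not_ge hxc,
        hpush x hx (by rintro rfl; exact hc0.not_ge hxc)⟩
    -- Here `g` shrinks `C` into `Z`, and `h` fixes `Z` and moves `g '' K` into `U`. The conjugate
    -- `g⁻¹ h⁻¹ g` therefore fixes `C`, and it takes the point `g⁻¹ (h (g x))` of `U` to `x`.
    refine ⟨(g.trans h.symm).trans g.symm, fun x hx => ?_, fun x hx => ?_, fun x hx => ?_⟩
    · simp only [Diffeomorph.coe_trans, Function.comp_apply]
      have hxR : N x ≤ R := hR ⟨x, hx, rfl⟩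
      rw [h.symm_apply_of_eq (hh1 _ ⟨hgU (hCU hx), (hg2 x (hCU hx) hxR).le⟩), g.symm_apply_apply]
    · simp only [Diffeomorph.coe_trans, Function.comp_apply]
      have hxU : x ∉ U := fun h => hx (heO h)
      rw [hg1 x hxU, h.symm_apply_of_eq (hh2 x hx), g.symm_apply_of_eq (hg1 x hxU)]
    · have h1 : h (g x) ∈ U := by
        refine hcU _ (h.mapsTo_of_forall_notMem hh2 (hgO (hKO hx))) (hh3 _ (hgO (hKO hx)) ?_)
        exact hR' ⟨g x, ⟨x, hx, rfl⟩, rfl⟩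
      refine ⟨g.symm (h (g x)), hgU' h1, ?_⟩
      simp only [Diffeomorph.coe_trans, Function.comp_apply]
      rw [g.apply_symm_apply, h.symm_apply_apply, g.symm_apply_apply])
  -- `F` need not fix `x₀`, so the chart is recentred by a translation.
  set a := e (F.symm x₀) with ha
  have hFU : ∀ y ∈ O, F.symm y ∈ U := fun y hy => hFs ▸ F.map_target (hFt ▸ hy)
  have hmem : F.symm.trans e ∈ IsManifold.maximalAtlas 𝓘(ℝ, E) ∞ M := by
    refine OpenPartialHomeomorph.mem_maximalAtlas_of_contMDiffOn _ ?_ ?_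
    · rw [OpenPartialHomeomorph.trans_source]
      refine (contMDiffOn_of_mem_maximalAtlas he).comp (hF2.mono ?_) fun x hx => hx.2
      rw [← hFt]
      exact inter_subset_left
    · rw [OpenPartialHomeomorph.trans_target]
      refine hF1.comp ((contMDiffOn_symm_of_mem_maximalAtlas he).mono inter_subset_left)
        fun x hx => hsU x
  refine ⟨(F.symm.trans e).trans (Homeomorph.addRight (-a)).toOpenPartialHomeomorph,
    mem_maximalAtlas_trans hmem ?_ ?_, ?_, ?_, ?_⟩
  · exact (contDiff_id.add contDiff_const).contDiffOn
  · exact (contDiff_id.add contDiff_const).contDiffOn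
  · ext y
    simp only [OpenPartialHomeomorph.trans_source, OpenPartialHomeomorph.symm_source, hFt,
      Homeomorph.toOpenPartialHomeomorph_source, preimage_univ, inter_univ, mem_inter_iff,
      mem_preimage, and_iff_left_iff_imp]
    exact hFU y
  · ext z
    simp only [OpenPartialHomeomorph.trans_target, OpenPartialHomeomorph.symm_target, hFs, het,
      Homeomorph.toOpenPartialHomeomorph_target, univ_inter, mem_preimage, mem_univ, iff_true]
    exact hsU _
  · simp [ha]

end Recognition

/-! ### The orbit projection -/

section OrbitProjection

variable {n : ℕ} {M : Type u} [TopologicalSpace M] [MulAction (Torus n) M]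
  {P : Set (EuclideanSpace ℝ (Fin n))}

/-- The orbit projection `M → M / T^n ≃ P`, as a map to `ℝ^n`. -/
def orbitProj (Φ : OrbitSpace n M ≃ₜ P) (y : M) : EuclideanSpace ℝ (Fin n) :=
  Φ (orbitMk n y)

variable (Φ : OrbitSpace n M ≃ₜ P)

theorem orbitProj_mem (y : M) : orbitProj Φ y ∈ P := (Φ (orbitMk n y)).2

theorem continuous_orbitMk : Continuous (orbitMk n : M → OrbitSpace n M) := continuous_quotient_mk'

theorem continuous_orbitProj : Continuous (orbitProj Φ) :=
  continuous_subtype_val.comp (Φ.continuous.comp continuous_orbitMk)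

theorem range_orbitProj : range (orbitProj Φ) = P := by
  refine subset_antisymm (range_subset_iff.2 (orbitProj_mem Φ)) fun p hp => ?_
  obtain ⟨y, hy⟩ := Quotient.exists_rep (Φ.symm ⟨p, hp⟩)
  refine ⟨y, ?_⟩
  change ((Φ (orbitMk n y) : P) : EuclideanSpace ℝ (Fin n)) = p
  rw [show orbitMk n y = Φ.symm ⟨p, hp⟩ from hy, Φ.apply_symm_apply]

theorem orbitProj_eq_iff {y z : M} : orbitProj Φ y = orbitProj Φ z ↔ ∃ t : Torus n, t • z = y := by
  rw [orbitProj, orbitProj, Subtype.coe_inj, Φ.injective.eq_iff]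
  exact Quotient.eq

theorem orbitProj_smul (t : Torus n) (y : M) : orbitProj Φ (t • y) = orbitProj Φ y :=
  (orbitProj_eq_iff Φ).2 ⟨t, rfl⟩

theorem isOpenMap_orbitProj [ContinuousConstSMul (Torus n) M] :
    IsOpenMap (fun y : M => Φ (orbitMk n y)) :=
  Φ.isOpenMap.comp isOpenMap_quotient_mk'_mul

/-- Preimages under a continuous open map commute with closure; `A ⊆ P` allows passing between
closures in `P` and in the ambient space. -/
theorem closure_orbitProj_preimage [ContinuousConstSMul (Torus n) M]
    (A : Set (EuclideanSpace ℝ (Fin n))) (hA : A ⊆ P) :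
    orbitProj Φ ⁻¹' (closure A) = closure (orbitProj Φ ⁻¹' A) := by
  have h1 := (isOpenMap_orbitProj Φ).preimage_closure_eq_closure_preimage
    (Φ.continuous.comp continuous_orbitMk) ((↑) ⁻¹' A : Set P)
  have h2 : closure ((↑) ⁻¹' A : Set P) = (↑) ⁻¹' closure A := by
    rw [IsEmbedding.subtypeVal.closure_eq_preimage_closure_image, Subtype.image_preimage_coe,
      inter_eq_self_of_subset_right hA]
  rw [h2] at h1
  exact h1

/-- The preimage of a preconnected subset of the orbit space is preconnected. -/
theorem isPreconnected_orbitProj_preimage [ContinuousSMul (Torus n) M] [ConnectedSpace (Torus n)]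
    {A : Set (EuclideanSpace ℝ (Fin n))} (hAP : A ⊆ P) (hA : IsPreconnected A) :
    IsPreconnected (orbitProj Φ ⁻¹' A) := by
  rintro U V hU hV hUV ⟨x, hxA, hxU⟩ ⟨y, hyA, hyV⟩
  -- The images of `U` and `V` are relatively open in `P` and cover `A`, so they overlap over some
  -- point of `A`. The orbit over that point is connected and meets both sets, hence meets their
  -- intersection.
  have hop : ∀ {U : Set M}, IsOpen U → ∃ O, IsOpen O ∧ orbitProj Φ '' U = P ∩ O := by
    intro U hU
    obtain ⟨O, hO, h⟩ := isOpen_induced_iff.1 (isOpenMap_orbitProj Φ U hU)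
    refine ⟨O, hO, ?_⟩
    have : orbitProj Φ '' U = (↑) '' ((fun y : M => Φ (orbitMk n y)) '' U) := by
      rw [image_image]; rfl
    rw [this, ← h, Subtype.image_preimage_coe]
  obtain ⟨O₁, hO₁, h1⟩ := hop hU
  obtain ⟨O₂, hO₂, h2⟩ := hop hV
  have hcov : A ⊆ O₁ ∪ O₂ := by
    intro p hp
    obtain ⟨z, rfl⟩ : p ∈ range (orbitProj Φ) := (range_orbitProj Φ).symm ▸ hAP hp
    rcases hUV hp with h | h
    · exact Or.inl (h1 ▸ mem_image_of_mem _ h : orbitProj Φ z ∈ P ∩ O₁).2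
    · exact Or.inr (h2 ▸ mem_image_of_mem _ h : orbitProj Φ z ∈ P ∩ O₂).2
  obtain ⟨p, hpA, hp1, hp2⟩ := hA O₁ O₂ hO₁ hO₂ hcov
    ⟨_, hxA, (h1 ▸ mem_image_of_mem _ hxU : orbitProj Φ x ∈ P ∩ O₁).2⟩
    ⟨_, hyA, (h2 ▸ mem_image_of_mem _ hyV : orbitProj Φ y ∈ P ∩ O₂).2⟩
  obtain ⟨a, haU, rfl⟩ : p ∈ orbitProj Φ '' U := h1 ▸ ⟨hAP hpA, hp1⟩
  obtain ⟨b, hbV, hba⟩ : orbitProj Φ a ∈ orbitProj Φ '' V := h2 ▸ ⟨hAP hpA, hp2⟩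
  obtain ⟨t, rfl⟩ := (orbitProj_eq_iff Φ).1 hba
  have horb : IsPreconnected (range fun t : Torus n => t • a) :=
    isPreconnected_range (by fun_prop)
  have hsub : ∀ t : Torus n, t • a ∈ orbitProj Φ ⁻¹' A := fun t => by
    rw [mem_preimage, orbitProj_smul]; exact hpA
  obtain ⟨z, ⟨s, rfl⟩, hz⟩ := horb U V hU hV
    (by rintro _ ⟨s, rfl⟩; exact hUV (hsub s))
    ⟨a, ⟨1, one_smul _ _⟩, haU⟩ ⟨t • a, ⟨t, rfl⟩, hbV⟩
  exact ⟨s • a, hsub s, hz⟩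

end OrbitProjection

/-! ### Corner charts -/

section CornerChart

variable {n : ℕ}

theorem contDiff_cornerCoord : ContDiff ℝ ∞ (cornerCoord : (Fin n → ℂ) → Fin n → ℝ) := by
  rw [contDiff_pi]
  intro j
  have : (fun z : Fin n → ℂ => cornerCoord z j) = fun z => ‖z j‖ ^ 2 := by
    ext z; rw [cornerCoord, Complex.normSq_eq_norm_sq]
  rw [this]
  exact (contDiff_norm_sq ℝ).comp (contDiff_apply ℝ ℂ j)

/-- Every tangent vector of the stratum of `cornerCoord z` lifts to a tangent vector at `z`. -/
theorem exists_hasDerivAt_cornerCoord (z : Fin n → ℂ) {a : Fin n → ℝ}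
    (ha : ∀ j, z j = 0 → a j = 0) :
    ∃ w : Fin n → ℂ, HasDerivAt (fun s : ℝ => cornerCoord (z + s • w)) a 0 := by
  -- The lift scales each coordinate radially; where `z j = 0`, division by zero gives the velocity
  -- `0`, as required there.
  refine ⟨fun j => (a j / (2 * Complex.normSq (z j))) • z j, hasDerivAt_pi.2 fun j => ?_⟩
  set k := a j / (2 * Complex.normSq (z j)) with hk
  have h1 : (fun s : ℝ => cornerCoord (z + s • fun j => (a j / (2 * Complex.normSq (z j))) • z j) j)
      = fun s => (1 + s * k) ^ 2 * Complex.normSq (z j) := by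
    ext s
    have : (z + s • fun j => (a j / (2 * Complex.normSq (z j))) • z j) j
        = ((1 + s * k : ℝ) : ℂ) * z j := by
      simp only [Pi.add_apply, Pi.smul_apply, ← hk, Complex.real_smul]
      push_cast; ring
    rw [cornerCoord, this, map_mul, Complex.normSq_ofReal]
    ring
  rw [h1]
  have h2 : HasDerivAt (fun s : ℝ => (1 + s * k) ^ 2 * Complex.normSq (z j))
      ((2 * (1 + 0 * k) ^ 1 * (1 * k)) * Complex.normSq (z j)) 0 := by
    exact ((((hasDerivAt_id (0 : ℝ)).mul_const k).const_add 1).pow 2).mul_const _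
  refine h2.congr_deriv ?_
  by_cases hz : z j = 0
  · simp [hz, ha j hz]
  · have : Complex.normSq (z j) ≠ 0 := by simpa using hz
    rw [hk]; field_simp; ring

variable {M : Type u} [TopologicalSpace M] [ChartedSpace (EuclideanSpace ℝ (Fin (2 * n))) M]
  [MulAction (Torus n) M] {P : Set (EuclideanSpace ℝ (Fin n))}

/-- A standard chart in which the orbit projection and its inverse are smooth. -/
structure IsCornerChart (Φ : OrbitSpace n M ≃ₜ P) (ψ : OpenPartialHomeomorph M (Fin n → ℂ))
    (f : (Fin n → ℝ) → EuclideanSpace ℝ (Fin n)) (g : EuclideanSpace ℝ (Fin n) → (Fin n → ℝ)) :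
    Prop where
  std : IsStandardChart ψ
  contDiffOn_f : ContDiffOn ℝ ∞ f (cornerCoord '' ψ.target)
  contDiffOn_g : ContDiffOn ℝ ∞ g (orbitProj Φ '' ψ.source)
  f_eq : ∀ y ∈ ψ.source, f (cornerCoord (ψ y)) = orbitProj Φ y
  g_eq : ∀ y ∈ ψ.source, g (orbitProj Φ y) = cornerCoord (ψ y)

theorem IsCornerDiffeo.exists_isCornerChart {Φ : OrbitSpace n M ≃ₜ P} (h : IsCornerDiffeo Φ)
    (x : M) : ∃ ψ f g, IsCornerChart Φ ψ f g ∧ x ∈ ψ.source := by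
  obtain ⟨ψ, h1, h2, f, g, h3, h4, h5⟩ := h x
  exact ⟨ψ, f, g, ⟨h1, h3, h4, fun y hy => (h5 y hy).1, fun y hy => (h5 y hy).2⟩, h2⟩

namespace IsCornerChart

variable {Φ : OrbitSpace n M ≃ₜ P} {ψ : OpenPartialHomeomorph M (Fin n → ℂ)}
  {f : (Fin n → ℝ) → EuclideanSpace ℝ (Fin n)} {g : EuclideanSpace ℝ (Fin n) → (Fin n → ℝ)}
  {V : Set (EuclideanSpace ℝ (Fin n))} {y : M}

/-- In a corner chart the tangent space of a face corresponds to the tangent space of a stratum of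
the corner. -/
theorem exists_tangent_maps [ContinuousConstSMul (Torus n) M] (h : IsCornerChart Φ ψ f g)
    (hV : V.Finite) (hP : P = convexHull ℝ V) (hy : y ∈ ψ.source) :
    ∃ (A : (Fin n → ℝ) →L[ℝ] EuclideanSpace ℝ (Fin n))
      (B : EuclideanSpace ℝ (Fin n) →L[ℝ] (Fin n → ℝ)),
      HasFDerivWithinAt f A (cornerCoord '' ψ.target) (cornerCoord (ψ y)) ∧
      (∀ u ∈ vectorSpan ℝ (carrierFace P (orbitProj Φ y)),
        A (B u) = u ∧ ∀ j, ψ y j = 0 → B u j = 0) ∧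
      ∀ a : Fin n → ℝ, (∀ j, ψ y j = 0 → a j = 0) →
        B (A a) = a ∧ A a ∈ vectorSpan ℝ (carrierFace P (orbitProj Φ y)) := by
  have hconv : Convex ℝ P := hP ▸ convex_convexHull ℝ V
  set p := orbitProj Φ y with hp
  set r := cornerCoord (ψ y) with hr
  set C := cornerCoord '' ψ.target with hC
  set Y := orbitProj Φ '' ψ.source with hY
  have hpP : p ∈ P := orbitProj_mem Φ y
  have hrC : r ∈ C := ⟨_, ψ.map_source hy, rfl⟩
  have hpY : p ∈ Y := ⟨y, hy, rfl⟩
  -- The derivatives within the domains are evaluated only along two-sided curves that stay in those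
  -- domains, where the chain rule applies.
  obtain ⟨A, hA⟩ := (h.contDiffOn_f.differentiableOn (by simp)) r hrC
  obtain ⟨B, hB⟩ := (h.contDiffOn_g.differentiableOn (by simp)) p hpY
  refine ⟨A, B, hA, fun u hu => ?_, fun a ha => ?_⟩
  · obtain ⟨O, hO, hYO⟩ : ∃ O, IsOpen O ∧ Y = P ∩ O := by
      obtain ⟨O, hO, h⟩ := isOpen_induced_iff.1 (isOpenMap_orbitProj Φ _ ψ.open_source)
      refine ⟨O, hO, ?_⟩
      have : Y = (↑) '' ((fun y : M => Φ (orbitMk n y)) '' ψ.source) := by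
        rw [image_image]; rfl
      rw [this, ← h, Subtype.image_preimage_coe]
    have hc : HasDerivAt (fun s : ℝ => p + s • u) u 0 := by
      simpa using ((hasDerivAt_id (0 : ℝ)).smul_const u).const_add p
    -- A vector tangent to the carrier can be followed in `P` in both directions for a short time.
    have hcY : ∀ᶠ s : ℝ in 𝓝 0, p + s • u ∈ Y := by
      rw [hYO] at hpY ⊢
      have h2 : ∀ᶠ s : ℝ in 𝓝 0, p + s • u ∈ O :=
        hc.continuousAt (hO.mem_nhds (by simpa using hpY.2))
      filter_upwards [eventually_add_smul_mem hconv hpP hu, h2] with s a b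
      exact ⟨a, b⟩
    have hgc : HasDerivAt (fun s : ℝ => g (p + s • u)) (B u) 0 :=
      HasFDerivWithinAt.comp_hasDerivAt_of_eq (l := g) (0 : ℝ) hB hc hcY (by simp)
    have hg0 : g p = r := h.g_eq y hy
    have hgC : ∀ᶠ s : ℝ in 𝓝 0, g (p + s • u) ∈ C := by
      filter_upwards [hcY] with s ⟨x, hx, hxs⟩
      rw [← hxs, h.g_eq x hx]
      exact ⟨_, ψ.map_source hx, rfl⟩
    constructor
    · have h3 : HasDerivAt (fun s : ℝ => f (g (p + s • u))) (A (B u)) 0 :=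
        HasFDerivWithinAt.comp_hasDerivAt_of_eq (l := f) (0 : ℝ) hA hgc hgC (by simp [hg0])
      refine h3.unique (hc.congr_of_eventuallyEq ?_)
      filter_upwards [hcY] with s ⟨x, hx, hxs⟩
      rw [← hxs, h.g_eq x hx, h.f_eq x hx]
    -- The `j`-th corner coordinate is nonnegative along the curve and zero at time `0`, so its
    -- derivative vanishes.
    · intro j hj
      have h3 := hasDerivAt_pi.1 hgc j
      refine IsLocalMin.hasDerivAt_eq_zero ?_ h3
      filter_upwards [hgC] with s ⟨z, hz, hzs⟩
      rw [← hzs, zero_smul, add_zero, hg0, hr, cornerCoord, hj, map_zero]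
      exact Complex.normSq_nonneg _
  · obtain ⟨w, hw⟩ := exists_hasDerivAt_cornerCoord (ψ y) ha
    have hz : ∀ᶠ s : ℝ in 𝓝 0, ψ y + s • w ∈ ψ.target := by
      have : Continuous fun s : ℝ => ψ y + s • w := by fun_prop
      exact this.continuousAt (ψ.open_target.mem_nhds (by simpa using ψ.map_source hy))
    have hfc : HasDerivAt (fun s : ℝ => f (cornerCoord (ψ y + s • w))) (A a) 0 :=
      HasFDerivWithinAt.comp_hasDerivAt_of_eq (l := f) (0 : ℝ) hA hw
        (hz.mono fun s hs => ⟨_, hs, rfl⟩) (by simp [hr])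
    have hval : ∀ᶠ s : ℝ in 𝓝 0, ∃ x ∈ ψ.source, ψ x = ψ y + s • w ∧
        f (cornerCoord (ψ y + s • w)) = orbitProj Φ x := by
      filter_upwards [hz] with s hs
      refine ⟨_, ψ.map_target hs, ψ.right_inv hs, ?_⟩
      rw [← h.f_eq _ (ψ.map_target hs), ψ.right_inv hs]
    have h0 : f (cornerCoord (ψ y + (0 : ℝ) • w)) = p := by
      rw [zero_smul, add_zero, h.f_eq y hy]
    constructor
    · have h3 : HasDerivAt (fun s : ℝ => g (f (cornerCoord (ψ y + s • w)))) (B (A a)) 0 :=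
        HasFDerivWithinAt.comp_hasDerivAt_of_eq (l := g) (0 : ℝ) hB hfc (by
          filter_upwards [hval] with s ⟨x, hx, _, hxs⟩
          rw [hxs]; exact ⟨x, hx, rfl⟩) h0.symm
      refine h3.unique (hw.congr_of_eventuallyEq ?_)
      filter_upwards [hval] with s ⟨x, hx, hx', hxs⟩
      rw [hxs, h.g_eq x hx, hx']
    · have := hasDerivAt_mem_vectorSpan_carrierFace hV hP (c := fun s : ℝ =>
        f (cornerCoord (ψ y + s • w))) (by
          filter_upwards [hval] with s ⟨x, hx, _, hxs⟩
          rw [hxs]; exact orbitProj_mem Φ x) hfc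
      rwa [h0] at this

/-- The number of nonzero coordinates in a corner chart is the dimension of the face. -/
theorem finrank_vectorSpan [ContinuousConstSMul (Torus n) M] (h : IsCornerChart Φ ψ f g)
    (hV : V.Finite) (hP : P = convexHull ℝ V) (hy : y ∈ ψ.source) :
    Module.finrank ℝ (vectorSpan ℝ (carrierFace P (orbitProj Φ y))) =
      Fintype.card {j // ψ y j ≠ 0} := by
  obtain ⟨A, B, -, h1, h2⟩ := h.exists_tangent_maps hV hP hy
  set D := vectorSpan ℝ (carrierFace P (orbitProj Φ y)) with hD
  rw [← Module.finrank_fintype_fun_eq_card ℝ (η := {j // ψ y j ≠ 0})]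
  let ext0 : ({j // ψ y j ≠ 0} → ℝ) →ₗ[ℝ] (Fin n → ℝ) := Function.ExtendByZero.linearMap ℝ (↑)
  have hext : ∀ (b : {j // ψ y j ≠ 0} → ℝ) j, ψ y j = 0 → ext0 b j = 0 := by
    intro b j hj
    exact Function.extend_apply' _ _ _ (by rintro ⟨⟨i, hi⟩, rfl⟩; exact hi hj)
  have hext' : ∀ (b : {j // ψ y j ≠ 0} → ℝ) j, ext0 b j.1 = b j := fun b j =>
    Subtype.val_injective.extend_apply _ _ _
  -- `B` followed by restriction to the nonzero coordinates is injective because `A` recovers `u`;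
  -- `A` after extension by zero is injective because `B` recovers `a`.
  apply le_antisymm
  · refine LinearMap.finrank_le_finrank_of_injective
      (f := (LinearMap.funLeft ℝ ℝ ((↑) : {j // ψ y j ≠ 0} → Fin n)) ∘ₗ
        (B : _ →ₗ[ℝ] (Fin n → ℝ)) ∘ₗ D.subtype) ?_
    rw [← LinearMap.ker_eq_bot, LinearMap.ker_eq_bot']
    rintro ⟨u, hu⟩ h0
    have hB : B u = 0 := by
      ext j
      by_cases hj : ψ y j = 0
      · exact (h1 u hu).2 j hj
      · exact congrFun h0 ⟨j, hj⟩
    have := (h1 u hu).1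
    rw [hB, map_zero] at this
    exact Subtype.ext this.symm
  · refine LinearMap.finrank_le_finrank_of_injective
      (f := LinearMap.codRestrict D ((A : _ →ₗ[ℝ] _) ∘ₗ ext0) fun b => (h2 _ (hext b)).2) ?_
    rw [← LinearMap.ker_eq_bot, LinearMap.ker_eq_bot']
    intro b h0
    have hA : A (ext0 b) = 0 := congrArg Subtype.val h0
    have := (h2 _ (hext b)).1
    rw [hA, map_zero] at this
    ext j
    rw [← hext' b j, ← this]
    rfl

/-- Vectors tangent to the face of `orbitProj Φ y` lift to tangent vectors at `y`. -/
theorem exists_hasDerivAt [ContinuousConstSMul (Torus n) M] (h : IsCornerChart Φ ψ f g)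
    (hV : V.Finite) (hP : P = convexHull ℝ V) (hy : y ∈ ψ.source) {u : EuclideanSpace ℝ (Fin n)}
    (hu : u ∈ vectorSpan ℝ (carrierFace P (orbitProj Φ y))) :
    ∃ w : Fin n → ℂ, HasDerivAt (fun s : ℝ => f (cornerCoord (ψ y + s • w))) u 0 := by
  obtain ⟨A, B, hA, h1, h2⟩ := h.exists_tangent_maps hV hP hy
  obtain ⟨hAB, hB0⟩ := h1 u hu
  obtain ⟨w, hw⟩ := exists_hasDerivAt_cornerCoord (ψ y) hB0
  refine ⟨w, ?_⟩
  have hz : ∀ᶠ s : ℝ in 𝓝 0, ψ y + s • w ∈ ψ.target := by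
    have : Continuous fun s : ℝ => ψ y + s • w := by fun_prop
    exact this.continuousAt (ψ.open_target.mem_nhds (by simpa using ψ.map_source hy))
  have := HasFDerivWithinAt.comp_hasDerivAt_of_eq (l := f) (0 : ℝ) hA hw
    (hz.mono fun s hs => ⟨_, hs, rfl⟩) (by simp)
  rwa [hAB] at this

/-- A smooth function on the orbit space whose derivative along the face does not vanish can be
pushed on the manifold. -/
theorem isPushable [ContinuousConstSMul (Torus n) M] [T2Space M] [IsManifold (𝓡 (2 * n)) ∞ M]
    (h : IsCornerChart Φ ψ f g) (hV : V.Finite) (hP : P = convexHull ℝ V) (hy : y ∈ ψ.source)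
    {W : Set (EuclideanSpace ℝ (Fin n))} (hW : IsOpen W) {τ : EuclideanSpace ℝ (Fin n) → ℝ}
    (hτ : ContDiffOn ℝ ∞ τ W) (hyW : orbitProj Φ y ∈ W) {u : EuclideanSpace ℝ (Fin n)}
    (hu : u ∈ vectorSpan ℝ (carrierFace P (orbitProj Φ y)))
    (hτu : fderiv ℝ τ (orbitProj Φ y) u ≠ 0) :
    IsPushable (EuclideanSpace ℝ (Fin (2 * n))) (fun y => τ (orbitProj Φ y)) y := by
  let L : (Fin n → ℂ) ≃L[ℝ] EuclideanSpace ℝ (Fin (2 * n)) :=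
    ContinuousLinearEquiv.ofFinrankEq (by
      rw [Module.finrank_pi_fintype]; simp [Complex.finrank_real_complex, mul_comm])
  set e := ψ.transHomeomorph L.toHomeomorph with he
  have hes : e.source = ψ.source := rfl
  have hea : ∀ x, e x = L (ψ x) := fun _ => rfl
  have hesymm : ∀ z, e.symm z = ψ.symm (L.symm z) := fun _ => rfl
  have hmem : e ∈ IsManifold.maximalAtlas (𝓡 (2 * n)) ∞ M := by
    refine OpenPartialHomeomorph.mem_maximalAtlas_of_contMDiffOn _ ?_ ?_
    · exact L.contDiff.contMDiff.comp_contMDiffOn h.std.smooth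
    · exact h.std.smooth_symm.comp L.symm.contDiff.contMDiff.contMDiffOn fun z hz => hz
  have hetarget : ∀ z, z ∈ e.target ↔ L.symm z ∈ ψ.target := fun _ => Iff.rfl
  obtain ⟨w, hw⟩ := h.exists_hasDerivAt hV hP hy hu
  set G : EuclideanSpace ℝ (Fin (2 * n)) → ℝ := fun z => τ (orbitProj Φ (e.symm z)) with hG
  have hGeq : ∀ z ∈ e.target, G z = τ (f (cornerCoord (L.symm z))) := by
    intro z hz
    rw [hetarget] at hz
    simp only [hG, hesymm]
    rw [← h.f_eq _ (ψ.map_target hz), ψ.right_inv hz]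
  have hfc : ContDiffOn ℝ ∞ (fun z => f (cornerCoord (L.symm z))) e.target :=
    h.contDiffOn_f.comp (contDiff_cornerCoord.comp L.symm.contDiff).contDiffOn
      fun z hz => ⟨_, hz, rfl⟩
  have hyt : e y ∈ e.target := e.map_source hy
  have hLy : L.symm (e y) = ψ y := L.symm_apply_apply _
  have hfy : f (cornerCoord (L.symm (e y))) = orbitProj Φ y := by rw [hLy, h.f_eq y hy]
  have hGcd : ContDiffAt ℝ ∞ G (e y) := by
    have h1 : ContDiffAt ℝ ∞ (fun z => f (cornerCoord (L.symm z))) (e y) :=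
      hfc.contDiffAt (e.open_target.mem_nhds hyt)
    have h2 : ContDiffAt ℝ ∞ (fun z => τ (f (cornerCoord (L.symm z)))) (e y) :=
      ContDiffAt.comp (e y) (g := τ) (by
        rw [hfy]; exact hτ.contDiffAt (hW.mem_nhds hyW)) h1
    refine h2.congr_of_eventuallyEq ?_
    filter_upwards [e.open_target.mem_nhds hyt] with z hz using hGeq z hz
  refine isPushable_of_fderiv_ne_zero hmem hy (hGcd.of_le (by simp)) (w := L w) ?_
  have hcurve : HasDerivAt (fun s : ℝ => e y + s • L w) (L w) 0 := by
    simpa using ((hasDerivAt_id (0 : ℝ)).smul_const (L w)).const_add (e y)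
  have hd1 : HasDerivAt (fun s : ℝ => G (e y + s • L w)) (fderiv ℝ G (e y) (L w)) 0 :=
    HasFDerivAt.comp_hasDerivAt_of_eq (0 : ℝ)
      (hGcd.differentiableAt (by simp)).hasFDerivAt hcurve (by simp)
  have hd2 : HasDerivAt (fun s : ℝ => τ (f (cornerCoord (ψ y + s • w))))
      (fderiv ℝ τ (orbitProj Φ y) u) 0 :=
    HasFDerivAt.comp_hasDerivAt_of_eq (0 : ℝ)
      ((hτ.contDiffAt (hW.mem_nhds hyW)).differentiableAt (by simp)).hasFDerivAt hw
      (by rw [zero_smul, add_zero, h.f_eq y hy])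
  -- Along the line through `e y` in the direction `L w`, the function `G` is `τ` along the lifted
  -- curve, whose velocity in `P` is `u`.
  have heq : fderiv ℝ G (e y) (L w) = fderiv ℝ τ (orbitProj Φ y) u := by
    refine hd1.unique (hd2.congr_of_eventuallyEq ?_)
    have : ∀ᶠ s : ℝ in 𝓝 0, e y + s • L w ∈ e.target :=
      hcurve.continuousAt (e.open_target.mem_nhds (by simpa using hyt))
    filter_upwards [this] with s hs
    rw [hGeq _ hs, map_add, map_smul, hLy, L.symm_apply_apply]
  change fderiv ℝ G (e y) (L w) ≠ 0
  rwa [heq]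

end IsCornerChart

end CornerChart

/-! ### Stabilizers -/

section Stabilizer

theorem nonempty_quotient_continuousMulEquiv {G H : Type*} [Group G] [TopologicalSpace G]
    [CompactSpace G] [Group H] [TopologicalSpace H] [T2Space H] (f : G →* H) (hf : Continuous f)
    (hsurj : Function.Surjective f) (N : Subgroup G) [N.Normal] (hN : N = f.ker) :
    Nonempty ((G ⧸ N) ≃ₜ* H) := by
  subst hN
  let e := QuotientGroup.quotientKerEquivOfSurjective f hsurj
  have he : Continuous e := hf.quotient_lift _
  exact ⟨{ e with
    continuous_toFun := he
    continuous_invFun := (Continuous.homeoOfEquivCompactToT2 (f := e.toEquiv) he).symm.continuous }⟩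

variable {n : ℕ} {M : Type u} [TopologicalSpace M]
  [ChartedSpace (EuclideanSpace ℝ (Fin (2 * n))) M] [MulAction (Torus n) M]

theorem IsStandardChart.exists_mem_stabilizer_iff {ψ : OpenPartialHomeomorph M (Fin n → ℂ)}
    (h : IsStandardChart ψ) : ∃ α : Torus n ≃ₜ* Torus n, ∀ y ∈ ψ.source, ∀ t : Torus n,
      t ∈ MulAction.stabilizer (Torus n) y ↔ ∀ j, ψ y j ≠ 0 → α t j = 1 := by
  obtain ⟨α, hα⟩ := h.equivariant
  refine ⟨α, fun y hy t => ?_⟩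
  rw [MulAction.mem_stabilizer_iff, ← ψ.injOn.eq_iff (h.invariant t y hy) hy, funext_iff]
  refine forall_congr' fun j => ?_
  rw [hα t y hy j]
  constructor
  · intro h1 h2
    exact Circle.ext (by simpa using mul_right_cancel₀ h2 (h1.trans (one_mul _).symm))
  · intro h1
    by_cases h2 : ψ y j = 0
    · simp [h2]
    · simp [h1 h2]

/-- Up to `α`, the stabilizer is the coordinate subtorus of the vanishing coordinates, a continuous
image of the connected group `T^n`. -/
theorem IsStandardChart.isConnected_stabilizer {ψ : OpenPartialHomeomorph M (Fin n → ℂ)}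
    (h : IsStandardChart ψ) {y : M} (hy : y ∈ ψ.source) :
    IsConnected (MulAction.stabilizer (Torus n) y : Set (Torus n)) := by
  classical
  obtain ⟨α, hα⟩ := h.exists_mem_stabilizer_iff
  have : (MulAction.stabilizer (Torus n) y : Set (Torus n)) =
      range fun s : Torus n => α.symm fun j => if ψ y j = 0 then s j else 1 := by
    ext t
    rw [SetLike.mem_coe, hα y hy]
    constructor
    · intro h1
      refine ⟨α t, (ContinuousMulEquiv.symm_apply_eq α).2 (funext fun j => ?_)⟩
      split_ifs with h2
      · rfl
      · exact (h1 j h2).symm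
    · rintro ⟨s, rfl⟩ j hj
      simp [hj]
  rw [this]
  refine isConnected_range (α.symm.continuous.comp (continuous_pi fun j => ?_))
  split_ifs <;> fun_prop

/-- The stabilizer is the kernel of `α` followed by projection to the coordinates where `ψ y` does
not vanish. -/
theorem IsStandardChart.nonempty_quotient_stabilizer {ψ : OpenPartialHomeomorph M (Fin n → ℂ)}
    (h : IsStandardChart ψ) {y : M} (hy : y ∈ ψ.source) {m : ℕ}
    (hm : Fintype.card {j // ψ y j ≠ 0} = m) :
    Nonempty ((Torus n ⧸ MulAction.stabilizer (Torus n) y) ≃ₜ* Torus m) := by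
  classical
  obtain ⟨α, hα⟩ := h.exists_mem_stabilizer_iff
  let e := Fintype.equivFinOfCardEq hm
  let f : Torus n →* Torus m :=
    { toFun := fun t i => α t (e.symm i)
      map_one' := by ext; simp
      map_mul' := fun a b => by ext; simp }
  refine nonempty_quotient_continuousMulEquiv f ?_ ?_ _ ?_
  · have hα := α.continuous
    exact continuous_pi fun i => (continuous_apply (e.symm i).1).comp hα
  · intro s
    refine ⟨α.symm fun j => if hj : ψ y j ≠ 0 then s (e ⟨j, hj⟩) else 1, funext fun i => ?_⟩
    change α (α.symm _) (e.symm i : Fin n) = s i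
    rw [ContinuousMulEquiv.apply_symm_apply, dif_pos (e.symm i).2]
    simp
  · ext t
    rw [hα y hy, MonoidHom.mem_ker, funext_iff]
    constructor
    · exact fun h1 i => h1 _ (e.symm i).2
    · intro h1 j hj
      simpa [f] using h1 (e ⟨j, hj⟩)

variable {P V : Set (EuclideanSpace ℝ (Fin n))} {Φ : OrbitSpace n M ≃ₜ P}

namespace IsCornerDiffeo

theorem isConnected_stabilizer (h : IsCornerDiffeo Φ) (y : M) :
    IsConnected (MulAction.stabilizer (Torus n) y : Set (Torus n)) := by
  obtain ⟨ψ, f, g, hψ, hy⟩ := h.exists_isCornerChart y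
  exact hψ.std.isConnected_stabilizer hy

variable [ContinuousSMul (Torus n) M]

theorem nonempty_quotient_stabilizer (h : IsCornerDiffeo Φ) (hV : V.Finite)
    (hP : P = convexHull ℝ V) (y : M) :
    Nonempty ((Torus n ⧸ MulAction.stabilizer (Torus n) y) ≃ₜ*
      Torus (polytopeDim (carrierFace P (orbitProj Φ y)))) := by
  obtain ⟨ψ, f, g, hψ, hy⟩ := h.exists_isCornerChart y
  exact hψ.std.nonempty_quotient_stabilizer hy (hψ.finrank_vectorSpan hV hP hy).symm

/-- The points with a given carrier form a connected set, so local constancy suffices. Nonzero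
coordinates stay nonzero nearby, and their number is the dimension of the common carrier, so the set
of nonzero coordinates does not change. -/
theorem stabilizer_eq (h : IsCornerDiffeo Φ) (hV : V.Finite) (hP : P = convexHull ℝ V) {y z : M}
    (hyz : carrierFace P (orbitProj Φ y) = carrierFace P (orbitProj Φ z)) :
    MulAction.stabilizer (Torus n) y = MulAction.stabilizer (Torus n) z := by
  have hconv : Convex ℝ P := hP ▸ convex_convexHull ℝ V
  set F := carrierFace P (orbitProj Φ z) with hF
  have hS := isPreconnected_orbitProj_preimage Φ (A := {q | q ∈ P ∧ carrierFace P q = F})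
    (fun q hq => hq.1) (convex_setOf_carrierFace_eq hconv F).isPreconnected
  refine hS.induction₂ (fun a b => MulAction.stabilizer (Torus n) a =
    MulAction.stabilizer (Torus n) b) (fun a ha => ?_) (fun _ _ _ _ _ _ => Eq.trans)
    (fun _ _ _ _ => Eq.symm) ⟨orbitProj_mem Φ y, hyz⟩ ⟨orbitProj_mem Φ z, rfl⟩
  obtain ⟨ψ, f, g, hψ, has⟩ := h.exists_isCornerChart a
  obtain ⟨α, hα⟩ := hψ.std.exists_mem_stabilizer_iff
  have h1 : ∀ᶠ b in 𝓝 a, ∀ j, ψ a j ≠ 0 → ψ b j ≠ 0 := by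
    refine Filter.eventually_all.2 fun j => ?_
    by_cases hj : ψ a j = 0
    · exact Filter.Eventually.of_forall fun b hb => absurd hj hb
    · have : ContinuousAt (fun b => ψ b j) a :=
        (continuous_apply j).continuousAt.comp (ψ.continuousAt has)
      filter_upwards [this.eventually_ne hj] with b hb _ using hb
  filter_upwards [nhdsWithin_le_nhds h1, nhdsWithin_le_nhds (ψ.open_source.mem_nhds has),
    self_mem_nhdsWithin] with b hb hbs hbF
  have hcard : Fintype.card {j // ψ a j ≠ 0} = Fintype.card {j // ψ b j ≠ 0} := by
    rw [← hψ.finrank_vectorSpan hV hP has, ← hψ.finrank_vectorSpan hV hP hbs, ha.2, hbF.2]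
  have hJ : ∀ j, ψ b j ≠ 0 → ψ a j ≠ 0 := by
    intro j hj
    have hinj : Function.Injective fun i : {j // ψ a j ≠ 0} =>
        (⟨i.1, hb i.1 i.2⟩ : {j // ψ b j ≠ 0}) := fun i i' hi =>
      Subtype.ext (congrArg (fun x => x.1) hi)
    obtain ⟨i, hi⟩ := ((Fintype.bijective_iff_injective_and_card _).2 ⟨hinj, hcard⟩).2 ⟨j, hj⟩
    rw [← show i.1 = j from congrArg Subtype.val hi]
    exact i.2
  ext t
  rw [hα a has, hα b hbs]
  exact forall_congr' fun j => ⟨fun h hj => h (hJ j hj), fun h hj => h (hb j hj)⟩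

/-- Both conditions say that no coordinate is nonzero: the stabilizer is then everything, and the
carrier has dimension `0`. -/
theorem mem_fixedPoints_iff (h : IsCornerDiffeo Φ) (hV : V.Finite) (hP : P = convexHull ℝ V)
    {y : M} : y ∈ MulAction.fixedPoints (Torus n) M ↔ orbitProj Φ y ∈ P.extremePoints ℝ := by
  have hconv : Convex ℝ P := hP ▸ convex_convexHull ℝ V
  obtain ⟨ψ, f, g, hψ, hy⟩ := h.exists_isCornerChart y
  obtain ⟨α, hα⟩ := hψ.std.exists_mem_stabilizer_iff
  have hd := hψ.finrank_vectorSpan hV hP hy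
  have hfix : y ∈ MulAction.fixedPoints (Torus n) M ↔ IsEmpty {j // ψ y j ≠ 0} := by
    have : y ∈ MulAction.fixedPoints (Torus n) M ↔
      ∀ t : Torus n, t ∈ MulAction.stabilizer (Torus n) y := Iff.rfl
    rw [this]
    constructor
    · refine fun h1 => ⟨fun ⟨j, hj⟩ => ?_⟩
      -- The test element has `-1` in every coordinate after `α`.
      have h2 := (hα y hy _).1 (h1 (α.symm fun _ => Circle.exp Real.pi)) j hj
      rw [ContinuousMulEquiv.apply_symm_apply] at h2
      have h3 := congrArg (fun z : Circle => (z : ℂ)) h2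
      rw [Circle.coe_exp, Complex.exp_pi_mul_I, Circle.coe_one] at h3
      norm_num at h3
    · exact fun h1 t => (hα y hy t).2 fun j hj => (h1.false ⟨j, hj⟩).elim
  rw [hfix, ← Fintype.card_eq_zero_iff, ← hd]
  constructor
  · intro h0
    have hsub : carrierFace P (orbitProj Φ y) = {orbitProj Φ y} := by
      refine subset_antisymm (fun q hq => ?_)
        (singleton_subset_iff.2 (self_mem_carrierFace (orbitProj_mem Φ y)))
      have := sub_mem_vectorSpan_carrierFace (orbitProj_mem Φ y) hq
      rw [Submodule.finrank_eq_zero.1 h0, Submodule.mem_bot, sub_eq_zero] at this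
      exact this
    rw [← isExtreme_singleton, ← hsub]
    exact isExtreme_carrierFace hconv
  · intro h0
    rw [carrierFace_of_mem_extremePoints h0, vectorSpan_singleton, finrank_bot]

/-- Over an interior point of `P` the carrier has dimension `n`, so all coordinates are nonzero and
the stabilizer is trivial. -/
theorem faithfulSMul (h : IsCornerDiffeo Φ) (hV : V.Finite) (hP : P = convexHull ℝ V)
    (hspan : affineSpan ℝ P = ⊤) : FaithfulSMul (Torus n) M := by
  have hconv : Convex ℝ P := hP ▸ convex_convexHull ℝ V
  obtain ⟨p, hp⟩ := hconv.interior_nonempty_iff_affineSpan_eq_top.2 hspan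
  obtain ⟨y, rfl⟩ : p ∈ range (orbitProj Φ) := by
    rw [range_orbitProj]; exact interior_subset hp
  obtain ⟨ψ, f, g, hψ, hy⟩ := h.exists_isCornerChart y
  obtain ⟨α, hα⟩ := hψ.std.exists_mem_stabilizer_iff
  have hd := hψ.finrank_vectorSpan hV hP hy
  rw [carrierFace_eq_of_mem_interior hp, ← direction_affineSpan, hspan, AffineSubspace.direction_top,
    finrank_top, finrank_euclideanSpace, Fintype.card_fin] at hd
  have hJ : ∀ j, ψ y j ≠ 0 := by
    intro j
    obtain ⟨i, rfl⟩ := ((Fintype.bijective_iff_injective_and_card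
      ((↑) : {j // ψ y j ≠ 0} → Fin n)).2 ⟨Subtype.val_injective, by simp [← hd]⟩).2 j
    exact i.2
  refine ⟨fun {s t} hst => ?_⟩
  have h1 : t⁻¹ * s ∈ MulAction.stabilizer (Torus n) y := by
    rw [MulAction.mem_stabilizer_iff, mul_smul, hst y, inv_smul_smul]
  have h2 : α (t⁻¹ * s) = 1 := funext fun j => (hα y hy _).1 h1 j (hJ j)
  rw [map_eq_one_iff α α.injective, inv_mul_eq_one] at h2
  exact h2.symm

end IsCornerDiffeo

end Stabilizer

/-! ### Simple connectedness -/

section SimplyConnected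

open scoped unitInterval

variable {X : Type*} [TopologicalSpace X]

theorem IsSimplyConnected.homotopic_of_range_subset {s : Set X} (hs : IsSimplyConnected s)
    {x y : X} (p q : Path x y) (hp : range p ⊆ s) (hq : range q ⊆ s) : p.Homotopic q := by
  have := hs.simplyConnectedSpace
  have hx : x ∈ s := hp p.source_mem_range
  have hy : y ∈ s := hp p.target_mem_range
  let lift : ∀ r : Path x y, range r ⊆ s → Path (⟨x, hx⟩ : s) ⟨y, hy⟩ := fun r hr =>
    { toFun := fun t => ⟨r t, hr (mem_range_self t)⟩
      continuous_toFun := r.continuous.subtype_mk _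
      source' := Subtype.ext r.source
      target' := Subtype.ext r.target }
  have h : (lift p hp).Homotopic (lift q hq) := SimplyConnectedSpace.paths_homotopic _ _
  exact h.map ⟨Subtype.val, continuous_subtype_val⟩

/-- A space that is covered by simply connected open sets which have a common point and path
connected pairwise intersections is simply connected. -/
theorem simplyConnectedSpace_of_open_cover {ι : Type*} {O : ι → Set X} (hO : ∀ i, IsOpen (O i))
    (hcov : ∀ x, ∃ i, x ∈ O i) (hsc : ∀ i, IsSimplyConnected (O i))
    (hint : ∀ i j, IsPathConnected (O i ∩ O j)) {b : X} (hb : ∀ i, b ∈ O i) :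
    SimplyConnectedSpace X := by
  -- In each `O i` there is one homotopy class of paths from `b` to `x`; a path inside `O i ∩ O j`
  -- shows that the classes for `i` and `j` agree in `X`.
  have hcanon : ∀ x, ∃ α : Path b x, ∀ i, x ∈ O i → ∀ β : Path b x, range β ⊆ O i →
      β.Homotopic α := by
    intro x
    obtain ⟨i, hi⟩ := hcov x
    have hj : ∀ j, x ∈ O j → ∃ γ : Path b x, range γ ⊆ O i ∩ O j := by
      intro j hj
      obtain ⟨γ, hγ⟩ := (hint i j).joinedIn b ⟨hb i, hb j⟩ x ⟨hi, hj⟩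
      exact ⟨γ, range_subset_iff.2 hγ⟩
    obtain ⟨α, hα⟩ := hj i hi
    refine ⟨α, fun j hxj β hβ => ?_⟩
    obtain ⟨γ, hγ⟩ := hj j hxj
    exact ((hsc j).homotopic_of_range_subset β γ hβ (hγ.trans inter_subset_right)).trans
      ((hsc i).homotopic_of_range_subset γ α (hγ.trans inter_subset_left)
        (hα.trans inter_subset_left))
  choose κ hκ using hcanon
  have hstep : ∀ {x y : X} (p : Path x y) (i : ι), range p ⊆ O i →
      ((κ x).trans p).Homotopic (κ y) := by
    intro x y p i hp
    have hx : x ∈ O i := hp p.source_mem_range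
    obtain ⟨β, hβ⟩ := (hsc i).isPathConnected.joinedIn b (hb i) x hx
    have hβ' : range β ⊆ O i := range_subset_iff.2 hβ
    refine ((hκ x i hx β hβ').symm.hcomp (Path.Homotopic.refl p)).trans
      (hκ y i (hp p.target_mem_range) _ ?_)
    rw [Path.trans_range]
    exact union_subset hβ' hp
  -- A Lebesgue subdivision cuts `p` into pieces that each lie in one set of the cover, where
  -- `hstep` applies.
  have hall : ∀ {x y : X} (p : Path x y), ((κ x).trans p).Homotopic (κ y) := by
    intro x y p
    obtain ⟨t, ht0, htm, ⟨N, hN⟩, htO⟩ := exists_monotone_Icc_subset_open_cover_unitInterval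
      (fun i => (hO i).preimage p.continuous)
      (fun s _ => mem_iUnion.2 (hcov (p s)))
    have hind : ∀ m, ((κ (p 0)).trans (p.subpath 0 (t m))).Homotopic (κ (p (t m))) := by
      intro m
      induction m with
      | zero =>
        rw [ht0, Path.subpath_self]
        exact ⟨Path.Homotopy.transRefl _⟩
      | succ m ih =>
        obtain ⟨i, hi⟩ := htO m
        have h1 : ((κ (p (t m))).trans (p.subpath (t m) (t (m + 1)))).Homotopic
            (κ (p (t (m + 1)))) := hstep _ i (by
          rw [Path.range_subpath_of_le _ _ _ (htm m.le_succ)]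
          exact image_subset_iff.2 hi)
        have h2 : (p.subpath 0 (t (m + 1))).Homotopic
            ((p.subpath 0 (t m)).trans (p.subpath (t m) (t (m + 1)))) :=
          ⟨(Path.Homotopy.subpathTransSubpath p 0 (t m) (t (m + 1))).symm⟩
        exact (((Path.Homotopic.refl _).hcomp h2).trans
          ⟨(Path.Homotopy.transAssoc _ _ _).symm⟩).trans
          ((ih.hcomp (Path.Homotopic.refl _)).trans h1)
    have h1 := hind N
    rw [hN N le_rfl, Path.subpath_zero_one] at h1
    have hcast : ∀ {x' y' : X} (hx : x' = x) (hy : y' = y),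
        ((κ x').trans (p.cast hx hy)).Homotopic (κ y') → ((κ x).trans p).Homotopic (κ y) := by
      rintro x' y' rfl rfl h
      exact h
    exact hcast p.source p.target h1
  refine simply_connected_iff_paths_homotopic'.2 ⟨⟨⟨b⟩, fun x y => ?_⟩, fun {x y} p q => ?_⟩
  · exact ⟨(κ x).symm.trans (κ y)⟩
  -- Both composites are homotopic to `κ y`, and `κ x` cancels.
  · have h : ((κ x).trans p).Homotopic ((κ x).trans q) := (hall p).trans (hall q).symm
    have hcancel : ∀ r : Path x y, r.Homotopic ((κ x).symm.trans ((κ x).trans r)) := fun r =>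
      ((Path.Homotopic.trans ⟨(Path.Homotopy.reflTrans r).symm⟩
        (Path.Homotopic.hcomp ⟨Path.Homotopy.reflSymmTrans (κ x)⟩ (Path.Homotopic.refl r))).trans
        ⟨Path.Homotopy.transAssoc _ _ _⟩)
    exact (hcancel p).trans (((Path.Homotopic.refl _).hcomp h).trans (hcancel q).symm)

end SimplyConnected

/-! ### Orientability -/

section Orientable

variable {m : ℕ} {M : Type u} [TopologicalSpace M]

theorem exists_continuousLinearEquiv_det_neg (hm : 0 < m) :
    ∃ R : EuclideanSpace ℝ (Fin m) ≃L[ℝ] EuclideanSpace ℝ (Fin m),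
      (R : EuclideanSpace ℝ (Fin m) →L[ℝ] EuclideanSpace ℝ (Fin m)).det < 0 := by
  let v : EuclideanSpace ℝ (Fin m) := EuclideanSpace.single ⟨0, hm⟩ 1
  have hv : v ≠ 0 := by simp [v]
  refine ⟨((ℝ ∙ v)ᗮ).reflection.toContinuousLinearEquiv, ?_⟩
  have h := ((ℝ ∙ v)ᗮ).det_reflection
  rw [Submodule.orthogonal_orthogonal, finrank_span_singleton hv, pow_one] at h
  rw [ContinuousLinearMap.det]
  exact (h.symm ▸ neg_one_lt_zero : LinearMap.det _ < (0 : ℝ))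

/-- The Jacobian determinant of a coordinate change. -/
def chartJacobian (e e' : OpenPartialHomeomorph M (EuclideanSpace ℝ (Fin m))) (x : M) : ℝ :=
  (fderiv ℝ (fun z => e' (e.symm z)) (e x)).det

variable {e e' e'' : OpenPartialHomeomorph M (EuclideanSpace ℝ (Fin m))} {x : M}

theorem coordChange_domain_mem_nhds (hx : x ∈ e.source) (hx' : x ∈ e'.source) :
    e.target ∩ e.symm ⁻¹' e'.source ∈ 𝓝 (e x) :=
  (e.isOpen_inter_preimage_symm e'.open_source).mem_nhds
    ⟨e.map_source hx, by rwa [mem_preimage, e.left_inv hx]⟩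

theorem chartJacobian_self (hx : x ∈ e.source) : chartJacobian e e x = 1 := by
  have h1 : (fun z => e (e.symm z)) =ᶠ[𝓝 (e x)] id := by
    filter_upwards [e.open_target.mem_nhds (e.map_source hx)] with z hz using e.right_inv hz
  rw [chartJacobian, h1.fderiv_eq, fderiv_id]
  exact LinearMap.det_id

theorem chartJacobian_trans_continuousLinearEquiv
    (R : EuclideanSpace ℝ (Fin m) ≃L[ℝ] EuclideanSpace ℝ (Fin m)) :
    chartJacobian e (e'.trans R.toHomeomorph.toOpenPartialHomeomorph) x =
      (R : EuclideanSpace ℝ (Fin m) →L[ℝ] EuclideanSpace ℝ (Fin m)).det * chartJacobian e e' x := by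
  rw [chartJacobian, chartJacobian]
  change (fderiv ℝ (R ∘ fun z => e' (e.symm z)) (e x)).det = _
  rw [R.comp_fderiv]
  exact LinearMap.det_comp _ _

variable [ChartedSpace (EuclideanSpace ℝ (Fin m)) M]

theorem contDiffOn_coordChange [IsManifold (𝓡 m) ∞ M]
    (he : e ∈ IsManifold.maximalAtlas (𝓡 m) ∞ M) (he' : e' ∈ IsManifold.maximalAtlas (𝓡 m) ∞ M) :
    ContDiffOn ℝ ∞ (fun z => e' (e.symm z)) (e.target ∩ e.symm ⁻¹' e'.source) := by
  rw [← contMDiffOn_iff_contDiffOn]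
  exact (contMDiffOn_of_mem_maximalAtlas he').comp
    ((contMDiffOn_symm_of_mem_maximalAtlas he).mono inter_subset_left) fun z hz => hz.2

theorem differentiableAt_coordChange [IsManifold (𝓡 m) ∞ M]
    (he : e ∈ IsManifold.maximalAtlas (𝓡 m) ∞ M) (he' : e' ∈ IsManifold.maximalAtlas (𝓡 m) ∞ M)
    (hx : x ∈ e.source) (hx' : x ∈ e'.source) :
    DifferentiableAt ℝ (fun z => e' (e.symm z)) (e x) :=
  ((contDiffOn_coordChange he he').contDiffAt
    (coordChange_domain_mem_nhds hx hx')).differentiableAt (by simp)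

theorem chartJacobian_mul [IsManifold (𝓡 m) ∞ M]
    (he : e ∈ IsManifold.maximalAtlas (𝓡 m) ∞ M) (he' : e' ∈ IsManifold.maximalAtlas (𝓡 m) ∞ M)
    (he'' : e'' ∈ IsManifold.maximalAtlas (𝓡 m) ∞ M)
    (hx : x ∈ e.source) (hx' : x ∈ e'.source) (hx'' : x ∈ e''.source) :
    chartJacobian e' e'' x * chartJacobian e e' x = chartJacobian e e'' x := by
  have h1 : (fun z => e'' (e.symm z)) =ᶠ[𝓝 (e x)]
      (fun z => e'' (e'.symm z)) ∘ fun z => e' (e.symm z) := by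
    filter_upwards [coordChange_domain_mem_nhds hx hx'] with z hz
    simp only [Function.comp_apply]
    rw [e'.left_inv hz.2]
  have h2 : e' (e.symm (e x)) = e' x := by rw [e.left_inv hx]
  rw [chartJacobian, chartJacobian, chartJacobian, h1.fderiv_eq, fderiv_comp, h2]
  · exact (LinearMap.det_comp _ _).symm
  · rw [h2]
    exact differentiableAt_coordChange he' he'' hx' hx''
  · exact differentiableAt_coordChange he he' hx hx'

theorem chartJacobian_ne_zero [IsManifold (𝓡 m) ∞ M]
    (he : e ∈ IsManifold.maximalAtlas (𝓡 m) ∞ M) (he' : e' ∈ IsManifold.maximalAtlas (𝓡 m) ∞ M)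
    (hx : x ∈ e.source) (hx' : x ∈ e'.source) : chartJacobian e e' x ≠ 0 := by
  have := chartJacobian_mul he he' he hx hx' hx
  rw [chartJacobian_self hx] at this
  exact right_ne_zero_of_mul_eq_one this

theorem continuousOn_chartJacobian [IsManifold (𝓡 m) ∞ M]
    (he : e ∈ IsManifold.maximalAtlas (𝓡 m) ∞ M) (he' : e' ∈ IsManifold.maximalAtlas (𝓡 m) ∞ M) :
    ContinuousOn (chartJacobian e e') (e.source ∩ e'.source) := by
  have h1 := (contDiffOn_coordChange he he').continuousOn_fderiv_of_isOpen
    (e.isOpen_inter_preimage_symm e'.open_source) (by simp)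
  refine ContinuousLinearMap.continuous_det.comp_continuousOn
    (h1.comp (e.continuousOn.mono inter_subset_left) fun x hx => ⟨e.map_source hx.1, ?_⟩)
  rw [mem_preimage, e.left_inv hx.1]
  exact hx.2

/-- The Jacobian is continuous and never zero, so its sign is constant on a connected overlap. -/
theorem chartJacobian_pos_of_isPreconnected [IsManifold (𝓡 m) ∞ M]
    (he : e ∈ IsManifold.maximalAtlas (𝓡 m) ∞ M) (he' : e' ∈ IsManifold.maximalAtlas (𝓡 m) ∞ M)
    (hc : IsPreconnected (e.source ∩ e'.source)) {b : M} (hb : b ∈ e.source ∩ e'.source)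
    (hpos : 0 < chartJacobian e e' b) (hx : x ∈ e.source ∩ e'.source) :
    0 < chartJacobian e e' x := by
  by_contra! hle
  obtain ⟨y, hy, hy0⟩ := hc.intermediate_value hx hb (continuousOn_chartJacobian he he')
    ⟨hle, hpos.le⟩
  exact chartJacobian_ne_zero he he' hy.1 hy.2 hy0

/-- A manifold is orientable if it has an atlas of charts whose domains have a common point and
connected pairwise intersections. -/
theorem isOrientable_of_isPreconnected_inter [IsManifold (𝓡 m) ∞ M] (hm : 0 < m) {ι : Type*}
    {e : ι → OpenPartialHomeomorph M (EuclideanSpace ℝ (Fin m))}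
    (he : ∀ i, e i ∈ IsManifold.maximalAtlas (𝓡 m) ∞ M) (hcov : ∀ x, ∃ i, x ∈ (e i).source)
    (hint : ∀ i j, IsPreconnected ((e i).source ∩ (e j).source)) {b : M}
    (hb : ∀ i, b ∈ (e i).source) : IsOrientable m M := by
  obtain ⟨R, hR⟩ := exists_continuousLinearEquiv_det_neg hm
  set c := chartAt (EuclideanSpace ℝ (Fin m)) b with hc
  have hcb : b ∈ c.source := mem_chart_source _ b
  have hcm : c ∈ IsManifold.maximalAtlas (𝓡 m) ∞ M := IsManifold.chart_mem_maximalAtlas b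
  -- Signs are normalized at the single point `b` against a reference chart, composing with a
  -- reflection where necessary.
  have hex : ∀ i, ∃ e' ∈ IsManifold.maximalAtlas (𝓡 m) ∞ M, e'.source = (e i).source ∧
      0 < chartJacobian c e' b := by
    intro i
    rcases lt_or_gt_of_ne (chartJacobian_ne_zero hcm (he i) hcb (hb i)) with h | h
    · refine ⟨(e i).trans R.toHomeomorph.toOpenPartialHomeomorph,
        mem_maximalAtlas_trans (he i) R.contDiff.contDiffOn R.symm.contDiff.contDiffOn, ?_, ?_⟩
      · simp
      · rw [chartJacobian_trans_continuousLinearEquiv]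
        exact mul_pos_of_neg_of_neg hR h
    · exact ⟨e i, he i, rfl, h⟩
  choose e' he' hs hpos using hex
  refine ⟨range e', range_subset_iff.2 he', fun x => ?_, ?_⟩
  · obtain ⟨i, hi⟩ := hcov x
    exact ⟨e' i, mem_range_self i, (hs i).symm ▸ hi⟩
  · rintro _ ⟨i, rfl⟩ _ ⟨j, rfl⟩ x hx
    have hbi : ∀ i, b ∈ (e' i).source := fun i => (hs i).symm ▸ hb i
    refine chartJacobian_pos_of_isPreconnected (he' i) (he' j) (by rw [hs, hs]; exact hint i j)
      ⟨hbi i, hbi j⟩ ?_ hx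
    have h1 := chartJacobian_mul hcm (he' i) (he' j) hcb (hbi i) (hbi j)
    exact pos_of_mul_pos_left (h1 ▸ hpos j) (hpos i).le

end Orientable

/-! ### The strata of a quasitoric manifold -/

section Quasitoric

variable {n : ℕ} {M : Type u} [TopologicalSpace M] [MulAction (Torus n) M]
  {P : Set (EuclideanSpace ℝ (Fin n))} {Φ : OrbitSpace n M ≃ₜ P}

theorem orbitProj_eq_fixedPt_iff (x : FixedPt n M) {y : M} :
    orbitProj Φ y = orbitProj Φ x ↔ y = x := by
  refine ⟨fun h => ?_, fun h => h ▸ rfl⟩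
  obtain ⟨t, rfl⟩ := (orbitProj_eq_iff Φ).1 h
  exact x.2 t

/-- The carrier of a point of the interior contains the whole orbit space. -/
theorem mem_carrierFace_of_mem_interior {y z : M} (hy : orbitProj Φ y ∈ interior P) :
    orbitProj Φ z ∈ carrierFace P (orbitProj Φ y) := by
  rw [carrierFace_eq_of_mem_interior hy]
  exact orbitProj_mem Φ z

variable [ChartedSpace (EuclideanSpace ℝ (Fin (2 * n))) M]

namespace IsQuasitoric

theorem exists_finite (hM : IsQuasitoric n M P Φ) :
    ∃ V : Set (EuclideanSpace ℝ (Fin n)), V.Finite ∧ P = convexHull ℝ V :=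
  let ⟨V, hV⟩ := hM.simple.1.1
  ⟨V, V.finite_toSet, hV⟩

theorem convex (hM : IsQuasitoric n M P Φ) : Convex ℝ P := by
  obtain ⟨V, -, hP⟩ := hM.exists_finite
  exact hP ▸ convex_convexHull ℝ V

theorem continuousSMul (hM : IsQuasitoric n M P Φ) : ContinuousSMul (Torus n) M := by
  have := hM.smooth_action
  exact ContMDiffSMul.continuousSMul (I := ModelWithCorners.pi fun _ : Fin n => 𝓡 1)
    (I' := 𝓡 (2 * n)) ∞

theorem interior_nonempty (hM : IsQuasitoric n M P Φ) : (interior P).Nonempty :=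
  hM.convex.interior_nonempty_iff_affineSpan_eq_top.2 hM.simple.1.2

theorem mem_fixedPoints_iff (hM : IsQuasitoric n M P Φ) {y : M} :
    y ∈ MulAction.fixedPoints (Torus n) M ↔ orbitProj Φ y ∈ P.extremePoints ℝ := by
  have := hM.continuousSMul
  obtain ⟨V, hV, hP⟩ := hM.exists_finite
  exact hM.diffeo.mem_fixedPoints_iff hV hP

theorem image_fixedPt (hM : IsQuasitoric n M P Φ) (F : Set (EuclideanSpace ℝ (Fin n))) :
    (fun x : FixedPt n M => orbitProj Φ x) '' {x | orbitProj Φ x ∈ F} =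
      P.extremePoints ℝ ∩ F := by
  ext p
  constructor
  · rintro ⟨x, hx, rfl⟩
    exact ⟨hM.mem_fixedPoints_iff.1 x.2, hx⟩
  · rintro ⟨hp, hpF⟩
    obtain ⟨y, rfl⟩ : p ∈ range (orbitProj Φ) := by rw [range_orbitProj]; exact hp.1
    exact ⟨⟨y, hM.mem_fixedPoints_iff.2 hp⟩, hpF, rfl⟩

theorem spanPolytope_setOf (hM : IsQuasitoric n M P Φ) (y : M) :
    spanPolytope (orbitProj Φ) {x : FixedPt n M | orbitProj Φ x ∈ carrierFace P (orbitProj Φ y)} =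
      carrierFace P (orbitProj Φ y) := by
  obtain ⟨V, hV, hP⟩ := hM.exists_finite
  rw [spanPolytope, hM.image_fixedPt,
    convexHull_extremePoints_inter_carrierFace hV hP (orbitProj_mem Φ y)]

/-- The union of the strata over the faces that contain a vertex is a coordinate cell. -/
theorem exists_chart (hM : IsQuasitoric n M P Φ) (x : FixedPt n M) :
    ∃ e ∈ IsManifold.maximalAtlas (𝓡 (2 * n)) ∞ M,
      e.source = {y | orbitProj Φ x ∈ carrierFace P (orbitProj Φ y)} ∧ e.target = univ ∧
      e (x : M) = 0 := by
  have := hM.continuousSMul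
  have := hM.hausdorff
  have := hM.compact
  have := hM.smooth
  obtain ⟨V, hV, hP⟩ := hM.exists_finite
  have hx := hM.mem_fixedPoints_iff.1 x.2
  obtain ⟨W, f, hW, hWP, hf, hcpt, hfx, hfpos⟩ := exists_radial_exhaustion hV hP hx
  -- Membership in the open star becomes the open condition `W`, so the cell is open and the
  -- exhaustion pulls back to it.
  have hO : {y : M | orbitProj Φ x ∈ carrierFace P (orbitProj Φ y)} = orbitProj Φ ⁻¹' W :=
    Set.ext fun y => hWP _ (orbitProj_mem Φ y)
  rw [hO]
  have hne : ∀ y : M, y ≠ x → orbitProj Φ y ≠ orbitProj Φ x := fun y hy h =>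
    hy ((orbitProj_eq_fixedPt_iff x).1 h)
  have hxW : orbitProj Φ (x : M) ∈ W := (hWP _ hx.1).1 (self_mem_carrierFace hx.1)
  refine exists_chart_of_exhaustion (f := fun y => f (orbitProj Φ y))
    (hW.preimage (continuous_orbitProj Φ))
    (hf.continuousOn.comp (continuous_orbitProj Φ).continuousOn (mapsTo_preimage _ _))
    (fun R => ?_) hxW (fun y hy hyx => ?_) (fun y hy hyx => ?_)
  · refine IsClosed.isCompact ?_
    convert (hcpt R).isClosed.preimage (continuous_orbitProj Φ) using 1
    ext y
    exact ⟨fun h => ⟨orbitProj_mem Φ y, h⟩, fun h => h.2⟩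
  · rw [hfx]
    exact (hfpos _ (orbitProj_mem Φ y) hy (hne y hyx)).1
  -- The radial direction at `orbitProj Φ y` is tangent to its carrier, because that face contains
  -- the vertex.
  · obtain ⟨ψ, g, g', hψ, hys⟩ := hM.diffeo.exists_isCornerChart y
    refine hψ.isPushable hV hP hys hW hf hy (u := orbitProj Φ y - orbitProj Φ x) ?_
      (hfpos _ (orbitProj_mem Φ y) hy (hne y hyx)).2.ne'
    rw [← neg_sub]
    exact neg_mem (sub_mem_vectorSpan_carrierFace (orbitProj_mem Φ y)
      ((hWP _ (orbitProj_mem Φ y)).2 hy))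

/-- The interior of a full-dimensional convex body is dense in it. This yields density of the charts
and connectedness of their overlaps. -/
theorem closure_preimage_interior (hM : IsQuasitoric n M P Φ) :
    closure (orbitProj Φ ⁻¹' interior P) = univ := by
  have := hM.continuousSMul
  rw [← closure_orbitProj_preimage Φ _ interior_subset,
    hM.convex.closure_interior_eq_closure_of_nonempty_interior hM.interior_nonempty]
  exact eq_univ_of_forall fun y => subset_closure (orbitProj_mem Φ y)

theorem exists_fixedPt_mem_carrierFace (hM : IsQuasitoric n M P Φ) (y : M) :
    ∃ x : FixedPt n M, orbitProj Φ x ∈ carrierFace P (orbitProj Φ y) := by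
  obtain ⟨V, hV, hP⟩ := hM.exists_finite
  obtain ⟨v, hv⟩ := exists_extremePoint_mem_carrierFace hV hP (orbitProj_mem Φ y)
  have hv' : v ∈ P.extremePoints ℝ ∩ carrierFace P (orbitProj Φ y) := hv
  rw [← hM.image_fixedPt] at hv'
  obtain ⟨x, hx, -⟩ := hv'
  exact ⟨x, hx⟩

/-- The atlas of a quasitoric manifold that consists of one coordinate cell for each vertex. -/
def invariantAtlas (hM : IsQuasitoric n M P Φ) : InvariantAtlas n n M where
  chart x := (hM.exists_chart x).choose
  smooth x := (hM.exists_chart x).choose_spec.1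
  cover := eq_univ_of_forall fun y => mem_iUnion.2 (by
    obtain ⟨x, hx⟩ := hM.exists_fixedPt_mem_carrierFace y
    exact ⟨x, (hM.exists_chart x).choose_spec.2.1.symm ▸ hx⟩)
  target x := (hM.exists_chart x).choose_spec.2.2.1
  invariant x t y hy := by
    rw [(hM.exists_chart x).choose_spec.2.1] at hy ⊢
    rwa [mem_ofPred_eq, orbitProj_smul]
  fixed x := by
    rw [(hM.exists_chart x).choose_spec.2.1]
    refine subset_antisymm ?_ (singleton_subset_iff.2
      ⟨self_mem_carrierFace (orbitProj_mem Φ (x : M)), x.2⟩)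
    rintro y ⟨hy, hyf⟩
    rw [mem_ofPred_eq, carrierFace_of_mem_extremePoints (hM.mem_fixedPoints_iff.1 hyf)] at hy
    exact (orbitProj_eq_fixedPt_iff (Φ := Φ) x).1 (Eq.symm hy)
  zero x := (hM.exists_chart x).choose_spec.2.2.2
  dense x := by
    rw [(hM.exists_chart x).choose_spec.2.1]
    exact (dense_iff_closure_eq.2 hM.closure_preimage_interior).mono
      fun y hy => mem_carrierFace_of_mem_interior hy

theorem invariantAtlas_source (hM : IsQuasitoric n M P Φ) (x : FixedPt n M) :
    (hM.invariantAtlas.chart x).source =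
      {y | orbitProj Φ x ∈ carrierFace P (orbitProj Φ y)} :=
  (hM.exists_chart x).choose_spec.2.1

theorem typeOf_eq (hM : IsQuasitoric n M P Φ) (y : M) : hM.invariantAtlas.typeOf y =
    {x : FixedPt n M | orbitProj Φ x ∈ carrierFace P (orbitProj Φ y)} := by
  ext x
  rw [InvariantAtlas.typeOf, mem_ofPred_eq, hM.invariantAtlas_source]
  rfl

theorem spanPolytope_typeOf (hM : IsQuasitoric n M P Φ) (y : M) :
    spanPolytope (orbitProj Φ) (hM.invariantAtlas.typeOf y) = carrierFace P (orbitProj Φ y) := by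
  rw [hM.typeOf_eq, hM.spanPolytope_setOf]

theorem spanPolytope_of_mem_stratum (hM : IsQuasitoric n M P Φ) {σ : Set (FixedPt n M)} {y : M}
    (hy : y ∈ hM.invariantAtlas.stratum σ) :
    spanPolytope (orbitProj Φ) σ = carrierFace P (orbitProj Φ y) := by
  rw [← hM.spanPolytope_typeOf, show hM.invariantAtlas.typeOf y = σ from hy]

/-- The carrier determines the index set by `typeOf_eq`, and the hull of the index set gives back
the carrier. -/
theorem mem_stratum_iff (hM : IsQuasitoric n M P Φ) {σ : Set (FixedPt n M)}
    (hσ : (hM.invariantAtlas.stratum σ).Nonempty) {y : M} :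
    y ∈ hM.invariantAtlas.stratum σ ↔
      carrierFace P (orbitProj Φ y) = spanPolytope (orbitProj Φ) σ := by
  obtain ⟨z, hz⟩ := hσ
  refine ⟨fun hy => (hM.spanPolytope_of_mem_stratum hy).symm, fun hy => ?_⟩
  change hM.invariantAtlas.typeOf y = σ
  rw [← show hM.invariantAtlas.typeOf z = σ from hz, hM.typeOf_eq, hM.typeOf_eq, hy,
    hM.spanPolytope_of_mem_stratum hz]

theorem intrinsicInterior_spanPolytope (hM : IsQuasitoric n M P Φ) {σ : Set (FixedPt n M)}
    (hσ : (hM.invariantAtlas.stratum σ).Nonempty) :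
    intrinsicInterior ℝ (spanPolytope (orbitProj Φ) σ) =
      {q | q ∈ P ∧ carrierFace P q = spanPolytope (orbitProj Φ) σ} := by
  obtain ⟨z, hz⟩ := hσ
  rw [hM.spanPolytope_of_mem_stratum hz, intrinsicInterior_carrierFace hM.convex]

theorem mem_intrinsicInterior_iff (hM : IsQuasitoric n M P Φ) {σ : Set (FixedPt n M)}
    (hσ : (hM.invariantAtlas.stratum σ).Nonempty) {y : M} :
    orbitProj Φ y ∈ intrinsicInterior ℝ (spanPolytope (orbitProj Φ) σ) ↔
      y ∈ hM.invariantAtlas.stratum σ := by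
  rw [hM.intrinsicInterior_spanPolytope hσ, hM.mem_stratum_iff hσ]
  exact and_iff_right (orbitProj_mem Φ y)

theorem closure_stratum (hM : IsQuasitoric n M P Φ) {σ : Set (FixedPt n M)}
    (hσ : (hM.invariantAtlas.stratum σ).Nonempty) :
    closure (hM.invariantAtlas.stratum σ) =
      orbitProj Φ ⁻¹' spanPolytope (orbitProj Φ) σ := by
  have := hM.continuousSMul
  obtain ⟨V, hV, hP⟩ := hM.exists_finite
  have h1 : hM.invariantAtlas.stratum σ =
      orbitProj Φ ⁻¹' {q | q ∈ P ∧ carrierFace P q = spanPolytope (orbitProj Φ) σ} := by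
    ext y
    rw [← hM.mem_intrinsicInterior_iff hσ, hM.intrinsicInterior_spanPolytope hσ, mem_preimage]
  rw [h1, ← closure_orbitProj_preimage Φ _ fun q hq => hq.1]
  congr 1
  obtain ⟨z, hz⟩ := hσ
  rw [hM.spanPolytope_of_mem_stratum hz]
  refine subset_antisymm (closure_minimal ?_
    (isCompact_carrierFace hV hP (orbitProj_mem Φ z)).isClosed)
    (carrierFace_subset_closure hM.convex (orbitProj_mem Φ z))
  rintro q ⟨hq, h⟩
  exact h ▸ self_mem_carrierFace hq

/-- The overlap lies between the preimage of the interior of `P`, which is connected, and the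
closure of that preimage, which is all of `M`. -/
theorem isPreconnected_inter_source (hM : IsQuasitoric n M P Φ) (x x' : FixedPt n M) :
    IsPreconnected ((hM.invariantAtlas.chart x).source ∩ (hM.invariantAtlas.chart x').source) := by
  have := hM.continuousSMul
  refine (isPreconnected_orbitProj_preimage Φ interior_subset
    hM.convex.interior.isPreconnected).subset_closure ?_
    (by rw [hM.closure_preimage_interior]; exact subset_univ _)
  rw [hM.invariantAtlas_source, hM.invariantAtlas_source]
  exact fun y hy => ⟨mem_carrierFace_of_mem_interior hy, mem_carrierFace_of_mem_interior hy⟩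

theorem exists_forall_mem_source (hM : IsQuasitoric n M P Φ) :
    ∃ b : M, ∀ x, b ∈ (hM.invariantAtlas.chart x).source := by
  obtain ⟨p, hp⟩ := hM.interior_nonempty
  obtain ⟨b, rfl⟩ : p ∈ range (orbitProj Φ) := by rw [range_orbitProj]; exact interior_subset hp
  exact ⟨b, fun x => (hM.invariantAtlas_source x).symm ▸ mem_carrierFace_of_mem_interior hp⟩

theorem exists_mem_source (hM : IsQuasitoric n M P Φ) (y : M) :
    ∃ x, y ∈ (hM.invariantAtlas.chart x).source :=
  mem_iUnion.1 (hM.invariantAtlas.cover.symm ▸ mem_univ y)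

theorem isOrientable (hM : IsQuasitoric n M P Φ) (hn : 1 ≤ n) : IsOrientable (2 * n) M := by
  have := hM.smooth
  obtain ⟨b, hb⟩ := hM.exists_forall_mem_source
  exact isOrientable_of_isPreconnected_inter (by omega) hM.invariantAtlas.smooth
    hM.exists_mem_source hM.isPreconnected_inter_source hb

theorem simplyConnectedSpace (hM : IsQuasitoric n M P Φ) : SimplyConnectedSpace M := by
  obtain ⟨b, hb⟩ := hM.exists_forall_mem_source
  have := ChartedSpace.locallyPathConnectedSpace (EuclideanSpace ℝ (Fin (2 * n))) M
  refine simplyConnectedSpace_of_open_cover (fun x => (hM.invariantAtlas.chart x).open_source)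
    hM.exists_mem_source (fun x => ?_) (fun x x' => ?_) hb
  · have e := ((hM.invariantAtlas.chart x).toHomeomorphSourceTarget.trans
      (Homeomorph.setCongr (hM.invariantAtlas.target x))).trans (Homeomorph.Set.univ _)
    exact e.toHomotopyEquiv.simplyConnectedSpace
  · rw [← ((hM.invariantAtlas.chart x).open_source.inter
      (hM.invariantAtlas.chart x').open_source).isConnected_iff_isPathConnected]
    exact ⟨⟨b, hb x, hb x'⟩, hM.isPreconnected_inter_source x x'⟩

theorem isTorusSetting (hM : IsQuasitoric n M P Φ) (hn : 1 ≤ n) :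
    IsTorusSetting n n M (orbitProj Φ) where
  one_le := hn
  le := le_rfl
  hausdorff := hM.hausdorff
  compact := hM.compact
  smooth := hM.smooth
  orientable := hM.isOrientable hn
  simplyConnected := hM.simplyConnectedSpace
  smooth_action := hM.smooth_action
  effective := by
    have := hM.continuousSMul
    obtain ⟨V, hV, hP⟩ := hM.exists_finite
    exact hM.diffeo.faithfulSMul hV hP hM.simple.1.2
  connected_stabilizer := hM.diffeo.isConnected_stabilizer
  continuous_map := continuous_orbitProj Φ
  invariant_map := orbitProj_smul Φ
  open_map := by
    have := hM.continuousSMul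
    exact (Homeomorph.setCongr (range_orbitProj Φ).symm).isOpenMap.comp (isOpenMap_orbitProj Φ)
  polytope := by
    rw [range_orbitProj]
    exact hM.simple.1

/-! ### Trivializations, leaves and spaces of parameters. -/

theorem mem_orbitStratum_iff (hM : IsQuasitoric n M P Φ) {σ : Set (FixedPt n M)}
    (hσ : (hM.invariantAtlas.stratum σ).Nonempty) {w : OrbitSpace n M} :
    w ∈ hM.invariantAtlas.orbitStratum σ ↔
      (Φ w : EuclideanSpace ℝ (Fin n)) ∈ intrinsicInterior ℝ (spanPolytope (orbitProj Φ) σ) := by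
  obtain ⟨y, rfl⟩ := Quotient.exists_rep w
  change orbitMk n y ∈ _ ↔ orbitProj Φ y ∈ _
  refine ⟨?_, fun h => ⟨y, (hM.mem_intrinsicInterior_iff hσ).1 h, rfl⟩⟩
  rintro ⟨z, hz, hzy⟩
  rw [orbitProj, ← hzy]
  exact (hM.mem_intrinsicInterior_iff hσ).2 hz

theorem intrinsicInterior_spanPolytope_subset (hM : IsQuasitoric n M P Φ)
    {σ : Set (FixedPt n M)} (hσ : (hM.invariantAtlas.stratum σ).Nonempty) :
    intrinsicInterior ℝ (spanPolytope (orbitProj Φ) σ) ⊆ P := by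
  rw [hM.intrinsicInterior_spanPolytope hσ]
  exact fun q hq => hq.1

/-- The orbit space of a stratum is the relative interior of a face. -/
def orbitStratumHomeomorph (hM : IsQuasitoric n M P Φ) (σ : Set (FixedPt n M))
    (hσ : (hM.invariantAtlas.stratum σ).Nonempty) : hM.invariantAtlas.orbitStratum σ ≃ₜ
      intrinsicInterior ℝ (spanPolytope (orbitProj Φ) σ) × PUnit.{u + 1} where
  toFun w := (⟨Φ w, (hM.mem_orbitStratum_iff hσ).1 w.2⟩, PUnit.unit)
  invFun q := ⟨Φ.symm ⟨q.1, hM.intrinsicInterior_spanPolytope_subset hσ q.1.2⟩,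
    (hM.mem_orbitStratum_iff hσ).2 (by rw [Φ.apply_symm_apply]; exact q.1.2)⟩
  left_inv w := Subtype.ext (Φ.symm_apply_apply w)
  right_inv q := Prod.ext (Subtype.ext (by
    change ((Φ (Φ.symm _) : P) : EuclideanSpace ℝ (Fin n)) = _
    rw [Φ.apply_symm_apply])) rfl
  continuous_toFun := by fun_prop
  continuous_invFun := by fun_prop

/-- The first four axioms for a quasitoric manifold. All spaces of parameters are points. -/
def torusStrata (hM : IsQuasitoric n M P Φ) (hn : 1 ≤ n) :
    TorusStrata n n M (orbitProj Φ) where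
  setting := hM.isTorusSetting hn
  atlas := hM.invariantAtlas
  bijOn_vertices := by
    rw [range_orbitProj]
    refine ⟨fun y hy => hM.mem_fixedPoints_iff.1 hy, fun y _ z hz h => ?_, fun p hp => ?_⟩
    · exact (orbitProj_eq_fixedPt_iff (Φ := Φ) ⟨z, hz⟩).1 h
    · obtain ⟨y, rfl⟩ : p ∈ range (orbitProj Φ) := by rw [range_orbitProj]; exact hp.1
      exact ⟨y, hM.mem_fixedPoints_iff.2 hp, rfl⟩
  stabilizer_eq σ y hy z hz := by
    have := hM.continuousSMul
    obtain ⟨V, hV, hP⟩ := hM.exists_finite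
    refine hM.diffeo.stabilizer_eq hV hP ?_
    rw [← hM.spanPolytope_of_mem_stratum hy, hM.spanPolytope_of_mem_stratum hz]
  mapsTo σ y hy := (hM.mem_intrinsicInterior_iff ⟨y, hy⟩).2 hy
  torus_dim σ y hy := by
    have := hM.continuousSMul
    obtain ⟨V, hV, hP⟩ := hM.exists_finite
    rw [hM.spanPolytope_of_mem_stratum hy]
    exact hM.diffeo.nonempty_quotient_stabilizer hV hP y
  F _ := PUnit
  topF _ := inferInstance
  h := hM.orbitStratumHomeomorph
  h_fst _ _ _ _ := rfl

theorem leaf_eq (hM : IsQuasitoric n M P Φ) (hn : 1 ≤ n) (σ : Set (FixedPt n M))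
    (hσ : (hM.invariantAtlas.stratum σ).Nonempty) (c : PUnit.{u + 1}) :
    (hM.torusStrata hn).leaf σ hσ c = hM.invariantAtlas.stratum σ :=
  Set.ext fun _ => ⟨fun ⟨h, _⟩ => h, fun h => ⟨h, rfl⟩⟩

theorem admissiblePolytopes_eq (hM : IsQuasitoric n M P Φ) (hn : 1 ≤ n) :
    (hM.torusStrata hn).admissiblePolytopes = {F | IsFace P F} := by
  obtain ⟨V, hV, hP⟩ := hM.exists_finite
  ext F
  constructor
  · rintro ⟨σ, ⟨y, hy⟩, rfl⟩
    rw [mem_ofPred_eq, hM.spanPolytope_of_mem_stratum hy]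
    exact ⟨⟨_, self_mem_carrierFace (orbitProj_mem Φ y)⟩,
      isExposed_carrierFace hV hP (orbitProj_mem Φ y)⟩
  · rintro ⟨hne, hF⟩
    obtain ⟨p, hp, rfl⟩ := exists_carrierFace_eq_of_isExposed hM.convex hF hne
    obtain ⟨y, rfl⟩ : p ∈ range (orbitProj Φ) := by rw [range_orbitProj]; exact hp
    exact ⟨_, ⟨y, rfl⟩, hM.spanPolytope_typeOf y⟩

/-- The boundary of a stratum is a union of strata over proper faces. -/
theorem boundary_stratum (hM : IsQuasitoric n M P Φ) {σ : Set (FixedPt n M)}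
    (hσ : (hM.invariantAtlas.stratum σ).Nonempty) :
    ∃ B : Set (Set (FixedPt n M)), (∀ τ ∈ B, (hM.invariantAtlas.stratum τ).Nonempty) ∧
      (∀ τ ∈ B, IsFace (spanPolytope (orbitProj Φ) σ) (spanPolytope (orbitProj Φ) τ) ∧
        spanPolytope (orbitProj Φ) τ ≠ spanPolytope (orbitProj Φ) σ) ∧
      closure (hM.invariantAtlas.stratum σ) \ hM.invariantAtlas.stratum σ =
        ⋃ τ ∈ B, hM.invariantAtlas.stratum τ := by
  obtain ⟨V, hV, hP⟩ := hM.exists_finite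
  -- Lying in the boundary depends only on the carrier of `orbitProj Φ y`, so the boundary is a
  -- union of whole strata, indexed by the types of its points.
  have hmem : ∀ y, y ∈ closure (hM.invariantAtlas.stratum σ) \ hM.invariantAtlas.stratum σ ↔
      carrierFace P (orbitProj Φ y) ⊆ spanPolytope (orbitProj Φ) σ ∧
        carrierFace P (orbitProj Φ y) ≠ spanPolytope (orbitProj Φ) σ := by
    intro y
    rw [mem_sdiff, hM.mem_stratum_iff hσ, hM.closure_stratum hσ, mem_preimage]
    refine and_congr_left fun _ => ⟨fun h => ?_,
      fun h => h (self_mem_carrierFace (orbitProj_mem Φ y))⟩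
    obtain ⟨z, hz⟩ := hσ
    rw [hM.spanPolytope_of_mem_stratum hz] at h ⊢
    exact carrierFace_subset_of_mem hM.convex h
  refine ⟨hM.invariantAtlas.typeOf ''
    (closure (hM.invariantAtlas.stratum σ) \ hM.invariantAtlas.stratum σ), ?_, ?_, ?_⟩
  · rintro _ ⟨y, -, rfl⟩
    exact ⟨y, rfl⟩
  · rintro _ ⟨y, hy, rfl⟩
    rw [hmem] at hy
    rw [hM.spanPolytope_typeOf]
    refine ⟨⟨⟨_, self_mem_carrierFace (orbitProj_mem Φ y)⟩, ?_⟩, hy.2⟩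
    obtain ⟨z, hz⟩ := hσ
    -- A face exposed in `P` is exposed in every smaller set that contains it, in particular in
    -- `P_σ`.
    refine (isExposed_carrierFace hV hP (orbitProj_mem Φ y)).mono ?_ hy.1
    rw [hM.spanPolytope_of_mem_stratum hz]
    exact carrierFace_subset
  · ext y
    rw [mem_iUnion₂]
    constructor
    · exact fun hy => ⟨_, mem_image_of_mem _ hy, rfl⟩
    · rintro ⟨_, ⟨z, hz, rfl⟩, hy⟩
      rw [hmem] at hz ⊢
      rwa [← hM.spanPolytope_of_mem_stratum hy, hM.spanPolytope_typeOf]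

/-- The canonical map from `M` to the complex is onto; this puts the values of `H` in `𝔈(M, P) /
T^n`. -/
theorem exists_orbitProj_eq (hM : IsQuasitoric n M P Φ) (hn : 1 ≤ n)
    (q : (hM.torusStrata hn).Complex) : ∃ y : M, orbitProj Φ y = q.1.2 ∧
      spanPolytope (orbitProj Φ) (hM.invariantAtlas.typeOf y) = q.1.1 := by
  obtain ⟨⟨Q, p⟩, ⟨σ, hσ, hQ⟩, hp⟩ := q
  change spanPolytope _ σ = Q at hQ
  subst hQ
  obtain ⟨y, rfl⟩ : p ∈ range (orbitProj Φ) := by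
    rw [range_orbitProj]
    exact hM.intrinsicInterior_spanPolytope_subset hσ hp
  exact ⟨y, rfl, by rw [show hM.invariantAtlas.typeOf y = σ from
    (hM.mem_intrinsicInterior_iff hσ).1 hp]⟩

theorem snd_mem (hM : IsQuasitoric n M P Φ) (hn : 1 ≤ n) (q : (hM.torusStrata hn).Complex) :
    q.1.2 ∈ P := by
  obtain ⟨y, hy, -⟩ := hM.exists_orbitProj_eq hn q
  exact hy ▸ orbitProj_mem Φ y

/-- The complex carries the quotient topology, so only the composite with the canonical map matters,
and that composite is the orbit projection. -/
theorem continuous_snd (hM : IsQuasitoric n M P Φ) (hn : 1 ≤ n) :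
    Continuous fun q : (hM.torusStrata hn).Complex => q.1.2 :=
  continuous_coinduced_dom.2 (continuous_orbitProj Φ)

/-- The sixth axiom for a quasitoric manifold: the universal space of parameters is a point. -/
def universalParameters (hM : IsQuasitoric n M P Φ) (hn : 1 ≤ n) :
    (hM.torusStrata hn).UniversalParameters where
  U := PUnit
  topU := inferInstance
  compact := inferInstance
  hausdorff := inferInstance
  incl := id
  incl_dense := IsDenseEmbedding.id
  V _ := univ
  cover _ := by
    obtain ⟨b, -⟩ := hM.exists_forall_mem_source
    exact ⟨_, ⟨b, rfl⟩, mem_univ _⟩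
  p _ _ := PUnit.unit
  p_continuous _ _ := continuous_const
  p_surjective _ _ _ := ⟨⟨PUnit.unit, mem_univ _⟩, rfl⟩
  -- One formula serves all cells at once, so continuity need not be checked across the boundaries
  -- between cells.
  H e := ⟨(e.1.1, Φ.symm ⟨e.1.1.1.2, hM.snd_mem hn e.1.1⟩), by
    obtain ⟨y, hy, hyq⟩ := hM.exists_orbitProj_eq hn e.1.1
    refine ⟨_, hyq.symm, y, rfl, ?_, hy.symm⟩
    exact (Φ.symm_apply_eq.2 (Subtype.ext hy.symm)).symm⟩
  H_apply _ _ _ _ _ _ := rfl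
  H_continuous := by
    have h1 : Continuous fun e : {e : (hM.torusStrata hn).Complex × PUnit.{u + 1} |
        ∃ σ, ((hM.torusStrata hn).atlas.stratum σ).Nonempty ∧
          e.1 ∈ (hM.torusStrata hn).cell σ ∧ e.2 ∈ univ} => e.1.1 :=
      continuous_fst.comp continuous_subtype_val
    exact (h1.prodMk (Φ.symm.continuous.comp
      (((hM.continuous_snd hn).comp h1).subtype_mk _))).subtype_mk _

end IsQuasitoric

end Quasitoric

end

/-! ### Assembly of the six axioms. -/

theorem mainTheorem9 {n : ℕ} (hn : 1 ≤ n) {M : Type u} [TopologicalSpace M]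
    [ChartedSpace (EuclideanSpace ℝ (Fin (2 * n))) M] [MulAction (Torus n) M]
    (P : Set (EuclideanSpace ℝ (Fin n))) (Φ : OrbitSpace n M ≃ₜ P)
    (hM : IsQuasitoric n M P Φ) :
    ∃ S : TwoNKManifold n n M (fun y => (Φ (orbitMk n y) : EuclideanSpace ℝ (Fin n))),
      S.admissiblePolytopes = {F | IsFace P F} := by
  change ∃ S : TwoNKManifold n n M (orbitProj Φ), S.admissiblePolytopes = {F | IsFace P F}
  refine ⟨{ hM.torusStrata hn with
    leaf_boundary := fun σ hσ c => ?_
    universal := hM.universalParameters hn }, hM.admissiblePolytopes_eq hn⟩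
  obtain ⟨B, hB, hface, hB'⟩ := hM.boundary_stratum hσ
  refine ⟨B, hB, fun _ _ => PUnit.unit, hface, ?_⟩
  change closure ((hM.torusStrata hn).leaf σ hσ c) \ (hM.torusStrata hn).leaf σ hσ c =
    ⋃ (τ) (hτ : τ ∈ B), (hM.torusStrata hn).leaf τ (hB τ hτ) PUnit.unit
  have h := hM.leaf_eq hn σ hσ c
  rw [h, hB']
  simp only [hM.leaf_eq hn]
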